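/- Let $p$ be an odd prime, let $d\ge 0$ be an integer, and let $V$ be a vector space of dimension $2(d+1)$ over $\mathbb{F}_p$ with a nondegenerate symmetric bilinear form $[\cdot,\cdot]\colon V\times V\to\mathbb{F}_p$ that is nonsplit, i.e. $V$ has no totally isotropic subspace of dimension $d+1$. For an $\mathbb{F}_{p^2}$-scheme $S$, let $\mathrm{Frob}\colon S\to S$ be the absolute $p$-power Frobenius, and identify $\mathrm{Frob}^*(V\otimes_{\mathbb{F}_p}\mathcal{O}_S)$ with $V\otimes_{\mathbb{F}_p}\mathcal{O}_S$. Let $\mathscr{Y}_V(S)$ be the set of pairs $(\mathcal{L}_d,\mathcal{L}_{d+1})$ of $\mathcal{O}_S$-submodules $\mathcal{L}_d\subseteq\mathcal{L}_{d+1}$ of $V\otimes_{\mathbb{F}_p}\mathcal{O}_S$ such that 1. for $r=d,d+1$, $\mathcal{L}_r$ is locally a direct summand of $V\otimes_{\mathbb{F}_p}\mathcal{O}_S$ of rank $r$ and is totally isotropic for the $\mathcal{O}_S$-bilinear extension of $[\cdot,\cdot]$; 2. $\mathcal{L}_d\subseteq\mathrm{Frob}^*\mathcal{L}_{d+1}$;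 3. $\mathcal{L}_{d+1}+\mathrm{Frob}^*\mathcal{L}_{d+1}$ is locally a direct summand of $V\otimes_{\mathbb{F}_p}\mathcal{O}_S$. Then the functor $S\mapsto\mathscr{Y}_V(S)$ on $\mathbb{F}_{p^2}$-schemes (with pull-back of submodules) is representable by an $\mathbb{F}_{p^2}$-scheme, and every $\mathbb{F}_{p^2}$-scheme $\mathscr{Y}_V$ representing it is smooth over $\mathbb{F}_{p^2}$. -/

import Mathlib

open CategoryTheory AlgebraicGeometry TensorProduct

universe u v

noncomputable section

namespace OrthDL

/-- A scheme over `Spec k`. -/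
abbrev Sch (k : Type u) [Field k] := Over (Spec (CommRingCat.of k))

/-- The ring homomorphism `k → Γ(S, U)` given by the structure morphism of a `k`-scheme `S`. -/
def structureHom {k : Type u} [Field k] (S : Sch k) (U : S.left.Opens) : k →+* Γ(S.left, U) :=
  (S.hom.appLE ⊤ U le_top).hom.comp (Scheme.ΓSpecIso (CommRingCat.of k)).inv.hom

/-- The rings of sections of a scheme over a field `k` of characteristic `p` are
`𝔽_p`-algebras, through `𝔽_p → k → Γ(S, U)`. -/
instance algebraSections {p : ℕ} [Fact p.Prime] {k : Type u} [Field k] [Algebra (ZMod p) k]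
    (S : Sch k) (U : S.left.Opens) : Algebra (ZMod p) Γ(S.left, U) :=
  ((structureHom S U).comp (algebraMap (ZMod p) k)).toAlgebra

/-- Every ring homomorphism of `𝔽_p`-algebras is a homomorphism of `𝔽_p`-algebras. -/
def toAlgHom (p : ℕ) {R R' : Type*} [CommRing R] [CommRing R'] [Algebra (ZMod p) R]
    [Algebra (ZMod p) R'] (φ : R →+* R') : R →ₐ[ZMod p] R' where
  __ := φ
  commutes' r := congrArg (fun ψ : ZMod p →+* R' => ψ r)
    (Subsingleton.elim (φ.comp (algebraMap (ZMod p) R)) (algebraMap (ZMod p) R'))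

section

variable (p : ℕ) [Fact p.Prime] {k : Type u} [Field k] [Algebra (ZMod p) k]
  (V : Type v) [AddCommGroup V] [Module (ZMod p) V]

/-- The sections of `V ⊗ 𝒪_S` over the open set `U` (here `V` is a finite-dimensional vector
space over `𝔽_p`, so that no sheafification is needed). -/
abbrev Sect (S : Sch k) (U : S.left.Opens) := Γ(S.left, U) ⊗[ZMod p] V

/-- For a morphism `f : T ⟶ S` of `k`-schemes, an open `U` of `S` and an open `W` of `T` with
`W ⊆ f⁻¹(U)`, the map `V ⊗ 𝒪_S(U) → V ⊗ 𝒪_T(W)` induced by `f`. -/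
def pull {S T : Sch k} (f : T ⟶ S) {U : S.left.Opens} {W : T.left.Opens}
    (h : W ≤ f.left ⁻¹ᵁ U) : Sect p V S U →ₗ[ZMod p] Sect p V T W :=
  (toAlgHom p (f.left.appLE U W h).hom).toLinearMap.rTensor V

/-- Restriction of sections of `V ⊗ 𝒪_S` from `U` to a smaller open set `W`. -/
def res {S : Sch k} {U W : S.left.Opens} (h : W ≤ U) : Sect p V S U →ₗ[ZMod p] Sect p V S W :=
  (toAlgHom p (S.left.presheaf.map (homOfLE h).op).hom).toLinearMap.rTensor V

/-- The map `v ⊗ a ↦ v ⊗ a ^ p` on sections of `V ⊗ 𝒪_S`. (The absolute Frobenius of `S` is the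
identity on the topological space and `a ↦ a ^ p` on sections of `𝒪_S`.) -/
def frob (S : Sch k) (U : S.left.Opens) : Sect p V S U →ₗ[ZMod p] Sect p V S U :=
  (FiniteField.frobeniusAlgHom (ZMod p) Γ(S.left, U)).toLinearMap.rTensor V

variable {p V}

lemma res_refl {S : Sch k} {U : S.left.Opens} (t : Sect p V S U) :
    res p V (le_refl U) t = t := by
  have h : (toAlgHom p (S.left.presheaf.map (homOfLE (le_refl U)).op).hom)
      = AlgHom.id (ZMod p) Γ(S.left, U) := by
    ext a
    change (S.left.presheaf.map (𝟙 _)) a = a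
    simp
  simp only [res, h]
  exact LinearMap.congr_fun (LinearMap.rTensor_id V Γ(S.left, U)) t

lemma res_res {S : Sch k} {U W W' : S.left.Opens} (h : W ≤ U) (h' : W' ≤ W)
    (t : Sect p V S U) : res p V h' (res p V h t) = res p V (h'.trans h) t := by
  have e : (toAlgHom p (S.left.presheaf.map (homOfLE (h'.trans h)).op).hom)
      = (toAlgHom p (S.left.presheaf.map (homOfLE h').op).hom).comp
        (toAlgHom p (S.left.presheaf.map (homOfLE h).op).hom) := by
    ext a
    change (S.left.presheaf.map ((homOfLE h).op ≫ (homOfLE h').op)) a = _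
    rw [Functor.map_comp]
    rfl
  simp only [res, e]
  rw [AlgHom.comp_toLinearMap, LinearMap.rTensor_comp]
  rfl

lemma res_smul {S : Sch k} {U W : S.left.Opens} (h : W ≤ U) (a : Γ(S.left, U))
    (t : Sect p V S U) :
    res p V h (a • t) = (S.left.presheaf.map (homOfLE h).op).hom a • res p V h t := by
  induction t using TensorProduct.induction_on with
  | zero => simp
  | tmul b x =>
    change ((S.left.presheaf.map (homOfLE h).op).hom (a * b)) ⊗ₜ[ZMod p] x = _
    rw [map_mul]
    rfl
  | add s t hs ht => rw [smul_add, map_add, hs, ht, map_add, smul_add]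

variable (p V)

/-- A subsheaf of `𝒪_S`-modules of `V ⊗ 𝒪_S`. -/
@[ext]
structure Subsheaf (S : Sch k) where
  /-- The submodule of sections over an open set. -/
  sec : ∀ U : S.left.Opens, Submodule Γ(S.left, U) (Sect p V S U)
  res_mem : ∀ {U W : S.left.Opens} (h : W ≤ U) {t : Sect p V S U},
    t ∈ sec U → res p V h t ∈ sec W
  local_mem : ∀ {U : S.left.Opens} {t : Sect p V S U},
    (∀ x ∈ U, ∃ (W : S.left.Opens) (h : W ≤ U), x ∈ W ∧ res p V h t ∈ sec W) → t ∈ sec U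

variable {p V}

namespace Subsheaf

variable {S T : Sch k}

/-- The sections over `W` which are restrictions of elements of a given family `G` of sections. -/
def restrictions (G : ∀ U : S.left.Opens, Set (Sect p V S U)) (W : S.left.Opens) :
    Set (Sect p V S W) :=
  {t | ∃ (U : S.left.Opens) (h : W ≤ U), ∃ g ∈ G U, t = res p V h g}

lemma res_span (G : ∀ U : S.left.Opens, Set (Sect p V S U)) {U W : S.left.Opens} (h : W ≤ U)
    {t : Sect p V S U} (ht : t ∈ Submodule.span Γ(S.left, U) (restrictions G U)) :
    res p V h t ∈ Submodule.span Γ(S.left, W) (restrictions G W) := by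
  induction ht using Submodule.span_induction with
  | mem t ht =>
    obtain ⟨U', h', g, hg, rfl⟩ := ht
    rw [res_res]
    exact Submodule.subset_span ⟨U', h.trans h', g, hg, rfl⟩
  | zero => rw [map_zero]; exact Submodule.zero_mem _
  | add s t _ _ hs ht => rw [map_add]; exact Submodule.add_mem _ hs ht
  | smul a t _ ht => rw [res_smul]; exact Submodule.smul_mem _ _ ht

/-- The subsheaf of `𝒪_S`-modules generated by a family of local sections: a section belongs to
it if locally it is a linear combination of (restrictions of) members of the family. -/
def gen (G : ∀ U : S.left.Opens, Set (Sect p V S U)) : Subsheaf p V S where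
  sec U :=
    { carrier := {t | ∀ x ∈ U, ∃ (W : S.left.Opens) (h : W ≤ U), x ∈ W ∧
        res p V h t ∈ Submodule.span Γ(S.left, W) (restrictions G W)}
      zero_mem' := fun x hx => ⟨U, le_rfl, hx, by rw [map_zero]; exact Submodule.zero_mem _⟩
      add_mem' := by
        intro s t hs ht x hx
        obtain ⟨W, h, hxW, hW⟩ := hs x hx
        obtain ⟨W', h', hxW', hW'⟩ := ht x hx
        refine ⟨W ⊓ W', inf_le_left.trans h, ⟨hxW, hxW'⟩, ?_⟩
        rw [map_add]
        refine Submodule.add_mem _ ?_ ?_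
        · rw [← res_res h inf_le_left]
          exact res_span G _ hW
        · rw [← res_res h' inf_le_right]
          exact res_span G _ hW'
      smul_mem' := by
        intro a t ht x hx
        obtain ⟨W, h, hxW, hW⟩ := ht x hx
        refine ⟨W, h, hxW, ?_⟩
        rw [res_smul]
        exact Submodule.smul_mem _ _ hW }
  res_mem := by
    intro U W h t ht x hx
    obtain ⟨W', h', hxW', hW'⟩ := ht x (h hx)
    refine ⟨W ⊓ W', inf_le_left, ⟨hx, hxW'⟩, ?_⟩
    have e := res_span G (inf_le_right : W ⊓ W' ≤ W') hW'
    rw [res_res] at e ⊢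
    exact e
  local_mem := by
    intro U t ht x hx
    obtain ⟨W, h, hxW, hW⟩ := ht x hx
    obtain ⟨W', h', hxW', hW'⟩ := hW x hxW
    rw [res_res] at hW'
    exact ⟨W', h'.trans h, hxW', hW'⟩

/-- The sum `L + M` of two subsheaves of `𝒪_S`-modules of `V ⊗ 𝒪_S`. -/
def add (L M : Subsheaf p V S) : Subsheaf p V S :=
  gen fun U => {t | t ∈ L.sec U ∨ t ∈ M.sec U}

/-- The pull-back `f^* L` of a subsheaf of `V ⊗ 𝒪_S` along `f : T ⟶ S`, as a subsheaf of
`f^*(V ⊗ 𝒪_S) = V ⊗ 𝒪_T`: the `𝒪_T`-submodule generated by the pull-backs of the sections of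
`L`. (When `L` is locally a direct summand, the module pull-back of `L` injects into
`V ⊗ 𝒪_T`, and this is its image.) -/
def pullback (f : T ⟶ S) (L : Subsheaf p V S) : Subsheaf p V T :=
  gen fun W => {t | ∃ (U : S.left.Opens) (h : W ≤ f.left ⁻¹ᵁ U), ∃ s ∈ L.sec U, t = pull p V f h s}

/-- The pull-back `Frob^* L` along the `p`-power Frobenius `Frob : S → S`, as a subsheaf of
`Frob^*(V ⊗ 𝒪_S) = V ⊗ 𝒪_S`: the `𝒪_S`-submodule generated by the images of the sections of `L`
under `v ⊗ a ↦ v ⊗ a ^ p`. -/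
def frobPullback (L : Subsheaf p V S) : Subsheaf p V S :=
  gen fun U => (frob p V S U) '' (L.sec U : Set (Sect p V S U))

/-- Inclusion of subsheaves. -/
def Le (L M : Subsheaf p V S) : Prop := ∀ U, L.sec U ≤ M.sec U

/-- `L` is locally a direct summand of `V ⊗ 𝒪_S`: every point has an open neighbourhood `U` on
which there is a subsheaf of modules `M` with `V ⊗ 𝒪_U = L|_U ⊕ M|_U`. -/
def IsLocallyDirectSummand (L : Subsheaf p V S) : Prop :=
  ∀ x : S.left, ∃ U : S.left.Opens, x ∈ U ∧ ∃ M : Subsheaf p V S,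
    ∀ W : S.left.Opens, W ≤ U → IsCompl (L.sec W) (M.sec W)

/-- `L` is locally free of rank `r`: every point has an open neighbourhood `U` with sections
`b₁, …, b_r` of `L` over `U` that form a basis of `L|_U`. -/
def IsLocallyFreeOfRank (L : Subsheaf p V S) (r : ℕ) : Prop :=
  ∀ x : S.left, ∃ U : S.left.Opens, x ∈ U ∧ ∃ b : Fin r → Sect p V S U,
    ∀ (W : S.left.Opens) (h : W ≤ U),
      LinearIndependent Γ(S.left, W) (fun i => res p V h (b i)) ∧
      Submodule.span Γ(S.left, W) (Set.range fun i => res p V h (b i)) = L.sec W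

/-- `L` belongs to `Gr(r, V)(S)`: it is locally a direct summand of `V ⊗ 𝒪_S`, of rank `r`. -/
def MemGr (L : Subsheaf p V S) (r : ℕ) : Prop :=
  L.IsLocallyDirectSummand ∧ L.IsLocallyFreeOfRank r

/-- `L` is totally isotropic for the `𝒪_S`-bilinear extension of `B` to `V ⊗ 𝒪_S`. -/
def IsTotallyIsotropic (B : LinearMap.BilinForm (ZMod p) V) (L : Subsheaf p V S) : Prop :=
  ∀ U, ∀ s ∈ L.sec U, ∀ t ∈ L.sec U, (B.baseChange Γ(S.left, U)) s t = 0

/-- `L` belongs to `OGr(r)(S)`. -/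
def MemOGr (B : LinearMap.BilinForm (ZMod p) V) (L : Subsheaf p V S) (r : ℕ) : Prop :=
  L.MemGr r ∧ L.IsTotallyIsotropic B

end Subsheaf

/-- `(L, M) = (ℒ_d, ℒ_{d+1})` belongs to `OGr(d, d+1)(S)`. -/
structure MemOGrPair (B : LinearMap.BilinForm (ZMod p) V) (d : ℕ) {S : Sch k}
    (L M : Subsheaf p V S) : Prop where
  left : L.MemOGr B d
  right : M.MemOGr B (d + 1)
  le : L.Le M

/-- The set `𝒴_V(S)` of pairs `(ℒ_d, ℒ_{d+1})` in `OGr(d, d+1)(S)` such that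
`ℒ_d ⊆ Frob^* ℒ_{d+1}` and such that `ℒ_{d+1} + Frob^* ℒ_{d+1}` is locally a direct summand of
`V ⊗ 𝒪_S`. -/
def moduliSet (B : LinearMap.BilinForm (ZMod p) V) (d : ℕ) (S : Sch k) :
    Set (Subsheaf p V S × Subsheaf p V S) :=
  {P | MemOGrPair B d P.1 P.2 ∧ P.1.Le P.2.frobPullback ∧
    (P.2.add P.2.frobPullback).IsLocallyDirectSummand}

/-- The `k`-scheme `Y`, with the universal pair `𝒰 = (𝒰_d, 𝒰_{d+1})` on it, represents the
functor `S ↦ 𝒴_V(S)` on `k`-schemes: for every `k`-scheme `S`, the pull-back of `𝒰` is a bijection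
from the set of `k`-morphisms `S ⟶ Y` onto `𝒴_V(S)`. -/
def Represents (B : LinearMap.BilinForm (ZMod p) V) (d : ℕ) (Y : Sch k)
    (P : Subsheaf p V Y × Subsheaf p V Y) : Prop :=
  P ∈ moduliSet B d Y ∧ ∀ S : Sch k,
    Set.BijOn (fun f : S ⟶ Y => (P.1.pullback f, P.2.pullback f)) Set.univ (moduliSet B d S)

/-- The quadratic space `(V, B)` of dimension `2 (d + 1)` is nonsplit: it has no totally
isotropic subspace of dimension `d + 1`. -/
def IsNonsplit (B : LinearMap.BilinForm (ZMod p) V) (d : ℕ) : Prop :=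
  ¬ ∃ W : Submodule (ZMod p) V, Module.finrank (ZMod p) W = d + 1 ∧ ∀ x ∈ W, ∀ y ∈ W, B x y = 0

end

end OrthDL

end

/-! Locally on `S`, a pair `(ℒ_d, ℒ_{d+1})` is described by a basis of `ℒ_d` and one more vector
completing it to a basis of `ℒ_{d+1}`. Normalising these vectors by pairing with vectors `c` of `V`
makes them unique. Since the functionals are defined over `𝔽_p`, the inclusion `ℒ_d ⊆ Frob^*
ℒ_{d+1}` turns into the explicit equation `IsChartPoint.frob`, and a chart is cut out by finitely
many polynomial equations in an affine space.

Write `m` for the last vector `x none`. Nonsplitness makes `[m, Frob m]` a unit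
(`IsChartPoint.isUnit_baseChange_frob`). If it vanished over a field, `ℒ_{d+1} + Frob^* ℒ_{d+1}`
would be isotropic, hence equal to `ℒ_{d+1}`; then `ℒ_{d+1}` would be Frobenius-stable and would
descend to a totally isotropic subspace of `V` of dimension `d + 1`. Consequently `ℒ_{d+1}` and
`Frob m` together have a frame of `d + 2` vectors, and condition 3 holds automatically on a chart.

Smoothness is the infinitesimal criterion (`IsChartPoint.exists_lift`). Along a square-zero
thickening, the Frobenius pull-back of a lift of `ℒ_{d+1}` does not depend on the lift. It is
isotropic, and `ℒ_d` lifts inside it. It remains to lift the isotropic vector `m`; the obstruction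
is a scalar, removed by moving `m` towards `Frob m`, because `2 [m, Frob m]` is a unit.

For representability, every pair is locally a chart point (`exists_isChartFrame`), and the locus
where a given chart applies is open and compatible with pull-back (`mem_chartOpen_of_pullback`), so
the charts are jointly surjective open immersions into a Zariski sheaf. The gluing criterion
concerns functors on all schemes, so the structure morphism to `Spec k` is carried along as part of
a `Datum`. Smoothness is then read off on the charts, and any other representing scheme is
isomorphic to the one constructed. -/

noncomputable section

namespace OrthDL

/-! ### Extension of scalars, Frobenius, and the equations of a chart -/

section Algebra

variable {p : ℕ} [Fact p.Prime] {V : Type v} [AddCommGroup V] [Module (ZMod p) V]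
  {R R' R'' : Type*} [CommRing R] [CommRing R'] [CommRing R'']
  [Algebra (ZMod p) R] [Algebra (ZMod p) R'] [Algebra (ZMod p) R'']

variable (V) in
/-- Extension of scalars `R ⊗ V → R' ⊗ V` along a homomorphism of `𝔽_p`-algebras. -/
abbrev mapV (φ : R →ₐ[ZMod p] R') : R ⊗[ZMod p] V →ₗ[ZMod p] R' ⊗[ZMod p] V :=
  φ.toLinearMap.rTensor V

lemma mapV_tmul (φ : R →ₐ[ZMod p] R') (a : R) (x : V) :
    mapV V φ (a ⊗ₜ x) = φ a ⊗ₜ x := rfl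

lemma mapV_smul (φ : R →ₐ[ZMod p] R') (a : R) (t : R ⊗[ZMod p] V) :
    mapV V φ (a • t) = φ a • mapV V φ t := by
  induction t using TensorProduct.induction_on with
  | zero => simp
  | tmul b x => simp [TensorProduct.smul_tmul']
  | add s t hs ht => rw [smul_add, map_add, hs, ht, map_add, smul_add]

lemma tensor_sub_smul (a b : R) (t : R ⊗[ZMod p] V) : (a - b) • t = a • t - b • t :=
  sub_smul a b t

lemma mapV_one_tmul (φ : R →ₐ[ZMod p] R') (x : V) :
    mapV V φ (1 ⊗ₜ x) = 1 ⊗ₜ x := by rw [mapV_tmul, map_one]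

lemma mapV_mapV (φ : R →ₐ[ZMod p] R') (ψ : R' →ₐ[ZMod p] R'') (t : R ⊗[ZMod p] V) :
    mapV V ψ (mapV V φ t) = mapV V (ψ.comp φ) t := by
  simp only [mapV, AlgHom.comp_toLinearMap, LinearMap.rTensor_comp]
  rfl

lemma mapV_id (t : R ⊗[ZMod p] V) : mapV V (AlgHom.id (ZMod p) R) t = t :=
  LinearMap.congr_fun (LinearMap.rTensor_id V R) t

lemma baseChange_mapV (B : LinearMap.BilinForm (ZMod p) V) (φ : R →ₐ[ZMod p] R')
    (s t : R ⊗[ZMod p] V) :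
    B.baseChange R' (mapV V φ s) (mapV V φ t) = φ (B.baseChange R s t) := by
  induction s using TensorProduct.induction_on with
  | zero => simp
  | add s s' hs hs' => simp only [map_add, LinearMap.add_apply, hs, hs']
  | tmul a x =>
    induction t using TensorProduct.induction_on with
    | zero => simp
    | add s s' hs hs' => simp only [map_add, hs, hs']
    | tmul b y => simp [LinearMap.BilinForm.baseChange_tmul]

lemma baseChange_symm {B : LinearMap.BilinForm (ZMod p) V} (hB : B.IsSymm)
    (s t : R ⊗[ZMod p] V) : B.baseChange R s t = B.baseChange R t s := by
  induction s using TensorProduct.induction_on with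
  | zero => simp
  | add s s' hs hs' => simp only [map_add, LinearMap.add_apply, hs, hs']
  | tmul a x =>
    induction t using TensorProduct.induction_on with
    | zero => simp
    | add s s' hs hs' => simp only [map_add, LinearMap.add_apply, hs, hs']
    | tmul b y =>
      simp only [LinearMap.BilinForm.baseChange_tmul]
      rw [mul_comm, ← hB.eq x y]

variable (R) in
/-- The `p`-power Frobenius endomorphism of an `𝔽_p`-algebra. -/
abbrev frobHom : R →ₐ[ZMod p] R := FiniteField.frobeniusAlgHom (ZMod p) R

lemma frobHom_apply (a : R) : frobHom (p := p) R a = a ^ p := by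
  simp

variable (R V) in
/-- The map `a ⊗ x ↦ a ^ p ⊗ x`. -/
abbrev frobV : R ⊗[ZMod p] V →ₗ[ZMod p] R ⊗[ZMod p] V := mapV V (frobHom R)

lemma frobV_smul (a : R) (t : R ⊗[ZMod p] V) :
    frobV V R (a • t) = a ^ p • frobV V R t := by
  rw [mapV_smul, frobHom_apply]

lemma mapV_frobV (φ : R →ₐ[ZMod p] R') (t : R ⊗[ZMod p] V) :
    mapV V φ (frobV V R t) = frobV V R' (mapV V φ t) := by
  rw [mapV_mapV, mapV_mapV]
  congr 1
  ext a
  simp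

/-- The form has coefficients in `𝔽_p`. Hence isotropy, and normalisations against vectors of `V`,
pass to Frobenius images. -/
lemma baseChange_frobV (B : LinearMap.BilinForm (ZMod p) V) (s t : R ⊗[ZMod p] V) :
    B.baseChange R (frobV V R s) (frobV V R t) = B.baseChange R s t ^ p := by
  rw [baseChange_mapV, frobHom_apply]

/-- A family in `R ⊗ V` is recovered from its pairings with the dual basis. -/
lemma sum_dualBasis {ι : Type*} [Fintype ι] [DecidableEq ι] {B : LinearMap.BilinForm (ZMod p) V}
    (hB : B.Nondegenerate) (e : Module.Basis ι (ZMod p) V) (t : R ⊗[ZMod p] V) :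
    t = ∑ a, B.baseChange R (1 ⊗ₜ B.dualBasis hB e a) t • (1 ⊗ₜ[ZMod p] e a) := by
  induction t using TensorProduct.induction_on with
  | zero => simp
  | add s t hs ht =>
    conv_lhs => rw [hs, ht]
    simp only [map_add, add_smul, Finset.sum_add_distrib]
  | tmul r x =>
    have h : ∀ a, B (B.dualBasis hB e a) x = e.repr x a := by
      intro a
      conv_lhs => rw [← e.sum_repr x]
      simp only [map_sum, map_smul, LinearMap.BilinForm.apply_dualBasis_left, smul_eq_mul, mul_ite,
        mul_one, mul_zero, Finset.sum_ite_eq', Finset.mem_univ, if_true]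
    simp only [LinearMap.BilinForm.baseChange_tmul, one_mul, h]
    conv_lhs => rw [← e.sum_repr x, TensorProduct.tmul_sum]
    refine Finset.sum_congr rfl fun a _ => ?_
    rw [TensorProduct.tmul_smul, TensorProduct.smul_tmul', TensorProduct.smul_tmul', smul_eq_mul,
      mul_one]

lemma exists_baseChange_ne_zero [FiniteDimensional (ZMod p) V]
    {B : LinearMap.BilinForm (ZMod p) V} (hB : B.Nondegenerate) {t : R ⊗[ZMod p] V} (ht : t ≠ 0) :
    ∃ g : V, B.baseChange R (1 ⊗ₜ g) t ≠ 0 := by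
  classical
  by_contra! h
  apply ht
  rw [sum_dualBasis hB (Module.finBasis (ZMod p) V) t]
  simp [h]

/-- Every linear functional on `R ⊗ V` is given by pairing with a vector. -/
lemma exists_eq_baseChange [FiniteDimensional (ZMod p) V]
    {B : LinearMap.BilinForm (ZMod p) V} (hB : B.Nondegenerate) (lam : R ⊗[ZMod p] V →ₗ[R] R) :
    ∃ w : R ⊗[ZMod p] V, ∀ t, B.baseChange R w t = lam t := by
  classical
  let e := Module.finBasis (ZMod p) V
  refine ⟨∑ a, lam (1 ⊗ₜ e a) • (1 ⊗ₜ[ZMod p] B.dualBasis hB e a), fun t => ?_⟩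
  conv_rhs => rw [sum_dualBasis hB e t]
  simp only [map_sum, map_smul, LinearMap.sum_apply, LinearMap.smul_apply, smul_eq_mul]
  exact Finset.sum_congr rfl fun _ _ => mul_comm _ _

lemma baseChange_nondegenerate [FiniteDimensional (ZMod p) V]
    {B : LinearMap.BilinForm (ZMod p) V} (hB : B.Nondegenerate) (hs : B.IsSymm) :
    (B.baseChange R).Nondegenerate := by
  have key : ∀ t, (∀ s, B.baseChange R s t = 0) → t = 0 := by
    intro t h
    by_contra ht
    obtain ⟨g, hg⟩ := exists_baseChange_ne_zero hB ht
    exact hg (h _)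
  exact ⟨fun t h => key t fun s => by rw [baseChange_symm hs]; exact h s, key⟩

/-- The polynomial `X ^ p - X` has at most `p` roots in `K`, and the prime field already supplies
`p` of them. -/
lemma exists_algebraMap_eq_of_pow_eq {K : Type*} [Field K] [Algebra (ZMod p) K] {a : K}
    (h : a ^ p = a) : ∃ c : ZMod p, algebraMap (ZMod p) K c = a := by
  classical
  have hp : 1 < p := (Fact.out : p.Prime).one_lt
  have hX := FiniteField.X_pow_card_sub_X_ne_zero K hp
  have hd := FiniteField.X_pow_card_sub_X_natDegree_eq K hp
  by_contra! hc
  let s : Finset K := insert a (Finset.univ.image (algebraMap (ZMod p) K))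
  have hs : s.card = p + 1 := by
    rw [Finset.card_insert_of_notMem (by simpa using hc),
      Finset.card_image_of_injective _ (algebraMap (ZMod p) K).injective, Finset.card_univ,
      ZMod.card]
  have hle := Polynomial.card_le_degree_of_subset_roots
    (p := (Polynomial.X ^ p - Polynomial.X : Polynomial K)) (Z := s) (by
      intro b hb
      rw [Polynomial.mem_roots hX]
      rcases Finset.mem_insert.mp (Finset.mem_def.mpr hb) with rfl | hb
      · simp [h]
      · obtain ⟨c, -, rfl⟩ := Finset.mem_image.mp hb
        simp [← map_pow, ZMod.pow_card])
  omega

/-- The vectors of `K ⊗ V` fixed by Frobenius are those of `V`. -/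
lemma exists_one_tmul_eq_of_frobV_eq [FiniteDimensional (ZMod p) V]
    {B : LinearMap.BilinForm (ZMod p) V} (hB : B.Nondegenerate)
    {K : Type*} [Field K] [Algebra (ZMod p) K] {t : K ⊗[ZMod p] V}
    (h : frobV V K t = t) : ∃ x : V, (1 : K) ⊗ₜ[ZMod p] x = t := by
  classical
  let e := Module.finBasis (ZMod p) V
  -- The dual basis is defined over `𝔽_p`, so each coordinate of a Frobenius-fixed vector equals its
  -- own `p`-th power.
  have h1 : ∀ a, ∃ c : ZMod p, algebraMap (ZMod p) K c
      = B.baseChange K (1 ⊗ₜ B.dualBasis hB e a) t := by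
    intro a
    apply exists_algebraMap_eq_of_pow_eq
    rw [← baseChange_frobV, h, mapV_one_tmul]
  choose c hc using h1
  refine ⟨∑ a, c a • e a, ?_⟩
  rw [sum_dualBasis hB e t, TensorProduct.tmul_sum]
  refine Finset.sum_congr rfl fun a _ => ?_
  rw [← hc, TensorProduct.tmul_smul, algebraMap_smul]

/-- A chart: `d + 1` linear functionals on `V`, given by pairing with vectors. -/
abbrev Chart (V : Type v) (d : ℕ) := Option (Fin d) → V

/-- The coordinates of a point of a chart: a basis `x (some i)` of `ℒ_d`, completed by `x none`
to a basis of `ℒ_{d+1}`, normalised by the functionals of the chart. -/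
structure IsChartPoint (B : LinearMap.BilinForm (ZMod p) V) {d : ℕ} (c : Chart V d)
    (x : Option (Fin d) → R ⊗[ZMod p] V) : Prop where
  some_some : ∀ i j : Fin d, B.baseChange R (1 ⊗ₜ c (some i)) (x (some j)) = if i = j then 1 else 0
  some_none : ∀ i : Fin d, B.baseChange R (1 ⊗ₜ c (some i)) (x none) = 0
  none_none : B.baseChange R (1 ⊗ₜ c none) (x none) = 1
  isotropic : ∀ i j, B.baseChange R (x i) (x j) = 0
  -- This encodes the inclusion of `ℒ_d` in `Frob^* ℒ_{d+1}`: pairing with the `c (some j)` forces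
  -- the coefficients on the `frobV V R (x (some j))`, and pairing with `c none` forces the one on
  -- `frobV V R (x none)`.
  frob : ∀ i : Fin d, x (some i) = frobV V R (x (some i)) +
    (B.baseChange R (1 ⊗ₜ c none) (x (some i)) -
      B.baseChange R (1 ⊗ₜ c none) (x (some i)) ^ p) • frobV V R (x none)

/-- The family dual to the basis of a point of a chart. -/
def chartDual (B : LinearMap.BilinForm (ZMod p) V) {d : ℕ} (c : Chart V d)
    (x : Option (Fin d) → R ⊗[ZMod p] V) : Option (Fin d) → R ⊗[ZMod p] V
  | some i => 1 ⊗ₜ c (some i)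
  -- The vector `c none` need not pair to zero with the `x (some i)`; the sum removes those values.
  | none => 1 ⊗ₜ c none -
      ∑ i, B.baseChange R (1 ⊗ₜ c none) (x (some i)) • (1 ⊗ₜ[ZMod p] c (some i))

variable {B : LinearMap.BilinForm (ZMod p) V} {d : ℕ} {c : Chart V d}
  {x : Option (Fin d) → R ⊗[ZMod p] V}

lemma chartDual_spec
    (h1 : ∀ i j : Fin d, B.baseChange R (1 ⊗ₜ c (some i)) (x (some j)) = if i = j then 1 else 0)
    (h2 : ∀ i : Fin d, B.baseChange R (1 ⊗ₜ c (some i)) (x none) = 0)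
    (h3 : B.baseChange R (1 ⊗ₜ c none) (x none) = 1) (i j : Option (Fin d)) :
    B.baseChange R (chartDual B c x i) (x j) = if i = j then 1 else 0 := by
  cases i with
  | some i =>
    cases j with
    | some j => simpa [chartDual] using h1 i j
    | none => simpa [chartDual] using h2 i
  | none =>
    cases j with
    | some j => simp [chartDual, h1]
    | none => simp [chartDual, h2, h3]

namespace IsChartPoint

lemma dual (h : IsChartPoint B c x) (i j : Option (Fin d)) :
    B.baseChange R (chartDual B c x i) (x j) = if i = j then 1 else 0 :=
  chartDual_spec h.some_some h.some_none h.none_none i j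

lemma map (φ : R →ₐ[ZMod p] R') (h : IsChartPoint B c x) :
    IsChartPoint B c fun i => mapV V φ (x i) where
  some_some i j := by
    rw [← mapV_one_tmul φ, baseChange_mapV, h.some_some]; split_ifs <;> simp
  some_none i := by rw [← mapV_one_tmul φ, baseChange_mapV, h.some_none, map_zero]
  none_none := by rw [← mapV_one_tmul φ, baseChange_mapV, h.none_none, map_one]
  isotropic i j := by rw [baseChange_mapV, h.isotropic, map_zero]
  frob i := by
    conv_lhs => rw [h.frob i]
    rw [map_add, mapV_smul, mapV_frobV, mapV_frobV, ← mapV_one_tmul φ, baseChange_mapV, map_sub,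
      map_pow]

lemma frob_isotropic (h : IsChartPoint B c x) (i j : Option (Fin d)) :
    B.baseChange R (frobV V R (x i)) (frobV V R (x j)) = 0 := by
  rw [baseChange_frobV, h.isotropic, zero_pow (Fact.out : p.Prime).ne_zero]

/-- By `frob`, the vector `x (some i)` lies in the span of the Frobenius images, which is isotropic.
-/
lemma some_frob_none (h : IsChartPoint B c x) (i : Fin d) :
    B.baseChange R (x (some i)) (frobV V R (x none)) = 0 := by
  rw [h.frob i, map_add, LinearMap.add_apply, map_smul, LinearMap.smul_apply, h.frob_isotropic,
    h.frob_isotropic, smul_zero, add_zero]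

lemma chart_frob_none (h : IsChartPoint B c x) (i : Fin d) :
    B.baseChange R (1 ⊗ₜ c (some i)) (frobV V R (x none)) = 0 := by
  rw [← mapV_one_tmul (frobHom R), baseChange_frobV, h.some_none,
    zero_pow (Fact.out : p.Prime).ne_zero]

lemma chart_none_frob_none (h : IsChartPoint B c x) :
    B.baseChange R (1 ⊗ₜ c none) (frobV V R (x none)) = 1 := by
  rw [← mapV_one_tmul (frobHom R), baseChange_frobV, h.none_none, one_pow]

end IsChartPoint

end Algebra

end OrthDL

end

/-! ### Dual families, the consequence of nonsplitness, and infinitesimal lifting -/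

noncomputable section

namespace OrthDL

section Algebra

variable {p : ℕ} [Fact p.Prime] {V : Type v} [AddCommGroup V] [Module (ZMod p) V]
  {R R' : Type*} [CommRing R] [CommRing R'] [Algebra (ZMod p) R] [Algebra (ZMod p) R']
  {B : LinearMap.BilinForm (ZMod p) V}

lemma linearIndependent_of_dual {ι : Type*} [Fintype ι] [DecidableEq ι]
    {v w : ι → R ⊗[ZMod p] V}
    (h : ∀ i j, B.baseChange R (w i) (v j) = if i = j then 1 else 0) : LinearIndependent R v := by
  rw [Fintype.linearIndependent_iff]
  intro a ha i
  have := congrArg (B.baseChange R (w i)) ha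
  simpa [h] using this

/-- An element of the span of a family with a dual family is the sum of its components. -/
lemma eq_sum_of_mem_span {ι : Type*} [Fintype ι] [DecidableEq ι] {v w : ι → R ⊗[ZMod p] V}
    (h : ∀ i j, B.baseChange R (w i) (v j) = if i = j then 1 else 0) {t : R ⊗[ZMod p] V}
    (ht : t ∈ Submodule.span R (Set.range v)) : t = ∑ i, B.baseChange R (w i) t • v i := by
  obtain ⟨a, rfl⟩ := (Submodule.mem_span_range_iff_exists_fun R).mp ht
  refine Finset.sum_congr rfl fun i _ => ?_
  congr 1
  simp [h]

lemma mem_span_iff_eq_sum {ι : Type*} [Fintype ι] [DecidableEq ι] {v w : ι → R ⊗[ZMod p] V}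
    (h : ∀ i j, B.baseChange R (w i) (v j) = if i = j then 1 else 0) {t : R ⊗[ZMod p] V} :
    t ∈ Submodule.span R (Set.range v) ↔ t = ∑ i, B.baseChange R (w i) t • v i :=
  ⟨eq_sum_of_mem_span h, fun e => (Submodule.mem_span_range_iff_exists_fun R).mpr ⟨_, e.symm⟩⟩

/-- A family with a dual family, in the span of a family of the same cardinality, has the same
span. -/
lemma span_eq_of_dual {ι ι' : Type*} [Fintype ι] [DecidableEq ι] [Fintype ι'] [DecidableEq ι']
    (hc : Fintype.card ι = Fintype.card ι') {v w : ι → R ⊗[ZMod p] V} {v' : ι' → R ⊗[ZMod p] V}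
    (h : ∀ i j, B.baseChange R (w i) (v j) = if i = j then 1 else 0)
    (hv : ∀ i, v i ∈ Submodule.span R (Set.range v')) :
    Submodule.span R (Set.range v) = Submodule.span R (Set.range v') := by
  apply le_antisymm
  · rw [Submodule.span_le]
    rintro _ ⟨i, rfl⟩
    exact hv i
  have hv' : ∀ i, ∃ a : ι' → R, ∑ k, a k • v' k = v i := fun i =>
    (Submodule.mem_span_range_iff_exists_fun R).mp (hv i)
  choose C hC using hv'
  let D : Matrix ι' ι R := fun k i => B.baseChange R (w i) (v' k)
  have hCD : (Matrix.of C) * D = 1 := by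
    ext j i
    have : B.baseChange R (w i) (v j) = ∑ k, C j k * D k i := by
      rw [← hC j]; simp [D]
    rw [Matrix.mul_apply, Matrix.one_apply]
    simp only [Matrix.of_apply]
    rw [← this, h]
    exact if_congr eq_comm rfl rfl
  -- The equality of cardinalities makes the one-sided inverse two-sided, so the `v' k` are in turn
  -- combinations of the `v i`.
  have hDC := (Matrix.mul_eq_one_comm_of_card_eq ι ι' R hc).mp hCD
  rw [Submodule.span_le]
  rintro _ ⟨k, rfl⟩
  refine (Submodule.mem_span_range_iff_exists_fun R).mpr ⟨D k, ?_⟩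
  calc ∑ i, D k i • v i = ∑ l, (D * Matrix.of C) k l • v' l := by
        simp only [← hC, Finset.smul_sum, smul_smul, Matrix.mul_apply, Finset.sum_smul,
          Matrix.of_apply]
        exact Finset.sum_comm
    _ = v' k := by simp [hDC, Matrix.one_apply]

/-- An isotropic frame of a nonsplit space cannot be carried by the Frobenius to an isotropic frame
orthogonal to it. -/
lemma IsChartPoint.baseChange_frob_ne_zero [FiniteDimensional (ZMod p) V] {d : ℕ}
    (hV : Module.finrank (ZMod p) V = 2 * (d + 1)) (hB : B.Nondegenerate) (hs : B.IsSymm)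
    (hns : IsNonsplit B d) {K : Type*} [Field K] [Algebra (ZMod p) K] {c : Chart V d}
    {x : Option (Fin d) → K ⊗[ZMod p] V} (h : IsChartPoint B c x) :
    B.baseChange K (x none) (frobV V K (x none)) ≠ 0 := by
  intro h0
  let n := frobV V K (x none)
  let b := B.baseChange K
  have hdual := h.dual
  have hli := linearIndependent_of_dual hdual
  let W := Submodule.span K (Set.range x)
  let W' := Submodule.span K (insert n (Set.range x))
  -- With the pairing assumed zero, adjoining `n` to the frame keeps the span isotropic.
  have hiso : W' ≤ b.orthogonal W' := by
    have key : ∀ s ∈ insert n (Set.range x), ∀ t ∈ insert n (Set.range x), b s t = 0 := by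
      have hn : ∀ i, b (x i) n = 0 := by
        rintro (_ | i)
        · exact h0
        · exact h.some_frob_none i
      rintro _ (rfl | ⟨i, rfl⟩) _ (rfl | ⟨j, rfl⟩)
      · exact h.frob_isotropic none none
      · rw [show b n (x j) = b (x j) n from baseChange_symm hs _ _]; exact hn j
      · exact hn i
      · exact h.isotropic i j
    have h2 : ∀ s ∈ insert n (Set.range x), ∀ t ∈ W', b s t = 0 := by
      intro s hs' t ht
      have : W' ≤ LinearMap.ker (b s) := Submodule.span_le.mpr fun t ht => key s hs' t ht
      exact this ht
    intro t ht
    rw [LinearMap.BilinForm.mem_orthogonal_iff]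
    intro s hs'
    change b s t = 0
    have : W' ≤ LinearMap.ker (b.flip t) := Submodule.span_le.mpr fun s hs => h2 s hs t ht
    exact this hs'
  -- An isotropic subspace has at most half of the dimension `2 * (d + 1)`, and the frame alone
  -- already reaches this bound; so `n` lies in its span.
  have hfr : Module.finrank K W' ≤ d + 1 := by
    have h1 := Submodule.finrank_mono hiso
    rw [LinearMap.BilinForm.finrank_orthogonal (baseChange_nondegenerate hB hs) W',
      Module.finrank_baseChange, hV] at h1
    omega
  have hWfr : Module.finrank K W = d + 1 := by
    rw [finrank_span_eq_card hli]; simp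
  have hWW : W = W' := Submodule.eq_of_le_of_finrank_le
    (Submodule.span_mono (Set.subset_insert _ _)) (by omega)
  have hn : n ∈ W := hWW ▸ Submodule.subset_span (Set.mem_insert _ _)
  -- The functionals of the chart take the same values on `n` as on `x none`, which determines a
  -- vector of the span up to its `some` coordinates, all zero here.
  have hnx : n = x none := by
    rw [eq_sum_of_mem_span hdual hn, Fintype.sum_option]
    have e1 : ∀ i, B.baseChange K (1 ⊗ₜ c (some i)) n = 0 := h.chart_frob_none
    have e2 : B.baseChange K (1 ⊗ₜ c none) n = 1 := h.chart_none_frob_none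
    simp [chartDual, e1, e2]
  -- Once `n = x none`, the equation `frob` says precisely that these modified basis vectors are
  -- fixed by Frobenius; they therefore come from `V` and span a forbidden isotropic subspace there.
  let y : Option (Fin d) → K ⊗[ZMod p] V
    | none => x none
    | some i => x (some i) - b (1 ⊗ₜ c none) (x (some i)) • x none
  have hy : ∀ i, frobV V K (y i) = y i := by
    rintro (_ | i)
    · exact hnx
    · have e := h.frob i
      change x _ = _ + _ • n at e
      rw [hnx, tensor_sub_smul] at e
      change frobV V K (x (some i) - b (1 ⊗ₜ c none) (x (some i)) • x none)
        = x (some i) - b (1 ⊗ₜ c none) (x (some i)) • x none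
      rw [map_sub, frobV_smul]
      change _ - _ • n = _
      rw [hnx]
      have key : ∀ X F P Q : K ⊗[ZMod p] V, X = F + (P - Q) → F - Q = X - P := by
        rintro X F P Q rfl; abel
      exact key _ _ _ _ e
  choose z hz using fun i => exists_one_tmul_eq_of_frobV_eq hB (hy i)
  have hinj : Function.Injective (algebraMap (ZMod p) K) := (algebraMap (ZMod p) K).injective
  have hbz : ∀ s t : V, algebraMap (ZMod p) K (B s t) = b (1 ⊗ₜ s) (1 ⊗ₜ t) := fun s t => by
    rw [LinearMap.BilinForm.baseChange_tmul, mul_one, Algebra.algebraMap_eq_smul_one]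
  have hcz : ∀ i j, B (c i) (z j) = if i = j then 1 else 0 := by
    intro i j
    apply hinj
    rw [hbz, hz]
    rcases i with _ | i <;> rcases j with _ | j
    · simp [y, b, h.none_none]
    · simp [y, b, h.none_none]
    · simp [y, b, h.some_none]
    · simp [y, b, h.some_none, h.some_some]
  have hzz : ∀ i j, B (z i) (z j) = 0 := by
    intro i j
    apply hinj
    rw [hbz, hz, hz, map_zero]
    rcases i with _ | i <;> rcases j with _ | j <;> simp [y, b, h.isotropic]
  have hzli : LinearIndependent (ZMod p) z := by
    rw [Fintype.linearIndependent_iff]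
    intro a ha i
    have := congrArg (B (c i)) ha
    simpa only [map_sum, map_smul, hcz, smul_eq_mul, mul_ite, mul_one, mul_zero,
      Finset.sum_ite_eq, Finset.mem_univ, if_true, map_zero] using this
  refine hns ⟨Submodule.span (ZMod p) (Set.range z), ?_, ?_⟩
  · rw [finrank_span_eq_card hzli]; simp
  · intro s hs' t ht
    have h1 : ∀ i, B (z i) t = 0 := fun i => by
      have : Submodule.span (ZMod p) (Set.range z) ≤ LinearMap.ker (B (z i)) := by
        rw [Submodule.span_le]; rintro _ ⟨j, rfl⟩; exact hzz i j
      exact this ht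
    have : Submodule.span (ZMod p) (Set.range z) ≤ LinearMap.ker (B.flip t) := by
      rw [Submodule.span_le]; rintro _ ⟨j, rfl⟩; exact h1 j
    exact this hs'

/-- A nonunit would vanish in the quotient by some maximal ideal, where the chart point reduces to
one over a field. -/
lemma IsChartPoint.isUnit_baseChange_frob [FiniteDimensional (ZMod p) V] {d : ℕ}
    (hV : Module.finrank (ZMod p) V = 2 * (d + 1)) (hB : B.Nondegenerate) (hs : B.IsSymm)
    (hns : IsNonsplit B d) {c : Chart V d}
    {x : Option (Fin d) → R ⊗[ZMod p] V} (h : IsChartPoint B c x) :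
    IsUnit (B.baseChange R (x none) (frobV V R (x none))) := by
  by_contra hu
  obtain ⟨P, hP, hm⟩ := exists_max_ideal_of_mem_nonunits hu
  let _ : Field (R ⧸ P) := Ideal.Quotient.field P
  let φ : R →ₐ[ZMod p] (R ⧸ P) := Ideal.Quotient.mkₐ (ZMod p) P
  apply (h.map φ).baseChange_frob_ne_zero hV hB hs hns
  rw [← mapV_frobV, baseChange_mapV]
  exact Ideal.Quotient.eq_zero_iff_mem.mpr hm

section Lift

variable (I : Ideal R) (hI : ∀ a ∈ I, ∀ b ∈ I, a * b = 0)

lemma mapV_mk_surjective : Function.Surjective (mapV V (Ideal.Quotient.mkₐ (ZMod p) I)) :=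
  LinearMap.rTensor_surjective V (Ideal.Quotient.mkₐ_surjective (ZMod p) I)

lemma mapV_mk_eq_zero_of_mem {a : R} (ha : a ∈ I) (t : R ⊗[ZMod p] V) :
    mapV V (Ideal.Quotient.mkₐ (ZMod p) I) (a • t) = 0 := by
  rw [mapV_smul]
  have : (Ideal.Quotient.mkₐ (ZMod p) I) a = 0 := Ideal.Quotient.eq_zero_iff_mem.mpr ha
  rw [this, zero_smul]

-- Frobenius is additive and kills `I`, because `p ≥ 2`. This is what makes Frobenius pull-backs
-- rigid along square-zero thickenings.
include hI in
lemma pow_eq_pow_of_sub_mem {a b : R} (h : a - b ∈ I) : a ^ p = b ^ p := by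
  have hp := (Fact.out : p.Prime).two_le
  have h0 : (a - b) ^ p = 0 := by
    rw [show p = 2 + (p - 2) by omega, pow_add, pow_two, hI _ h _ h, zero_mul]
  rw [← frobHom_apply (p := p), ← frobHom_apply (p := p), ← sub_eq_zero, ← map_sub, frobHom_apply,
    h0]

include hI in
/-- The Frobenius pull-back of a lift along a square-zero thickening does not depend on the
lift. -/
lemma frobV_eq_of_mapV_mk_eq [FiniteDimensional (ZMod p) V] (hB : B.Nondegenerate)
    {s t : R ⊗[ZMod p] V}
    (h : mapV V (Ideal.Quotient.mkₐ (ZMod p) I) s = mapV V (Ideal.Quotient.mkₐ (ZMod p) I) t) :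
    frobV V R s = frobV V R t := by
  classical
  let e := Module.finBasis (ZMod p) V
  rw [sum_dualBasis hB e (frobV V R s), sum_dualBasis hB e (frobV V R t)]
  refine Finset.sum_congr rfl fun a _ => ?_
  congr 1
  rw [← mapV_one_tmul (frobHom R), baseChange_frobV, baseChange_frobV]
  apply pow_eq_pow_of_sub_mem I hI
  rw [← map_sub]
  apply Ideal.Quotient.eq_zero_iff_mem.mp
  change (Ideal.Quotient.mkₐ (ZMod p) I) _ = 0
  rw [← baseChange_mapV, map_sub, h, sub_self, map_zero]

include hI in
/-- Points of a chart lift along square-zero thickenings. -/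
lemma IsChartPoint.exists_lift [FiniteDimensional (ZMod p) V] (hp : p ≠ 2) {d : ℕ}
    (hV : Module.finrank (ZMod p) V = 2 * (d + 1)) (hB : B.Nondegenerate) (hs : B.IsSymm)
    (hns : IsNonsplit B d) {c : Chart V d}
    {x : Option (Fin d) → (R ⧸ I) ⊗[ZMod p] V} (h : IsChartPoint B c x) :
    ∃ y : Option (Fin d) → R ⊗[ZMod p] V, IsChartPoint B c y ∧
      ∀ i, mapV V (Ideal.Quotient.mkₐ (ZMod p) I) (y i) = x i := by
  set φ := Ideal.Quotient.mkₐ (ZMod p) I with hφ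
  have hφ0 : ∀ {a : R}, φ a = 0 ↔ a ∈ I := Ideal.Quotient.eq_zero_iff_mem
  set b := B.baseChange R with hb
  have bsymm : ∀ s t, b s t = b t s := baseChange_symm hs
  have hbφ : ∀ s t, φ (b s t) = B.baseChange (R ⧸ I) (mapV V φ s) (mapV V φ t) :=
    fun s t => (baseChange_mapV B φ s t).symm
  have hp0 : p ≠ 0 := (Fact.out : p.Prime).ne_zero
  have hzp : ∀ {a : R}, a ∈ I → a ^ p = 0 := fun {a} ha => by
    rw [pow_eq_pow_of_sub_mem (p := p) I hI (b := 0) (by simpa using ha), zero_pow hp0]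
  have hunit : ∀ {a : R}, IsUnit (φ a) → IsUnit a := by
    intro a ha
    obtain ⟨a', ha'⟩ := ha.exists_right_inv
    obtain ⟨a', rfl⟩ := Ideal.Quotient.mkₐ_surjective (ZMod p) I a'
    have hm : 1 - a * a' ∈ I := hφ0.mp (by
      rw [map_sub, map_one, map_mul]; exact sub_eq_zero.mpr ha'.symm)
    have := hI _ hm _ hm
    -- With `e = a * a'`, one has `e * (2 - e) = 1 - (1 - e) ^ 2`, and `1 - e` lies in the
    -- square-zero ideal.
    refine IsUnit.of_mul_eq_one (a' * (2 - a * a')) ?_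
    linear_combination -this
  choose xt hxt using fun i => mapV_mk_surjective (V := V) I (x i)
  -- These vectors do not depend on the lifts `xt`: they are the Frobenius images of any lift of
  -- `x`, so the lift of `ℒ_d` must be found in their span.
  set n : Option (Fin d) → R ⊗[ZMod p] V := fun i => frobV V R (xt i) with hn
  have hφn : ∀ i, mapV V φ (n i) = frobV V (R ⧸ I) (x i) := fun i => by
    rw [hn]; simp only; rw [mapV_frobV, hxt]
  -- The pairing of two lifts lies in `I`, so its `p`-th power vanishes: the `n i` are isotropic
  -- although the `xt i` need not be.
  have hnn : ∀ i j, b (n i) (n j) = 0 := fun i j => by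
    rw [hb, hn]
    simp only
    rw [baseChange_frobV]
    apply hzp
    rw [← hφ0, ← hb, hbφ, hxt, hxt, h.isotropic]
  have hcn : ∀ i j a, B.baseChange (R ⧸ I) (1 ⊗ₜ c i) (x j) = a → ∀ a' : R, φ a' = a →
      b (1 ⊗ₜ c i) (n j) = a' ^ p := by
    intro i j a ha a' ha'
    rw [hb, hn]
    simp only
    rw [← mapV_one_tmul (frobHom R), baseChange_frobV]
    apply pow_eq_pow_of_sub_mem I hI
    rw [← hφ0, map_sub, ← hb, hbφ, hxt, mapV_one_tmul, ha, ha', sub_self]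
  have hcn1 : ∀ i j : Fin d, b (1 ⊗ₜ c (some i)) (n (some j)) = if i = j then 1 else 0 := by
    intro i j
    rw [hcn _ _ _ (h.some_some i j) (if i = j then 1 else 0) (by split_ifs <;> simp)]
    split_ifs <;> simp [hp0]
  have hcn2 : ∀ i : Fin d, b (1 ⊗ₜ c (some i)) (n none) = 0 := by
    intro i
    rw [hcn _ _ _ (h.some_none i) 0 (by simp), zero_pow hp0]
  have hcn3 : b (1 ⊗ₜ c none) (n none) = 1 := by
    rw [hcn _ _ _ h.none_none 1 (by simp), one_pow]
  choose t ht using fun i : Fin d => Ideal.Quotient.mkₐ_surjective (ZMod p) I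
    (B.baseChange (R ⧸ I) (1 ⊗ₜ c none) (x (some i)) -
      B.baseChange (R ⧸ I) (1 ⊗ₜ c none) (x (some i)) ^ p)
  -- The same combination as in `frob` over `R ⧸ I`, with `t i` any lift of the coefficient.
  set l : Fin d → R ⊗[ZMod p] V := fun i => n (some i) + t i • n none with hl
  have hφl : ∀ i, mapV V φ (l i) = x (some i) := by
    intro i
    rw [h.frob i, hl]
    simp only
    rw [map_add, mapV_smul, hφn, hφn, ht]
  have hll : ∀ i j, b (l i) (l j) = 0 := by
    intro i j; simp [hl, hnn]
  have hln : ∀ i, b (l i) (n none) = 0 := by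
    intro i; simp [hl, hnn]
  have hcl : ∀ i j : Fin d, b (1 ⊗ₜ c (some i)) (l j) = if i = j then 1 else 0 := by
    intro i j
    rw [hl]; simp only
    rw [map_add, map_smul, hcn1, hcn2, smul_zero, add_zero]
  have hfl : ∀ i, frobV V R (l i) = n (some i) := fun i =>
    frobV_eq_of_mapV_mk_eq I hI hB (by rw [← hφ, hφl, hxt])
  -- The value of `c none` on `l i` is its value on `n (some i)` plus `t i`. As `n (some i)` is the
  -- Frobenius image of `l i`, the first term is the `p`-th power of the whole, so `t i` is the
  -- coefficient that `frob` demands.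
  have hlf : ∀ i, l i = frobV V R (l i) +
      (b (1 ⊗ₜ c none) (l i) - b (1 ⊗ₜ c none) (l i) ^ p) • n none := by
    intro i
    have e : b (1 ⊗ₜ c none) (l i) - b (1 ⊗ₜ c none) (l i) ^ p = t i := by
      have e1 : b (1 ⊗ₜ c none) (l i) ^ p = b (1 ⊗ₜ c none) (n (some i)) := by
        rw [← hfl, ← mapV_one_tmul (frobHom R), hb, baseChange_frobV, mapV_one_tmul]
      rw [e1, hl]; simp only
      rw [map_add, map_smul, hcn3, smul_eq_mul, mul_one, add_sub_cancel_left]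
    rw [e, hfl]
  -- successive corrections of the lift of `x none`
  have hε1 : ∀ i, b (l i) (xt none) ∈ I := fun i => by
    rw [← hφ0, hbφ, hφl, hxt, h.isotropic]
  -- The `c (some j)` are dual to the `l j`, so this makes the vector orthogonal to all `l i`; the
  -- coefficients lie in `I`, so the reduction is unchanged.
  set m1 := xt none - ∑ j, b (l j) (xt none) • (1 ⊗ₜ[ZMod p] c (some j)) with hm1
  have hφm1 : mapV V φ m1 = x none := by
    rw [hm1, map_sub, map_sum, hxt, Finset.sum_eq_zero, sub_zero]
    exact fun i _ => mapV_mk_eq_zero_of_mem I (hε1 i) _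
  have hlm1 : ∀ i, b (l i) m1 = 0 := by
    intro i
    rw [hm1, map_sub, map_sum]
    simp [bsymm (l i) (1 ⊗ₜ _), hcl]
  have hε2 : ∀ i, b (1 ⊗ₜ c (some i)) m1 ∈ I := fun i => by
    rw [← hφ0, hbφ, hφm1, mapV_one_tmul, h.some_none]
  -- The `l j` being mutually orthogonal, this normalisation preserves the orthogonality to `l` just
  -- obtained.
  set m2 := m1 - ∑ j, b (1 ⊗ₜ c (some j)) m1 • l j with hm2
  have hφm2 : mapV V φ m2 = x none := by
    rw [hm2, map_sub, map_sum, hφm1, Finset.sum_eq_zero, sub_zero]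
    exact fun i _ => mapV_mk_eq_zero_of_mem I (hε2 i) _
  have hlm2 : ∀ i, b (l i) m2 = 0 := by
    intro i
    rw [hm2, map_sub, map_sum]
    simp [hlm1, hll]
  have hcm2 : ∀ i, b (1 ⊗ₜ c (some i)) m2 = 0 := by
    intro i
    rw [hm2, map_sub, map_sum]
    simp [hcl]
  have hu : φ (b (1 ⊗ₜ c none) m2) = 1 := by
    rw [hbφ, hφm2, mapV_one_tmul, h.none_none]
  obtain ⟨u, hu'⟩ := hunit (by rw [hu]; exact isUnit_one)
  have hφu : φ (↑u⁻¹ : R) = 1 := by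
    have : φ ((↑u⁻¹ : R) * u) = 1 := by rw [Units.inv_mul, map_one]
    rwa [map_mul, hu', hu, mul_one] at this
  set m3 := (↑u⁻¹ : R) • m2 with hm3
  have hφm3 : mapV V φ m3 = x none := by rw [hm3, mapV_smul, hφu, one_smul, hφm2]
  have hlm3 : ∀ i, b (l i) m3 = 0 := fun i => by rw [hm3, map_smul, hlm2, smul_zero]
  have hcm3 : ∀ i, b (1 ⊗ₜ c (some i)) m3 = 0 := fun i => by rw [hm3, map_smul, hcm2, smul_zero]
  have hcm3' : b (1 ⊗ₜ c none) m3 = 1 := by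
    rw [hm3, map_smul, ← hu', smul_eq_mul, Units.inv_mul]
  have hε3 : b m3 m3 ∈ I := by rw [← hφ0, hbφ, hφm3, h.isotropic]
  -- Both the oddness of `p` and nonsplitness enter here.
  have hq : IsUnit (2 * b m3 (n none)) := by
    apply hunit
    rw [map_mul, hbφ, hφm3, hφn]
    refine IsUnit.mul ?_ (h.isUnit_baseChange_frob hV hB hs hns)
    have h2 : IsUnit (2 : ZMod p) := by
      rw [isUnit_iff_ne_zero]
      intro h2
      have : (p : ℕ) ∣ 2 := by
        rw [← ZMod.natCast_eq_zero_iff]; exact_mod_cast h2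
      exact hp ((Nat.prime_dvd_prime_iff_eq Fact.out Nat.prime_two).mp this)
    have := h2.map (algebraMap (ZMod p) (R ⧸ I))
    rwa [map_ofNat, ← map_ofNat φ] at this
  obtain ⟨q, hq'⟩ := hq
  clear_value m3
  -- On the affine line joining `m3` to `n none`, all the linear conditions persist, since both ends
  -- satisfy them. For a parameter `a` in `I` the self-pairing is `b m3 m3 + 2 * a * b m3 (n none)`,
  -- because `I ^ 2 = 0`; this `a` is its zero.
  set a := -(b m3 m3 * ↑q⁻¹) with ha
  have haI : a ∈ I := I.neg_mem (I.mul_mem_right _ hε3)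
  have haq : b m3 m3 + a * (2 * b m3 (n none)) = 0 := by
    rw [← hq', ha, neg_mul, mul_assoc, Units.inv_mul, mul_one, add_neg_cancel]
  set m := (1 - a) • m3 + a • n none with hm
  have hφm : mapV V φ m = x none := by
    rw [hm, map_add, tensor_sub_smul, one_smul, map_sub, hφm3, mapV_mk_eq_zero_of_mem I haI,
      mapV_mk_eq_zero_of_mem I haI, sub_zero, add_zero]
  have hfm : frobV V R m = n none :=
    frobV_eq_of_mapV_mk_eq I hI hB (by rw [← hφ, hφm, hxt])
  refine ⟨fun i => i.elim m l, ⟨hcl, ?_, ?_, ?_, ?_⟩, ?_⟩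
  · intro i
    change b _ m = 0
    rw [hm, map_add, map_smul, map_smul, hcm3, hcn2, smul_zero, smul_zero, add_zero]
  · change b _ m = 1
    rw [hm, map_add, map_smul, map_smul, hcm3', hcn3, smul_eq_mul, smul_eq_mul]
    ring
  · have hlm : ∀ i, b (l i) m = 0 := by
      intro i
      rw [hm, map_add, map_smul, map_smul, hlm3, hln, smul_zero, smul_zero, add_zero]
    have hmm : b m m = 0 := by
      have e1 := hI _ haI _ hε3
      have e2 := hI _ haI _ haI
      rw [hm]
      simp only [map_add, map_smul, LinearMap.add_apply, LinearMap.smul_apply, smul_eq_mul, hnn,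
        bsymm (n none) m3]
      linear_combination haq + (a - 2) * e1 - 2 * b m3 (n none) * e2
    rintro (_ | i) (_ | j)
    · exact hmm
    · change b m (l j) = 0
      rw [bsymm, hlm]
    · exact hlm i
    · exact hll i j
  · intro i
    change l i = frobV V R (l i) + (b _ (l i) - b _ (l i) ^ p) • frobV V R m
    rw [hfm]
    exact hlf i
  · rintro (_ | i)
    · exact hφm
    · exact hφl i

end Lift

end Algebra

end OrthDL

end

/-! ### Linear algebra for normalising frames by vectors of `V` -/

noncomputable section

namespace OrthDL

section Algebra

variable {p : ℕ} [Fact p.Prime] {V : Type v} [AddCommGroup V] [Module (ZMod p) V]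
  {R : Type*} [CommRing R] [Algebra (ZMod p) R]
  {B : LinearMap.BilinForm (ZMod p) V}

/-- A family of vectors in `K ⊗ V` with a dual family has a non-zero minor of maximal size with
respect to functionals defined over `𝔽_p`. -/
lemma exists_det_ne_zero {K : Type*} [Field K] [Algebra (ZMod p) K] {d : ℕ}
    {v w : Fin d → K ⊗[ZMod p] V}
    (h : ∀ i j, B.baseChange K (w i) (v j) = if i = j then 1 else 0) :
    ∃ f : Fin d → V, (Matrix.of fun i j => B.baseChange K (1 ⊗ₜ f i) (v j)).det ≠ 0 := by
  let T : V → Fin d → K := fun e j => B.baseChange K (1 ⊗ₜ e) (v j)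
  -- Evaluation vectors of elements of `K ⊗ V` are combinations of those of elements of `V`, and the
  -- dual family `w` yields the standard basis among the former. A basis can then be extracted from
  -- the range of `T`.
  have hspan : Submodule.span K (Set.range T) = ⊤ := by
    have h1 : ∀ t : K ⊗[ZMod p] V,
        (fun j => B.baseChange K t (v j)) ∈ Submodule.span K (Set.range T) := by
      intro t
      induction t using TensorProduct.induction_on with
      | zero =>
        simp only [map_zero, LinearMap.zero_apply]
        exact Submodule.zero_mem _
      | add s t hs ht =>
        simp only [map_add, LinearMap.add_apply]
        exact Submodule.add_mem _ hs ht
      | tmul a e =>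
        have : (fun j => B.baseChange K (a ⊗ₜ[ZMod p] e) (v j)) = a • T e := by
          ext j
          have e1 : a ⊗ₜ[ZMod p] e = a • (1 ⊗ₜ[ZMod p] e) := by
            rw [TensorProduct.smul_tmul', smul_eq_mul, mul_one]
          rw [e1]
          simp [T]
        rw [this]
        exact Submodule.smul_mem _ _ (Submodule.subset_span ⟨e, rfl⟩)
    rw [eq_top_iff, ← (Pi.basisFun K (Fin d)).span_eq, Submodule.span_le]
    rintro _ ⟨i, rfl⟩
    have e : Pi.basisFun K (Fin d) i = fun j => B.baseChange K (w i) (v j) := by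
      ext j
      simp [h, Pi.single_apply, eq_comm]
    rw [e]
    exact h1 (w i)
  obtain ⟨s, hs, hs', hli⟩ := exists_linearIndependent K (Set.range T)
  let b : Module.Basis s K (Fin d → K) := Module.Basis.mk hli (by
    rw [Subtype.range_coe, hs', hspan])
  have : Fintype s := FiniteDimensional.fintypeBasisIndex b
  have hcard : Fintype.card s = Fintype.card (Fin d) := by
    rw [← Module.finrank_eq_card_basis b]; simp
  let e := Fintype.equivOfCardEq hcard
  choose f hf using fun i => hs (e.symm i).2
  refine ⟨f, ?_⟩
  have hli' : LinearIndependent K fun i => T (f i) := by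
    have : (fun i => T (f i)) = (fun a : s => (a : Fin d → K)) ∘ e.symm := by
      ext1 i; exact hf i
    rw [this]
    exact hli.comp _ e.symm.injective
  have := Matrix.linearIndependent_rows_iff_isUnit.mp
    (show LinearIndependent K (Matrix.of fun i j => T (f i) j).row from hli')
  exact ((Matrix.isUnit_iff_isUnit_det _).mp this).ne_zero

/-- Normalisation of a family with respect to functionals with invertible matrix. -/
lemma exists_normalized {ι : Type*} [Fintype ι] [DecidableEq ι] {v : ι → R ⊗[ZMod p] V}
    (f : ι → V)
    (h : IsUnit (Matrix.of fun i j => B.baseChange R (1 ⊗ₜ f i) (v j)).det) :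
    ∃ l : ι → R ⊗[ZMod p] V, (∀ i, l i ∈ Submodule.span R (Set.range v)) ∧
      ∀ i j, B.baseChange R (1 ⊗ₜ f i) (l j) = if i = j then 1 else 0 := by
  set A := Matrix.of fun i j => B.baseChange R (1 ⊗ₜ f i) (v j)
  refine ⟨fun j => ∑ k, A⁻¹ k j • v k, fun j => Submodule.sum_mem _ fun k _ =>
    Submodule.smul_mem _ _ (Submodule.subset_span ⟨k, rfl⟩), fun i j => ?_⟩
  have := congrFun (congrFun (Matrix.mul_nonsing_inv A h) i) j
  rw [Matrix.mul_apply, Matrix.one_apply] at this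
  rw [← this, map_sum]
  refine Finset.sum_congr rfl fun k _ => ?_
  rw [map_smul, smul_eq_mul, mul_comm]
  rfl

/-- Over a field, `d` normalised vectors do not span a space containing `d + 1` independent
vectors, so that one of these has a non-trivial component in the kernel of the normalising
functionals. -/
lemma exists_sub_sum_ne_zero {K : Type*} [Field K] [Algebra (ZMod p) K] {d : ℕ}
    {v w : Fin (d + 1) → K ⊗[ZMod p] V}
    (h : ∀ i j, B.baseChange K (w i) (v j) = if i = j then 1 else 0)
    (l : Fin d → K ⊗[ZMod p] V) (a : Fin (d + 1) → Fin d → K) :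
    ∃ i, v i - ∑ j, a i j • l j ≠ 0 := by
  by_contra! hc
  have hli := linearIndependent_of_dual h
  have hle : Submodule.span K (Set.range v) ≤ Submodule.span K (Set.range l) := by
    rw [Submodule.span_le]
    rintro _ ⟨i, rfl⟩
    rw [sub_eq_zero.mp (hc i)]
    exact Submodule.sum_mem _ fun k _ => Submodule.smul_mem _ _ (Submodule.subset_span ⟨k, rfl⟩)
  have := FiniteDimensional.span_of_finite K (Set.finite_range l)
  have h1 := Submodule.finrank_mono hle
  rw [finrank_span_eq_card hli] at h1
  have h2 := finrank_range_le_card (R := K) l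
  rw [Set.finrank] at h2
  simp at h1 h2
  omega

/-- The functional equations of a chart determine the coordinates. -/
lemma IsChartPoint.eq_of_span_eq {d : ℕ} {c : Chart V d} {x y : Option (Fin d) → R ⊗[ZMod p] V}
    (hx : IsChartPoint B c x) (hy : IsChartPoint B c y)
    (h1 : Submodule.span R (Set.range fun i => x (some i))
      = Submodule.span R (Set.range fun i => y (some i)))
    (h2 : Submodule.span R (Set.range x) = Submodule.span R (Set.range y)) : x = y := by
  have hs : ∀ i, x (some i) = y (some i) := by
    intro i
    have : x (some i) ∈ Submodule.span R (Set.range fun i => y (some i)) := by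
      rw [← h1]; exact Submodule.subset_span ⟨i, rfl⟩
    rw [eq_sum_of_mem_span (w := fun i => 1 ⊗ₜ c (some i)) hy.some_some this]
    simp [hx.some_some]
  ext i
  rcases i with _ | i
  · have : x none ∈ Submodule.span R (Set.range y) := by
      rw [← h2]; exact Submodule.subset_span ⟨none, rfl⟩
    rw [eq_sum_of_mem_span hy.dual this, Fintype.sum_option]
    simp [chartDual, hx.some_none, hx.none_none]
  · exact hs i

end Algebra

end OrthDL

end

/-! ### Sections and subsheaves of `V ⊗ 𝒪_S`; pull-back, direct image and frames -/

noncomputable section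

namespace OrthDL

section Sections

lemma mapV_toAlgHom_comp {p : ℕ} [Fact p.Prime] {V : Type v} [AddCommGroup V] [Module (ZMod p) V]
    {R R' R'' : Type*} [CommRing R] [CommRing R'] [CommRing R'']
    [Algebra (ZMod p) R] [Algebra (ZMod p) R'] [Algebra (ZMod p) R'']
    (φ : R →+* R') (ψ : R' →+* R'') (χ : R →+* R'') (h : ψ.comp φ = χ) (t : R ⊗[ZMod p] V) :
    mapV V (toAlgHom p ψ) (mapV V (toAlgHom p φ) t) = mapV V (toAlgHom p χ) t := by
  rw [mapV_mapV]
  congr 1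
  subst h
  rfl

variable {p : ℕ} [Fact p.Prime] {k : Type u} [Field k] [Algebra (ZMod p) k]
  {V : Type v} [AddCommGroup V] [Module (ZMod p) V] {B : LinearMap.BilinForm (ZMod p) V}
  {S T Z : Sch k}

lemma baseChange_res {U W : S.left.Opens} (h : W ≤ U) (s t : Sect p V S U) :
    B.baseChange Γ(S.left, W) (res p V h s) (res p V h t)
      = (S.left.presheaf.map (homOfLE h).op).hom (B.baseChange Γ(S.left, U) s t) :=
  baseChange_mapV B _ s t

lemma res_one_tmul {U W : S.left.Opens} (h : W ≤ U) (e : V) :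
    res p V h (1 ⊗ₜ e : Sect p V S U) = 1 ⊗ₜ e :=
  mapV_one_tmul _ e

lemma pull_one_tmul (f : T ⟶ S) {U : S.left.Opens} {W : T.left.Opens} (h : W ≤ f.left ⁻¹ᵁ U)
    (e : V) : pull p V f h (1 ⊗ₜ e : Sect p V S U) = 1 ⊗ₜ e :=
  mapV_one_tmul _ e

lemma baseChange_pull (f : T ⟶ S) {U : S.left.Opens} {W : T.left.Opens} (h : W ≤ f.left ⁻¹ᵁ U)
    (s t : Sect p V S U) :
    B.baseChange Γ(T.left, W) (pull p V f h s) (pull p V f h t)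
      = (f.left.appLE U W h).hom (B.baseChange Γ(S.left, U) s t) :=
  baseChange_mapV B _ s t

lemma pull_smul (f : T ⟶ S) {U : S.left.Opens} {W : T.left.Opens} (h : W ≤ f.left ⁻¹ᵁ U)
    (a : Γ(S.left, U)) (t : Sect p V S U) :
    pull p V f h (a • t) = (f.left.appLE U W h).hom a • pull p V f h t :=
  mapV_smul _ a t

lemma res_frob {U W : S.left.Opens} (h : W ≤ U) (t : Sect p V S U) :
    res p V h (frob p V S U t) = frob p V S W (res p V h t) :=
  mapV_frobV _ t

lemma frob_smul {U : S.left.Opens} (a : Γ(S.left, U)) (t : Sect p V S U) :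
    frob p V S U (a • t) = a ^ p • frob p V S U t :=
  frobV_smul a t

lemma res_pull (f : T ⟶ S) {U : S.left.Opens} {W W' : T.left.Opens} (h : W ≤ f.left ⁻¹ᵁ U)
    (h' : W' ≤ W) (t : Sect p V S U) :
    res p V h' (pull p V f h t) = pull p V f (h'.trans h) t := by
  refine mapV_toAlgHom_comp _ _ _ ?_ t
  rw [← CommRingCat.hom_comp, Scheme.Hom.appLE_map]

lemma pull_res (f : T ⟶ S) {U U' : S.left.Opens} {W : T.left.Opens} (h : U' ≤ U)
    (h' : W ≤ f.left ⁻¹ᵁ U') (h'' : W ≤ f.left ⁻¹ᵁ U) (t : Sect p V S U) :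
    pull p V f h' (res p V h t) = pull p V f h'' t := by
  refine mapV_toAlgHom_comp _ _ _ ?_ t
  rw [← CommRingCat.hom_comp, Scheme.Hom.map_appLE]

lemma pull_pull (f : T ⟶ S) (g : Z ⟶ T) {U : S.left.Opens} {W : T.left.Opens} {W' : Z.left.Opens}
    (h : W ≤ f.left ⁻¹ᵁ U) (h' : W' ≤ g.left ⁻¹ᵁ W) (h'' : W' ≤ (g ≫ f).left ⁻¹ᵁ U)
    (t : Sect p V S U) :
    pull p V g h' (pull p V f h t) = pull p V (g ≫ f) h'' t := by
  refine mapV_toAlgHom_comp _ _ _ ?_ t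
  rw [← CommRingCat.hom_comp, Scheme.Hom.appLE_comp_appLE]
  rfl

lemma pull_id {U W : S.left.Opens} (h : W ≤ (𝟙 S : S ⟶ S).left ⁻¹ᵁ U) (h' : W ≤ U)
    (t : Sect p V S U) : pull p V (𝟙 S) h t = res p V h' t := by
  have : ((𝟙 S : S ⟶ S).left.appLE U W h) = S.left.presheaf.map (homOfLE h').op := by
    change (𝟙 S.left : S.left ⟶ S.left).appLE U W h = _
    simp only [Scheme.Hom.appLE, Scheme.Hom.id_app]
    exact Category.id_comp _
  rw [pull, res]
  congr 3

lemma pull_congr {f g : T ⟶ S} (hfg : f = g) {U : S.left.Opens} {W : T.left.Opens}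
    (h : W ≤ f.left ⁻¹ᵁ U) (h' : W ≤ g.left ⁻¹ᵁ U) (t : Sect p V S U) :
    pull p V f h t = pull p V g h' t := by
  subst hfg; rfl

/-- Functions which agree locally are equal. -/
lemma function_ext {U : S.left.Opens} {a b : Γ(S.left, U)}
    (h : ∀ x ∈ U, ∃ (W : S.left.Opens) (h : W ≤ U), x ∈ W ∧
      (S.left.presheaf.map (homOfLE h).op).hom a = (S.left.presheaf.map (homOfLE h).op).hom b) :
    a = b := by
  choose W hW hx hWe using h
  refine TopCat.Sheaf.eq_of_locally_eq' S.left.sheaf (fun x : U => W x.1 x.2) U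
    (fun x => homOfLE (hW x.1 x.2)) ?_ _ _ fun x => hWe x.1 x.2
  intro x hxU
  exact TopologicalSpace.Opens.mem_iSup.mpr ⟨⟨x, hxU⟩, hx x hxU⟩

/-- Sections of `V ⊗ 𝒪_S` which agree locally are equal. -/
lemma sect_ext [FiniteDimensional (ZMod p) V] (hB : B.Nondegenerate) {U : S.left.Opens}
    {s t : Sect p V S U}
    (h : ∀ x ∈ U, ∃ (W : S.left.Opens) (h : W ≤ U), x ∈ W ∧ res p V h s = res p V h t) :
    s = t := by
  classical
  let e := Module.finBasis (ZMod p) V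
  rw [sum_dualBasis hB e s, sum_dualBasis hB e t]
  refine Finset.sum_congr rfl fun a _ => ?_
  congr 1
  refine function_ext fun x hx => ?_
  obtain ⟨W, hW, hxW, hWe⟩ := h x hx
  refine ⟨W, hW, hxW, ?_⟩
  have := congrArg (B.baseChange _ (1 ⊗ₜ B.dualBasis hB e a)) hWe
  rwa [← res_one_tmul hW, baseChange_res, baseChange_res] at this

end Sections

namespace Subsheaf

variable {p : ℕ} [Fact p.Prime] {k : Type u} [Field k] [Algebra (ZMod p) k]
  {V : Type v} [AddCommGroup V] [Module (ZMod p) V] {B : LinearMap.BilinForm (ZMod p) V}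
  {S T Z : Sch k}

lemma Le.antisymm {L M : Subsheaf p V S} (h : L.Le M) (h' : M.Le L) : L = M := by
  ext U t
  exact ⟨fun ht => h U ht, fun ht => h' U ht⟩

lemma Le.refl (L : Subsheaf p V S) : L.Le L := fun _ => le_rfl

lemma le_of_local {L M : Subsheaf p V S}
    (h : ∀ x : S.left, ∃ U : S.left.Opens, x ∈ U ∧ ∀ W ≤ U, L.sec W ≤ M.sec W) : L.Le M := by
  intro U t ht
  refine M.local_mem fun x hx => ?_
  obtain ⟨U', hx', h'⟩ := h x
  exact ⟨U ⊓ U', inf_le_left, ⟨hx, hx'⟩, h' _ inf_le_right (L.res_mem _ ht)⟩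

lemma ext_of_local {L M : Subsheaf p V S}
    (h : ∀ x : S.left, ∃ U : S.left.Opens, x ∈ U ∧ ∀ W ≤ U, L.sec W = M.sec W) : L = M := by
  apply Le.antisymm <;> refine le_of_local fun x => ?_ <;> obtain ⟨U, hx, h'⟩ := h x
  exacts [⟨U, hx, fun W hW => (h' W hW).le⟩, ⟨U, hx, fun W hW => (h' W hW).ge⟩]

lemma subset_gen (G : ∀ U : S.left.Opens, Set (Sect p V S U)) {U : S.left.Opens}
    {t : Sect p V S U} (ht : t ∈ G U) : t ∈ (gen G).sec U := by
  intro x hx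
  exact ⟨U, le_rfl, hx, Submodule.subset_span ⟨U, le_rfl, t, ht, rfl⟩⟩

lemma gen_le_iff {G : ∀ U : S.left.Opens, Set (Sect p V S U)} {M : Subsheaf p V S} :
    (gen G).Le M ↔ ∀ U, G U ⊆ M.sec U := by
  constructor
  · exact fun h U t ht => h U (subset_gen G ht)
  · intro h U t ht
    refine M.local_mem fun x hx => ?_
    obtain ⟨W, hW, hxW, ht⟩ := ht x hx
    refine ⟨W, hW, hxW, ?_⟩
    have : Submodule.span Γ(S.left, W) (restrictions G W) ≤ M.sec W := by
      rw [Submodule.span_le]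
      rintro _ ⟨U', h', g, hg, rfl⟩
      exact M.res_mem _ (h _ hg)
    exact this ht

/-- The direct image of a subsheaf of `V ⊗ 𝒪_T` along `f : T ⟶ S`, as the subsheaf of `V ⊗ 𝒪_S` of
the sections whose pull-backs belong to it. -/
def push (f : T ⟶ S) (K : Subsheaf p V T) : Subsheaf p V S where
  sec U :=
    { carrier := {t | pull p V f (le_refl (f.left ⁻¹ᵁ U)) t ∈ K.sec (f.left ⁻¹ᵁ U)}
      zero_mem' := by
        change pull p V f (le_refl (f.left ⁻¹ᵁ U)) 0 ∈ K.sec (f.left ⁻¹ᵁ U)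
        rw [map_zero]; exact Submodule.zero_mem _
      add_mem' := by
        intro s t hs ht
        change pull p V f (le_refl (f.left ⁻¹ᵁ U)) (s + t) ∈ K.sec (f.left ⁻¹ᵁ U)
        rw [map_add]
        exact Submodule.add_mem _ hs ht
      smul_mem' := by
        intro a t ht
        change pull p V f (le_refl (f.left ⁻¹ᵁ U)) (a • t) ∈ K.sec (f.left ⁻¹ᵁ U)
        rw [pull_smul]
        exact Submodule.smul_mem _ _ ht }
  res_mem := by
    intro U W h t ht
    change pull p V f (le_refl (f.left ⁻¹ᵁ W)) (res p V h t) ∈ K.sec (f.left ⁻¹ᵁ W)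
    have h' : f.left ⁻¹ᵁ W ≤ f.left ⁻¹ᵁ U := (TopologicalSpace.Opens.map f.left.base).monotone h
    rw [pull_res f h le_rfl h', ← res_pull f le_rfl h']
    exact K.res_mem h' ht
  local_mem := by
    intro U t ht
    refine K.local_mem fun x hx => ?_
    obtain ⟨W, h, hxW, hW⟩ := ht (f.left.base x) hx
    change pull p V f (le_refl (f.left ⁻¹ᵁ W)) (res p V h t) ∈ K.sec (f.left ⁻¹ᵁ W) at hW
    have h' : f.left ⁻¹ᵁ W ≤ f.left ⁻¹ᵁ U := (TopologicalSpace.Opens.map f.left.base).monotone h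
    refine ⟨f.left ⁻¹ᵁ W, h', hxW, ?_⟩
    rw [res_pull f le_rfl h', ← pull_res f h le_rfl h']
    exact hW

lemma mem_push {f : T ⟶ S} {K : Subsheaf p V T} {U : S.left.Opens} {t : Sect p V S U} :
    t ∈ (K.push f).sec U ↔ pull p V f (le_refl (f.left ⁻¹ᵁ U)) t ∈ K.sec (f.left ⁻¹ᵁ U) := Iff.rfl

/-- The adjunction between pull-back and direct image; functoriality of the pull-back follows
formally from that of `push`. -/
lemma pullback_le_iff {f : T ⟶ S} {L : Subsheaf p V S} {K : Subsheaf p V T} :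
    (L.pullback f).Le K ↔ L.Le (K.push f) := by
  rw [pullback, gen_le_iff]
  constructor
  · intro h U t ht
    exact h _ ⟨U, le_rfl, t, ht, rfl⟩
  · rintro h W _ ⟨U, hU, s, hs, rfl⟩
    rw [← res_pull f le_rfl hU]
    exact K.res_mem _ (h _ hs)

lemma pull_mem_pullback (f : T ⟶ S) (L : Subsheaf p V S) {U : S.left.Opens} {W : T.left.Opens}
    (h : W ≤ f.left ⁻¹ᵁ U) {t : Sect p V S U} (ht : t ∈ L.sec U) :
    pull p V f h t ∈ (L.pullback f).sec W :=
  subset_gen _ ⟨U, h, t, ht, rfl⟩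

lemma push_comp (f : T ⟶ S) (g : Z ⟶ T) (K : Subsheaf p V Z) :
    K.push (g ≫ f) = (K.push g).push f := by
  ext U t
  exact iff_of_eq (congrArg (· ∈ K.sec _) (pull_pull f g le_rfl le_rfl le_rfl t).symm)

lemma pullback_comp (f : T ⟶ S) (g : Z ⟶ T) (L : Subsheaf p V S) :
    L.pullback (g ≫ f) = (L.pullback f).pullback g := by
  have h : ∀ K : Subsheaf p V Z, (L.pullback (g ≫ f)).Le K ↔ ((L.pullback f).pullback g).Le K := by
    intro K
    rw [pullback_le_iff, pullback_le_iff, pullback_le_iff, push_comp]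
  exact Le.antisymm ((h _).mpr (Le.refl _)) ((h _).mp (Le.refl _))

lemma push_id (K : Subsheaf p V S) : K.push (𝟙 S) = K := by
  ext U t
  exact iff_of_eq (congrArg (· ∈ K.sec _) ((pull_id le_rfl le_rfl t).trans (res_refl t)))

lemma pullback_id (L : Subsheaf p V S) : L.pullback (𝟙 S) = L := by
  have h : ∀ K : Subsheaf p V S, (L.pullback (𝟙 S)).Le K ↔ L.Le K := by
    intro K
    rw [pullback_le_iff, push_id]
  exact Le.antisymm ((h _).mpr (Le.refl _)) ((h _).mp (Le.refl _))

/-- The family `v` is a basis of `L` on `U`, and `w` is a dual family, so that `L` is a direct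
summand of `V ⊗ 𝒪_U`. -/
structure IsFrame (B : LinearMap.BilinForm (ZMod p) V) (L : Subsheaf p V S) (U : S.left.Opens)
    {ι : Type*} [Fintype ι] [DecidableEq ι] (v w : ι → Sect p V S U) : Prop where
  dual : ∀ i j, B.baseChange Γ(S.left, U) (w i) (v j) = if i = j then 1 else 0
  span : ∀ (W : S.left.Opens) (h : W ≤ U),
    Submodule.span Γ(S.left, W) (Set.range fun i => res p V h (v i)) = L.sec W

section Frame

variable {ι : Type*} [Fintype ι] [DecidableEq ι] {L : Subsheaf p V S} {U : S.left.Opens}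
  {v w : ι → Sect p V S U}

omit [Fintype ι] in
lemma dual_res (h : ∀ i j, B.baseChange Γ(S.left, U) (w i) (v j) = if i = j then 1 else 0)
    {W : S.left.Opens} (hW : W ≤ U) (i j : ι) :
    B.baseChange Γ(S.left, W) (res p V hW (w i)) (res p V hW (v j)) = if i = j then 1 else 0 := by
  rw [baseChange_res, h]
  split_ifs
  exacts [map_one _, map_zero _]

lemma IsFrame.mem (hf : IsFrame B L U v w) (i : ι) : v i ∈ L.sec U := by
  rw [← hf.span U le_rfl]
  exact Submodule.subset_span ⟨i, res_refl _⟩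

lemma IsFrame.res (hf : IsFrame B L U v w) {W : S.left.Opens} (h : W ≤ U) :
    IsFrame B L W (fun i => OrthDL.res p V h (v i)) (fun i => OrthDL.res p V h (w i)) where
  dual := dual_res hf.dual h
  span W' h' := by
    rw [← hf.span W' (h'.trans h)]
    simp only [res_res]

lemma IsFrame.mem_iff (hf : IsFrame B L U v w) {W : S.left.Opens} (h : W ≤ U) {t : Sect p V S W} :
    t ∈ L.sec W ↔
      t = ∑ i, B.baseChange Γ(S.left, W) (OrthDL.res p V h (w i)) t • OrthDL.res p V h (v i) := by
  rw [← hf.span W h, mem_span_iff_eq_sum (dual_res hf.dual h)]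

lemma IsFrame.of_card_eq (hf : IsFrame B L U v w) {ι' : Type*} [Fintype ι'] [DecidableEq ι']
    {v' w' : ι' → Sect p V S U}
    (h : ∀ i j, B.baseChange Γ(S.left, U) (w' i) (v' j) = if i = j then 1 else 0)
    (hc : Fintype.card ι' = Fintype.card ι) (hv : ∀ i, v' i ∈ L.sec U) : IsFrame B L U v' w' where
  dual := h
  span W hW := by
    rw [← hf.span W hW]
    refine span_eq_of_dual hc (dual_res h hW) fun i => ?_
    rw [hf.span W hW]
    exact L.res_mem hW (hv i)

/-- Sections of `gen G` are only locally combinations of generators. The dual family provides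
coefficients globally, and the resulting expansion in `v` is an identity that can be checked
locally. -/
lemma isFrame_gen [FiniteDimensional (ZMod p) V] (hB : B.Nondegenerate)
    {G : ∀ U : S.left.Opens, Set (Sect p V S U)}
    (h : ∀ i j, B.baseChange Γ(S.left, U) (w i) (v j) = if i = j then 1 else 0)
    (hv : ∀ i, v i ∈ (gen G).sec U)
    (hG : ∀ (U' W : S.left.Opens) (hU : W ≤ U) (hU' : W ≤ U'), ∀ g ∈ G U',
      OrthDL.res p V hU' g ∈
        Submodule.span Γ(S.left, W) (Set.range fun i => OrthDL.res p V hU (v i))) :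
    IsFrame B (gen G) U v w where
  dual := h
  span W hW := by
    apply le_antisymm
    · rw [Submodule.span_le]
      rintro _ ⟨i, rfl⟩
      exact (gen G).res_mem hW (hv i)
    · intro t ht
      rw [mem_span_iff_eq_sum (dual_res h hW)]
      apply sect_ext hB
      intro x hx
      obtain ⟨W', hW', hxW', ht'⟩ := ht x hx
      refine ⟨W', hW', hxW', ?_⟩
      have hle : Submodule.span Γ(S.left, W') (restrictions G W') ≤
          Submodule.span Γ(S.left, W')
            (Set.range fun i => OrthDL.res p V (hW'.trans hW) (v i)) := by
        rw [Submodule.span_le]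
        rintro _ ⟨U', h', g, hg, rfl⟩
        exact hG U' W' (hW'.trans hW) h' g hg
      rw [eq_sum_of_mem_span (dual_res h (hW'.trans hW)) (hle ht'), map_sum]
      refine Finset.sum_congr rfl fun i _ => ?_
      rw [res_smul, ← baseChange_res, res_res, res_res]

lemma IsFrame.frobPullback [FiniteDimensional (ZMod p) V] (hB : B.Nondegenerate)
    (hf : IsFrame B L U v w) :
    IsFrame B L.frobPullback U (fun i => frob p V S U (v i)) (fun i => frob p V S U (w i)) := by
  refine isFrame_gen hB ?_ ?_ ?_
  · intro i j
    have := baseChange_frobV B (w i) (v j)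
    rw [hf.dual] at this
    refine this.trans ?_
    split_ifs
    exacts [one_pow _, zero_pow (Fact.out : p.Prime).ne_zero]
  · intro i
    exact subset_gen _ ⟨_, hf.mem i, rfl⟩
  · rintro U' W hU hU' _ ⟨g, hg, rfl⟩
    have hg' := L.res_mem hU' hg
    rw [hf.mem_iff hU] at hg'
    rw [res_frob, hg', map_sum]
    refine Submodule.sum_mem _ fun i _ => ?_
    rw [frob_smul, ← res_frob]
    exact Submodule.smul_mem _ _ (Submodule.subset_span ⟨i, rfl⟩)

lemma IsFrame.pullback [FiniteDimensional (ZMod p) V] (hB : B.Nondegenerate)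
    (hf : IsFrame B L U v w) (f : T ⟶ S) {W : T.left.Opens} (h : W ≤ f.left ⁻¹ᵁ U) :
    IsFrame B (L.pullback f) W (fun i => pull p V f h (v i)) (fun i => pull p V f h (w i)) := by
  refine isFrame_gen hB ?_ ?_ ?_
  · intro i j
    rw [baseChange_pull, hf.dual]
    split_ifs
    exacts [map_one _, map_zero _]
  · intro i
    exact pull_mem_pullback f L h (hf.mem i)
  · rintro U' W' hW hW' _ ⟨U'', h'', s, hs, rfl⟩
    have hs' := L.res_mem (inf_le_right : U ⊓ U'' ≤ U'') hs
    rw [hf.mem_iff inf_le_left] at hs'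
    have hle : W' ≤ f.left ⁻¹ᵁ (U ⊓ U'') := le_inf (hW.trans h) (hW'.trans h'')
    rw [res_pull, ← pull_res f inf_le_right hle, hs', map_sum]
    refine Submodule.sum_mem _ fun i _ => ?_
    rw [pull_smul, pull_res f inf_le_left hle (hW.trans h), ← res_pull f h hW]
    exact Submodule.smul_mem _ _ (Submodule.subset_span ⟨i, rfl⟩)

/-- The subsheaf of the sections orthogonal on `U` to a given family. -/
def orthogonal (B : LinearMap.BilinForm (ZMod p) V) {ι : Type*} {U : S.left.Opens}
    (w : ι → Sect p V S U) : Subsheaf p V S where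
  sec W :=
    { carrier := {t | ∀ i, B.baseChange Γ(S.left, W ⊓ U) (OrthDL.res p V inf_le_right (w i))
        (OrthDL.res p V inf_le_left t) = 0}
      zero_mem' := fun i => by rw [map_zero, map_zero]
      add_mem' := fun hs ht i => by rw [map_add, map_add, hs i, ht i, add_zero]
      smul_mem' := fun a t ht i => by rw [res_smul, map_smul, ht i, smul_zero] }
  res_mem := by
    intro W W' h t ht i
    have hle : W' ⊓ U ≤ W ⊓ U := inf_le_inf_right U h
    have := congrArg (S.left.presheaf.map (homOfLE hle).op).hom (ht i)
    rw [← baseChange_res, res_res, res_res, map_zero] at this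
    rw [res_res]
    exact this
  local_mem := by
    intro W t ht i
    refine function_ext fun x hx => ?_
    obtain ⟨N, hN, hxN, hN'⟩ := ht x hx.1
    have hle := inf_le_inf_right U hN
    refine ⟨N ⊓ U, hle, ⟨hxN, hx.2⟩, ?_⟩
    have := hN' i
    rw [res_res, ← res_res inf_le_left hle, ← res_res inf_le_right hle, baseChange_res] at this
    rw [map_zero]
    exact this

lemma mem_orthogonal {ι : Type*} {U W : S.left.Opens} (hW : W ≤ U)
    {w : ι → Sect p V S U} {t : Sect p V S W} :
    t ∈ (orthogonal B w).sec W ↔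
      ∀ i, B.baseChange Γ(S.left, W) (OrthDL.res p V hW (w i)) t = 0 := by
  have hle : W ≤ W ⊓ U := le_inf le_rfl hW
  have hle' : W ⊓ U ≤ W := inf_le_left
  constructor
  · intro h i
    have := congrArg (S.left.presheaf.map (homOfLE hle).op).hom (h i)
    rw [← baseChange_res, res_res, res_res, map_zero, res_refl] at this
    exact this
  · intro h i
    have := congrArg (S.left.presheaf.map (homOfLE hle').op).hom (h i)
    rw [← baseChange_res, res_res, map_zero] at this
    exact this

/-- Pairing with the dual family gives a projection onto `L`, whose kernel is the complement. -/
lemma IsFrame.isCompl (hf : IsFrame B L U v w) {W : S.left.Opens} (hW : W ≤ U) :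
    IsCompl (L.sec W) ((orthogonal B w).sec W) := by
  have hd := dual_res hf.dual hW
  constructor
  · rw [Submodule.disjoint_def]
    intro t ht ht'
    rw [mem_orthogonal hW] at ht'
    rw [hf.mem_iff hW] at ht
    rw [ht]
    exact Finset.sum_eq_zero fun i _ => by rw [ht' i, zero_smul]
  · rw [codisjoint_iff, eq_top_iff]
    intro t _
    let t' := ∑ i, B.baseChange Γ(S.left, W) (OrthDL.res p V hW (w i)) t • OrthDL.res p V hW (v i)
    rw [show t = t' + (t - t') by abel]
    refine Submodule.add_mem_sup ?_ ?_
    · exact Submodule.sum_mem _ fun i _ => Submodule.smul_mem _ _ (L.res_mem hW (hf.mem i))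
    · rw [mem_orthogonal hW]
      intro i
      rw [map_sub, sub_eq_zero]
      simp [t', hd]

lemma isLocallyDirectSummand_of_frames
    (h : ∀ x : S.left, ∃ U : S.left.Opens, x ∈ U ∧ ∃ v w : ι → Sect p V S U, IsFrame B L U v w) :
    L.IsLocallyDirectSummand := by
  intro x
  obtain ⟨U, hx, v, w, hf⟩ := h x
  exact ⟨U, hx, orthogonal B w, fun W hW => hf.isCompl hW⟩

lemma memGr_of_frames {r : ℕ} (hr : Fintype.card ι = r)
    (h : ∀ x : S.left, ∃ U : S.left.Opens, x ∈ U ∧ ∃ v w : ι → Sect p V S U, IsFrame B L U v w) :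
    L.MemGr r := by
  refine ⟨isLocallyDirectSummand_of_frames h, fun x => ?_⟩
  obtain ⟨U, hx, v, w, hf⟩ := h x
  let e : Fin r ≃ ι := (Fintype.equivFinOfCardEq hr).symm
  refine ⟨U, hx, v ∘ e, fun W hW => ⟨?_, ?_⟩⟩
  · exact (linearIndependent_of_dual (dual_res hf.dual hW)).comp e e.injective
  · rw [← hf.span W hW]
    congr 1
    exact e.surjective.range_comp fun i => OrthDL.res p V hW (v i)

lemma isTotallyIsotropic_of_frames
    (h : ∀ x : S.left, ∃ U : S.left.Opens, x ∈ U ∧ ∃ v w : ι → Sect p V S U, IsFrame B L U v w ∧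
      ∀ i j, B.baseChange Γ(S.left, U) (v i) (v j) = 0) : L.IsTotallyIsotropic B := by
  intro U s hs t ht
  refine function_ext fun x hx => ?_
  obtain ⟨N, hxN, v, w, hf, hv⟩ := h x
  refine ⟨U ⊓ N, inf_le_left, ⟨hx, hxN⟩, ?_⟩
  have hs' := L.res_mem (inf_le_left : U ⊓ N ≤ U) hs
  have ht' := L.res_mem (inf_le_left : U ⊓ N ≤ U) ht
  rw [hf.mem_iff inf_le_right] at hs' ht'
  rw [← baseChange_res, hs', ht', map_zero]
  simp only [map_sum, map_smul, LinearMap.sum_apply, LinearMap.smul_apply, baseChange_res, hv,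
    map_zero, smul_zero, Finset.sum_const_zero]

/-- The coordinates of the projection onto `L` along a complement are linear functionals on `V ⊗
𝒪_S`; nondegeneracy turns them into pairings with sections, which form the dual family. -/
lemma MemGr.exists_isFrame [FiniteDimensional (ZMod p) V] (hB : B.Nondegenerate) {r : ℕ}
    (hL : L.MemGr r) (x : S.left) :
    ∃ U : S.left.Opens, x ∈ U ∧ ∃ v w : Fin r → Sect p V S U, IsFrame B L U v w := by
  obtain ⟨U, hx, M, hM⟩ := hL.1 x
  obtain ⟨U', hx', b, hb⟩ := hL.2 x
  refine ⟨U ⊓ U', ⟨hx, hx'⟩, fun i => OrthDL.res p V inf_le_right (b i), ?_⟩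
  obtain ⟨hli, hsp⟩ := hb _ (inf_le_right : U ⊓ U' ≤ U')
  have hc := hM _ (inf_le_left : U ⊓ U' ≤ U)
  let bas := (Module.Basis.span hli).map (LinearEquiv.ofEq _ _ hsp)
  have hw : ∀ i, ∃ w : Sect p V S (U ⊓ U'), ∀ t, B.baseChange _ w t =
      (bas.coord i ∘ₗ Submodule.projectionOnto _ _ hc) t := fun i => exists_eq_baseChange hB _
  choose w hw using hw
  refine ⟨w, ⟨fun i j => ?_, fun W hW => ?_⟩⟩
  · rw [hw]
    have hbj : OrthDL.res p V inf_le_right (b j) = (bas j : Sect p V S (U ⊓ U')) := by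
      simp [bas, Module.Basis.span_apply]
    rw [hbj, LinearMap.comp_apply]
    refine (congrArg (bas.coord i) (Submodule.projectionOnto_apply_left hc (bas j))).trans ?_
    simp [Finsupp.single_apply, eq_comm]
  · rw [← (hb W (hW.trans inf_le_right)).2]
    simp only [res_res]

end Frame

end Subsheaf

end OrthDL

end

/-! ### Pairs of the moduli problem and chart points -/

noncomputable section

namespace OrthDL

lemma mapV_chartDual {p : ℕ} [Fact p.Prime] {V : Type v} [AddCommGroup V] [Module (ZMod p) V]
    {R R' : Type*} [CommRing R] [CommRing R'] [Algebra (ZMod p) R] [Algebra (ZMod p) R']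
    {B : LinearMap.BilinForm (ZMod p) V} {d : ℕ} (φ : R →ₐ[ZMod p] R') (c : Chart V d)
    (x : Option (Fin d) → R ⊗[ZMod p] V) (i : Option (Fin d)) :
    mapV V φ (chartDual B c x i) = chartDual B c (fun j => mapV V φ (x j)) i := by
  cases i with
  | some i => exact mapV_one_tmul φ _
  | none =>
    simp only [chartDual, map_sub, map_sum]
    congr 1
    · exact mapV_one_tmul φ _
    · refine Finset.sum_congr rfl fun j _ => ?_
      rw [mapV_smul, mapV_one_tmul, ← baseChange_mapV, mapV_one_tmul]

open Subsheaf

variable {p : ℕ} [Fact p.Prime] {k : Type u} [Field k] [Algebra (ZMod p) k]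
  {V : Type v} [AddCommGroup V] [Module (ZMod p) V] {B : LinearMap.BilinForm (ZMod p) V}
  {S T Z : Sch k} {d : ℕ}

/-- The pair `P` is given on `U` by the point `x` of the chart `c`. -/
structure IsChartFrame (B : LinearMap.BilinForm (ZMod p) V) (c : Chart V d)
    (P : Subsheaf p V S × Subsheaf p V S) (U : S.left.Opens)
    (x : Option (Fin d) → Sect p V S U) : Prop where
  point : IsChartPoint B c x
  fst : IsFrame B P.1 U (fun i => x (some i)) (fun i => 1 ⊗ₜ c (some i))
  snd : IsFrame B P.2 U x (chartDual B c x)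

namespace IsChartFrame

variable {c : Chart V d} {P Q : Subsheaf p V S × Subsheaf p V S} {U : S.left.Opens}
  {x y : Option (Fin d) → Sect p V S U}

lemma res (h : IsChartFrame B c P U x) {W : S.left.Opens} (hW : W ≤ U) :
    IsChartFrame B c P W fun i => OrthDL.res p V hW (x i) where
  point := h.point.map _
  fst := by
    have := h.fst.res hW
    simp only [res_one_tmul] at this
    exact this
  snd := by
    have := h.snd.res hW
    have e : (fun i => OrthDL.res p V hW (chartDual B c x i)) = chartDual B c _ :=
      funext fun i => mapV_chartDual _ c x i
    rw [e] at this
    exact this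

lemma pullback [FiniteDimensional (ZMod p) V] (hB : B.Nondegenerate) (h : IsChartFrame B c P U x)
    (f : T ⟶ S) {W : T.left.Opens} (hW : W ≤ f.left ⁻¹ᵁ U) :
    IsChartFrame B c (P.1.pullback f, P.2.pullback f) W fun i => pull p V f hW (x i) where
  point := h.point.map _
  fst := by
    have := h.fst.pullback hB f hW
    simp only [pull_one_tmul] at this
    exact this
  snd := by
    have := h.snd.pullback hB f hW
    have e : (fun i => pull p V f hW (chartDual B c x i)) = chartDual B c _ :=
      funext fun i => mapV_chartDual _ c x i
    rw [e] at this
    exact this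

lemma unique (hx : IsChartFrame B c P U x) (hy : IsChartFrame B c P U y) : x = y := by
  refine hx.point.eq_of_span_eq hy.point ?_ ?_
  · have h1 := hx.fst.span U le_rfl
    have h2 := hy.fst.span U le_rfl
    simp only [res_refl] at h1 h2
    rw [h1, h2]
  · have h1 := hx.snd.span U le_rfl
    have h2 := hy.snd.span U le_rfl
    simp only [res_refl] at h1 h2
    rw [h1, h2]

lemma ext_of_local (h : ∀ s : S.left, ∃ U : S.left.Opens, s ∈ U ∧ ∃ (c : Chart V d)
    (x : Option (Fin d) → Sect p V S U), IsChartFrame B c P U x ∧ IsChartFrame B c Q U x) :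
    P = Q := by
  apply Prod.ext <;> refine Subsheaf.ext_of_local fun s => ?_ <;>
    obtain ⟨U, hs, c, x, h1, h2⟩ := h s
  · exact ⟨U, hs, fun W hW => (h1.fst.span W hW).symm.trans (h2.fst.span W hW)⟩
  · exact ⟨U, hs, fun W hW => (h1.snd.span W hW).symm.trans (h2.snd.span W hW)⟩

lemma le (h : IsChartFrame B c P U x) {W : S.left.Opens} (hW : W ≤ U) : P.1.sec W ≤ P.2.sec W := by
  rw [← h.fst.span W hW, ← h.snd.span W hW]
  exact Submodule.span_mono (Set.range_comp_subset_range some fun i => OrthDL.res p V hW (x i))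

lemma le_frobPullback [FiniteDimensional (ZMod p) V] (hB : B.Nondegenerate)
    (h : IsChartFrame B c P U x) {W : S.left.Opens} (hW : W ≤ U) :
    P.1.sec W ≤ P.2.frobPullback.sec W := by
  rw [← h.fst.span W hW, Submodule.span_le]
  rintro _ ⟨i, rfl⟩
  have hm := (h.snd.frobPullback hB).mem
  refine P.2.frobPullback.res_mem hW ?_
  have e := h.point.frob i
  rw [e]
  exact Submodule.add_mem _ (hm _) (Submodule.smul_mem _ _ (hm none))

/-- Given a pair coming from a chart, `ℒ_{d+1} + Frob^* ℒ_{d+1}` has a frame. -/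
lemma exists_isFrame_add [FiniteDimensional (ZMod p) V]
    (hV : Module.finrank (ZMod p) V = 2 * (d + 1)) (hB : B.Nondegenerate) (hs : B.IsSymm)
    (hns : IsNonsplit B d) (h : IsChartFrame B c P U x) :
    ∃ v w : Option (Option (Fin d)) → Sect p V S U,
      IsFrame B (P.2.add P.2.frobPullback) U v w := by
  obtain ⟨u, hu⟩ := h.point.isUnit_baseChange_frob hV hB hs hns
  set n := frob p V S U (x none) with hn
  change (u : Γ(S.left, U)) = B.baseChange _ (x none) n at hu
  have hxn : ∀ i : Fin d, B.baseChange _ (x (some i)) n = 0 := h.point.some_frob_none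
  have hnn : B.baseChange _ n n = 0 := h.point.frob_isotropic none none
  have hcn : ∀ i : Fin d, B.baseChange _ (1 ⊗ₜ c (some i)) n = 0 := h.point.chart_frob_none
  have hb := fun s t => baseChange_symm hs (R := Γ(S.left, U)) s t
  let v : Option (Option (Fin d)) → Sect p V S U := fun i => i.elim n x
  -- The vectors `x none` and `n` are isotropic and pair to the unit `u`, so after division by `u`
  -- each is dual to the other.
  let w : Option (Option (Fin d)) → Sect p V S U := fun i => i.elim
    ((u⁻¹ : Γ(S.left, U)ˣ).1 • x none) fun i => i.elim
    ((u⁻¹ : Γ(S.left, U)ˣ).1 • n) fun i => 1 ⊗ₜ c (some i)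
  refine ⟨v, w, isFrame_gen hB ?_ ?_ ?_⟩
  · rintro (_ | _ | i) (_ | _ | j)
    · simp [v, w, ← hu]
    · simp [v, w, h.point.isotropic]
    · simp [v, w, h.point.isotropic]
    · simp [v, w, hnn]
    · simp [v, w, hb n, ← hu]
    · simp [v, w, hb n, hxn]
    · simp [v, w, hcn]
    · simp [v, w, h.point.some_none]
    · simp [v, w, h.point.some_some]
  · have hm := (h.snd.frobPullback hB).mem
    rintro (_ | i)
    · exact subset_gen _ (Or.inr (hm none))
    · exact subset_gen _ (Or.inl (h.snd.mem i))
  · intro U' W hU hU' g hg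
    have hx : ∀ i, OrthDL.res p V hU (x i) ∈
        Submodule.span Γ(S.left, W) (Set.range fun i => OrthDL.res p V hU (v i)) :=
      fun i => Submodule.subset_span ⟨some i, rfl⟩
    have hn' : OrthDL.res p V hU n ∈
        Submodule.span Γ(S.left, W) (Set.range fun i => OrthDL.res p V hU (v i)) :=
      Submodule.subset_span ⟨none, rfl⟩
    rcases hg with hg | hg
    · have := P.2.res_mem hU' hg
      rw [← h.snd.span W hU] at this
      refine (Submodule.span_le.mpr ?_) this
      rintro _ ⟨i, rfl⟩
      exact hx i
    · have := P.2.frobPullback.res_mem hU' hg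
      rw [← (h.snd.frobPullback hB).span W hU] at this
      refine (Submodule.span_le.mpr ?_) this
      rintro _ ⟨_ | i, rfl⟩
      · exact hn'
      -- The other Frobenius images differ from the `x (some i)` by multiples of `n`, so `n` is the
      -- only new generator of the sum.
      · have e : x (some i) = frob p V S U (x (some i)) + _ • n := h.point.frob i
        have e' := congrArg (OrthDL.res p V hU) e
        rw [map_add, res_smul] at e'
        exact (Submodule.add_mem_iff_left _ (Submodule.smul_mem _ _ hn')).mp (e' ▸ hx (some i))

end IsChartFrame

/-- Converse to `exists_isChartFrame`. Nonsplitness serves only to supply the direct summand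
condition, through `exists_isFrame_add`. -/
lemma mem_moduliSet_of_isChartFrame [FiniteDimensional (ZMod p) V]
    (hV : Module.finrank (ZMod p) V = 2 * (d + 1)) (hB : B.Nondegenerate) (hs : B.IsSymm)
    (hns : IsNonsplit B d) {P : Subsheaf p V S × Subsheaf p V S}
    (h : ∀ s : S.left, ∃ U : S.left.Opens, s ∈ U ∧ ∃ (c : Chart V d)
      (x : Option (Fin d) → Sect p V S U), IsChartFrame B c P U x) :
    P ∈ moduliSet B d S := by
  refine ⟨⟨⟨memGr_of_frames (B := B) (ι := Fin d) (by simp) fun s => ?_,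
    isTotallyIsotropic_of_frames (ι := Fin d) fun s => ?_⟩,
    ⟨memGr_of_frames (B := B) (ι := Option (Fin d)) (by simp) fun s => ?_,
    isTotallyIsotropic_of_frames (ι := Option (Fin d)) fun s => ?_⟩,
    le_of_local fun s => ?_⟩, le_of_local fun s => ?_,
    isLocallyDirectSummand_of_frames (B := B) (ι := Option (Option (Fin d))) fun s => ?_⟩ <;>
  obtain ⟨U, hs', c, x, h⟩ := h s
  · exact ⟨U, hs', _, _, h.fst⟩
  · exact ⟨U, hs', _, _, h.fst, fun i j => h.point.isotropic _ _⟩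
  · exact ⟨U, hs', _, _, h.snd⟩
  · exact ⟨U, hs', _, _, h.snd, h.point.isotropic⟩
  · exact ⟨U, hs', fun W hW => h.le hW⟩
  · exact ⟨U, hs', fun W hW => h.le_frobPullback hB hW⟩
  · exact ⟨U, hs', h.exists_isFrame_add hV hB hs hns⟩

lemma exists_isUnit_of_evaluation_ne_zero {X : Scheme.{u}} {U : X.Opens} {s : X} (hs : s ∈ U)
    (a : Γ(X, U)) (ha : (X.evaluation U s hs).hom a ≠ 0) :
    ∃ (W : X.Opens) (h : W ≤ U), s ∈ W ∧ IsUnit ((X.presheaf.map (homOfLE h).op).hom a) :=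
  ⟨X.basicOpen a, X.basicOpen_le a, (X.evaluation_ne_zero_iff_mem_basicOpen s hs a).mp ha,
    RingedSpace.isUnit_res_basicOpen _ a⟩

lemma map_det_baseChange {R R' : Type*} [CommRing R] [CommRing R'] [Algebra (ZMod p) R]
    [Algebra (ZMod p) R'] {ι : Type*} [Fintype ι] [DecidableEq ι] (φ : R →ₐ[ZMod p] R')
    (f : ι → V) (v : ι → R ⊗[ZMod p] V) :
    φ (Matrix.of fun i j => B.baseChange R (1 ⊗ₜ f i) (v j)).det
      = (Matrix.of fun i j => B.baseChange R' (1 ⊗ₜ f i) (mapV V φ (v j))).det := by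
  rw [AlgHom.map_det]
  congr 1
  ext i j
  rw [Matrix.of_apply, ← mapV_one_tmul φ, baseChange_mapV]
  rfl

/-- Locally, a locally direct summand of rank `d` has a frame normalised by functionals defined
over `𝔽_p`. -/
lemma Subsheaf.MemGr.exists_isFrame_normalized [FiniteDimensional (ZMod p) V]
    (hB : B.Nondegenerate) {L : Subsheaf p V S} (hL : L.MemGr d) (s : S.left) :
    ∃ (f : Fin d → V) (U : S.left.Opens), s ∈ U ∧
      ∃ l : Fin d → Sect p V S U, IsFrame B L U l fun i => 1 ⊗ₜ f i := by
  obtain ⟨U₁, hs₁, v, w, hv⟩ := hL.exists_isFrame hB s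
  let ev : Γ(S.left, U₁) →+* S.left.residueField s := (S.left.evaluation U₁ s hs₁).hom
  let _ : Algebra (ZMod p) (S.left.residueField s) :=
    (ev.comp (algebraMap (ZMod p) Γ(S.left, U₁))).toAlgebra
  let φ : Γ(S.left, U₁) →ₐ[ZMod p] S.left.residueField s := toAlgHom p ev
  -- A minor that is nonzero in the residue field at `s` is invertible near `s`.
  obtain ⟨f, hf⟩ := exists_det_ne_zero (B := B) (K := S.left.residueField s)
    (v := fun i => mapV V φ (v i)) (w := fun i => mapV V φ (w i)) (by
      intro i j
      rw [baseChange_mapV, hv.dual]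
      split_ifs
      exacts [map_one _, map_zero _])
  rw [← map_det_baseChange] at hf
  obtain ⟨U, hU, hsU, hu⟩ := exists_isUnit_of_evaluation_ne_zero hs₁ _ hf
  have hv' := hv.res hU
  obtain ⟨l, hl, hfl⟩ := exists_normalized (B := B) (v := fun i => res p V hU (v i)) f
    (map_det_baseChange (B := B) (toAlgHom p (S.left.presheaf.map (homOfLE hU).op).hom) f v ▸ hu)
  refine ⟨f, U, hsU, l, hv'.of_card_eq hfl rfl fun i => ?_⟩
  have := hl i
  have e := hv'.span U le_rfl
  simp only [res_refl] at e
  rwa [e] at this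

/-- Normalised frames of the members of a pair of `𝒴_V(S)` form a point of a chart. -/
lemma isChartFrame_of_isFrame [FiniteDimensional (ZMod p) V] (hB : B.Nondegenerate)
    {P : Subsheaf p V S × Subsheaf p V S} (hP : P ∈ moduliSet B d S) {W : S.left.Opens}
    {c : Chart V d} {x : Option (Fin d) → Sect p V S W}
    (h2 : ∀ j : Fin d, B.baseChange Γ(S.left, W) (1 ⊗ₜ c (some j)) (x none) = 0)
    (h3 : B.baseChange Γ(S.left, W) (1 ⊗ₜ c none) (x none) = 1)
    (hl : IsFrame B P.1 W (fun i => x (some i)) (fun i => 1 ⊗ₜ c (some i)))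
    (hx : IsFrame B P.2 W x (chartDual B c x)) : IsChartFrame B c P W x := by
  obtain ⟨⟨-, ⟨-, hiso⟩, -⟩, hF, -⟩ := hP
  refine ⟨⟨hl.dual, h2, h3, fun i j => hiso W _ (hx.mem i) _ (hx.mem j), fun j => ?_⟩, hl, hx⟩
  have hmem := hF W (hl.mem j)
  rw [(hx.frobPullback hB).mem_iff le_rfl] at hmem
  simp only [res_refl, Fintype.sum_option] at hmem
  -- Frobenius fixes the vectors of `V`, so these functionals on `Frob^* ℒ_{d+1}` are again those of
  -- the chart.
  have hδ : ∀ i, B.baseChange Γ(S.left, W) (frob p V S W (chartDual B c x (some i))) (x (some j))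
      = if i = j then 1 else 0 := by
    intro i
    have : frob p V S W (chartDual B c x (some i)) = 1 ⊗ₜ c (some i) := mapV_one_tmul _ _
    rw [this]
    exact hl.dual i j
  have e : x (some j) = frobV V _ (x (some j)) +
      B.baseChange Γ(S.left, W) (frob p V S W (chartDual B c x none)) (x (some j)) •
        frobV V _ (x none) := by
    refine hmem.trans ?_
    rw [add_comm]
    congr 1
    change ∑ i, B.baseChange Γ(S.left, W) (frob p V S W (chartDual B c x (some i))) (x (some j)) •
      frobV V _ (x (some i)) = _
    simp [hδ]
  -- Pairing the expansion with `c none` identifies its remaining coefficient.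
  have e2 := congrArg (B.baseChange Γ(S.left, W) (1 ⊗ₜ c none)) e
  have e3 : ∀ t : Sect p V S W, B.baseChange Γ(S.left, W) (1 ⊗ₜ c none) (frobV V _ t)
      = B.baseChange Γ(S.left, W) (1 ⊗ₜ c none) t ^ p := fun t => by
    rw [← baseChange_frobV, mapV_one_tmul]
  rw [map_add, map_smul, e3, e3, h3, one_pow, smul_eq_mul, mul_one] at e2
  rw [sub_eq_of_eq_add' e2]
  exact e

/-- A pair of `𝒴_V(S)` is given locally on `S` by points of charts. -/
lemma exists_isChartFrame [FiniteDimensional (ZMod p) V] (hB : B.Nondegenerate)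
    {P : Subsheaf p V S × Subsheaf p V S} (hP : P ∈ moduliSet B d S) (s : S.left) :
    ∃ U : S.left.Opens, s ∈ U ∧ ∃ (c : Chart V d) (x : Option (Fin d) → Sect p V S U),
      IsChartFrame B c P U x := by
  obtain ⟨⟨⟨hL, -⟩, ⟨hM, -⟩, hLM⟩, -⟩ := id hP
  obtain ⟨f, N, hsN, l, v, w, hl, hv⟩ : ∃ (f : Fin d → V) (N : S.left.Opens), s ∈ N ∧
      ∃ (l : Fin d → Sect p V S N) (v w : Fin (d + 1) → Sect p V S N),
        IsFrame B P.1 N l (fun i => 1 ⊗ₜ f i) ∧ IsFrame B P.2 N v w := by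
    obtain ⟨f, U, hsU, l, hl⟩ := hL.exists_isFrame_normalized hB s
    obtain ⟨U', hs', v, w, hv⟩ := hM.exists_isFrame hB s
    have := hl.res (inf_le_left : U ⊓ U' ≤ U)
    simp only [res_one_tmul] at this
    exact ⟨f, U ⊓ U', ⟨hsU, hs'⟩, _, _, _, this, hv.res inf_le_right⟩
  -- The component of `v i` killed by the functionals `f`. As `ℒ_{d+1}` has rank `d + 1`, some `y i`
  -- is nonzero at `s`; a vector `g` detecting it becomes `c none`, and `y i`, rescaled, the last
  -- basis vector.
  let y : Fin (d + 1) → Sect p V S N := fun i =>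
    v i - ∑ j, B.baseChange Γ(S.left, N) (1 ⊗ₜ f j) (v i) • l j
  obtain ⟨i, g, hg⟩ : ∃ (i : Fin (d + 1)) (g : V), (S.left.evaluation N s hsN).hom
      (B.baseChange Γ(S.left, N) (1 ⊗ₜ g) (y i)) ≠ 0 := by
    let ev : Γ(S.left, N) →+* S.left.residueField s := (S.left.evaluation N s hsN).hom
    let _ : Algebra (ZMod p) (S.left.residueField s) :=
      (ev.comp (algebraMap (ZMod p) Γ(S.left, N))).toAlgebra
    let φ : Γ(S.left, N) →ₐ[ZMod p] S.left.residueField s := toAlgHom p ev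
    obtain ⟨i, hi⟩ := exists_sub_sum_ne_zero (B := B) (K := S.left.residueField s)
      (v := fun i => mapV V φ (v i)) (w := fun i => mapV V φ (w i)) (by
        intro i j
        rw [baseChange_mapV, hv.dual]
        split_ifs
        exacts [map_one _, map_zero _]) (fun j => mapV V φ (l j))
        fun i j => φ (B.baseChange Γ(S.left, N) (1 ⊗ₜ f j) (v i))
    obtain ⟨g, hg⟩ := exists_baseChange_ne_zero hB hi
    refine ⟨i, g, ?_⟩
    have e : mapV V φ (v i) - ∑ j, φ (B.baseChange Γ(S.left, N) (1 ⊗ₜ f j) (v i)) •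
        mapV V φ (l j) = mapV V φ (y i) := by
      simp only [y, map_sub, map_sum, mapV_smul]
    rw [e, ← mapV_one_tmul φ, baseChange_mapV] at hg
    exact hg
  have hfy : ∀ j, B.baseChange Γ(S.left, N) (1 ⊗ₜ f j) (y i) = 0 := by
    intro j
    simp [y, hl.dual]
  have hyM : y i ∈ P.2.sec N := Submodule.sub_mem _ (hv.mem i) (Submodule.sum_mem _ fun j _ =>
    Submodule.smul_mem _ _ (hLM _ (hl.mem j)))
  obtain ⟨W, hW, hsW, u, hu⟩ := exists_isUnit_of_evaluation_ne_zero hsN _ hg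
  rw [← baseChange_res, res_one_tmul] at hu
  let m : Sect p V S W := (u⁻¹ : Γ(S.left, W)ˣ).1 • res p V hW (y i)
  let x : Option (Fin d) → Sect p V S W := fun i => i.elim m fun j => res p V hW (l j)
  let c : Chart V d := fun i => i.elim g f
  have hl' := hl.res hW
  simp only [res_one_tmul] at hl'
  have h2 : ∀ j : Fin d, B.baseChange Γ(S.left, W) (1 ⊗ₜ c (some j)) (x none) = 0 := by
    intro j
    change B.baseChange Γ(S.left, W) (1 ⊗ₜ f j) (_ • res p V hW (y i)) = 0
    rw [map_smul, ← res_one_tmul hW, baseChange_res, hfy, map_zero, smul_zero]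
  have h3 : B.baseChange Γ(S.left, W) (1 ⊗ₜ c none) (x none) = 1 := by
    change B.baseChange Γ(S.left, W) (1 ⊗ₜ g) (_ • res p V hW (y i)) = 1
    rw [map_smul, ← hu, smul_eq_mul, Units.inv_mul]
  have hxM : ∀ j, x j ∈ P.2.sec W := by
    rintro (_ | j)
    · exact Submodule.smul_mem _ _ (P.2.res_mem hW hyM)
    · exact P.2.res_mem hW (hLM _ (hl.mem j))
  have hx := (hv.res hW).of_card_eq (chartDual_spec (B := B) (c := c) (x := x) hl'.dual h2 h3)
    (by simp) hxM
  exact ⟨W, hsW, c, x, isChartFrame_of_isFrame hB hP h2 h3 hl' hx⟩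

end OrthDL

end

/-! ### Open immersions, descent and gluing of subsheaves -/

noncomputable section

namespace OrthDL

variable {p : ℕ} [Fact p.Prime] {k : Type u} [Field k] [Algebra (ZMod p) k]
  {V : Type v} [AddCommGroup V] [Module (ZMod p) V] {B : LinearMap.BilinForm (ZMod p) V}
  {S T Z : Sch k} {d : ℕ}

lemma exists_pull_inverse (f : T ⟶ S) [IsOpenImmersion f.left] {U : S.left.Opens}
    (hU : U ≤ f.left.opensRange) :
    ∃ ψ : Γ(T.left, f.left ⁻¹ᵁ U) →ₐ[ZMod p] Γ(S.left, U),
      (∀ t, mapV V ψ (pull p V f (le_refl (f.left ⁻¹ᵁ U)) t) = t) ∧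
      ∀ t, pull p V f (le_refl (f.left ⁻¹ᵁ U)) (mapV V ψ t) = t := by
  have := f.left.isIso_app U hU
  refine ⟨toAlgHom p (inv (f.left.app U)).hom, fun t => ?_, fun t => ?_⟩
  · refine (mapV_toAlgHom_comp _ _ (RingHom.id _) ?_ t).trans (mapV_id t)
    rw [← CommRingCat.hom_comp, ← Scheme.Hom.app_eq_appLE, IsIso.hom_inv_id, CommRingCat.hom_id]
  · refine (mapV_toAlgHom_comp _ _ (RingHom.id _) ?_ t).trans (mapV_id t)
    rw [← CommRingCat.hom_comp, ← Scheme.Hom.app_eq_appLE, IsIso.inv_hom_id, CommRingCat.hom_id]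

lemma pull_injective (f : T ⟶ S) [IsOpenImmersion f.left] {U : S.left.Opens}
    (hU : U ≤ f.left.opensRange) :
    Function.Injective (pull p V f (le_refl (f.left ⁻¹ᵁ U))) := by
  obtain ⟨ψ, h, -⟩ := exists_pull_inverse (p := p) (V := V) f hU
  exact Function.LeftInverse.injective h

lemma pull_surjective (f : T ⟶ S) [IsOpenImmersion f.left] {U : S.left.Opens}
    (hU : U ≤ f.left.opensRange) :
    Function.Surjective (pull p V f (le_refl (f.left ⁻¹ᵁ U))) := by
  obtain ⟨ψ, -, h⟩ := exists_pull_inverse (p := p) (V := V) f hU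
  exact Function.RightInverse.surjective h

lemma preimage_mono (f : T ⟶ S) {U W : S.left.Opens} (h : W ≤ U) :
    f.left ⁻¹ᵁ W ≤ f.left ⁻¹ᵁ U := (TopologicalSpace.Opens.map f.left.base).monotone h

lemma image_le_opensRange (f : T ⟶ S) [IsOpenImmersion f.left] (W : T.left.Opens) :
    f.left ''ᵁ W ≤ f.left.opensRange := by
  rintro _ ⟨x, -, rfl⟩
  exact ⟨x, rfl⟩

namespace Subsheaf

/-- The sections of the pull-back along an open immersion. -/
lemma pull_mem_pullback_iff (f : T ⟶ S) [IsOpenImmersion f.left] (L : Subsheaf p V S)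
    {U : S.left.Opens} (hU : U ≤ f.left.opensRange) {s : Sect p V S U} :
    pull p V f (le_refl (f.left ⁻¹ᵁ U)) s ∈ (L.pullback f).sec (f.left ⁻¹ᵁ U) ↔ s ∈ L.sec U := by
  refine ⟨fun h => ?_, pull_mem_pullback f L le_rfl⟩
  refine L.local_mem fun y hy => ?_
  obtain ⟨x, rfl⟩ := hU hy
  obtain ⟨W, hW, hxW, ht⟩ := h x hy
  let N : S.left.Opens := f.left ''ᵁ W
  have hfN : f.left ⁻¹ᵁ N = W := f.left.preimage_image_eq W
  have hNU : N ≤ U := by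
    rintro _ ⟨z, hz, rfl⟩
    exact hW hz
  have hN : N ≤ f.left.opensRange := hNU.trans hU
  refine ⟨N, hNU, ⟨x, hxW, rfl⟩, ?_⟩
  have hspan := res_span _ hfN.le ht
  rw [res_res, res_pull, ← pull_res f hNU le_rfl] at hspan
  -- Over `N`, contained in the image of `f`, functions upstairs and downstairs coincide, so taking
  -- spans upstairs creates nothing beyond `L.sec N`.
  have key : ∀ t ∈ Submodule.span Γ(T.left, f.left ⁻¹ᵁ N) (restrictions (fun W => {t |
      ∃ (U : S.left.Opens) (h : W ≤ f.left ⁻¹ᵁ U), ∃ s ∈ L.sec U, t = pull p V f h s})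
      (f.left ⁻¹ᵁ N)), ∃ s' ∈ L.sec N, pull p V f (le_refl (f.left ⁻¹ᵁ N)) s' = t := by
    intro t ht
    induction ht using Submodule.span_induction with
    | mem t ht =>
      obtain ⟨W', h', _, ⟨U', hU', s', hs', rfl⟩, rfl⟩ := ht
      have hNU' : N ≤ U' := by
        rintro _ ⟨z, hz, rfl⟩
        exact (h'.trans hU') (hfN.ge hz)
      refine ⟨res p V hNU' s', L.res_mem _ hs', ?_⟩
      rw [res_pull, pull_res]
    | zero => exact ⟨0, Submodule.zero_mem _, map_zero _⟩
    | add t t' _ _ hs hs' =>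
      obtain ⟨s, hs, rfl⟩ := hs
      obtain ⟨s', hs', rfl⟩ := hs'
      exact ⟨s + s', Submodule.add_mem _ hs hs', map_add _ _ _⟩
    | smul a t _ hs =>
      obtain ⟨s, hs, rfl⟩ := hs
      have := f.left.isIso_app N hN
      refine ⟨(inv (f.left.app N)).hom a • s, Submodule.smul_mem _ _ hs, ?_⟩
      rw [pull_smul]
      congr 1
      rw [← Scheme.Hom.app_eq_appLE, ← RingHom.comp_apply, ← CommRingCat.hom_comp,
        IsIso.inv_hom_id, CommRingCat.hom_id, RingHom.id_apply]
  obtain ⟨s', hs', e⟩ := key _ hspan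
  rwa [← pull_injective f hN e]

lemma eq_of_pullback_eq {ι : Type*} {T : ι → Sch k} (f : ∀ i, T i ⟶ S)
    [∀ i, IsOpenImmersion (f i).left] (hf : ∀ s : S.left, ∃ i, s ∈ (f i).left.opensRange)
    {L M : Subsheaf p V S} (h : ∀ i, L.pullback (f i) = M.pullback (f i)) : L = M := by
  refine ext_of_local fun s => ?_
  obtain ⟨i, hi⟩ := hf s
  refine ⟨_, hi, fun W hW => ?_⟩
  ext t
  rw [← pull_mem_pullback_iff (f i) L hW, h, pull_mem_pullback_iff (f i) M hW]

/-- The intersection of a family of subsheaves. -/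
def inter {ι : Type*} (K : ι → Subsheaf p V S) : Subsheaf p V S where
  sec U := ⨅ i, (K i).sec U
  res_mem {U W} h {t} ht := by
    rw [Submodule.mem_iInf] at ht ⊢
    exact fun i => (K i).res_mem h (ht i)
  local_mem {U t} h := by
    rw [Submodule.mem_iInf]
    refine fun i => (K i).local_mem fun x hx => ?_
    obtain ⟨W, hW, hxW, ht⟩ := h x hx
    exact ⟨W, hW, hxW, (Submodule.mem_iInf _).mp ht i⟩

/-- Subsheaves which are compatible on overlaps glue. -/
lemma exists_glue {ι : Type*} {T : ι → Sch k} (f : ∀ i, T i ⟶ S)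
    [∀ i, IsOpenImmersion (f i).left] (L : ∀ i, Subsheaf p V (T i))
    (h : ∀ (i j : ι) (Z : Sch k) (a : Z ⟶ T i) (b : Z ⟶ T j), a ≫ f i = b ≫ f j →
      (L i).pullback a = (L j).pullback b) :
    ∃ M : Subsheaf p V S, ∀ i, M.pullback (f i) = L i := by
  -- The glued subsheaf consists of the sections whose pull-back to each `T i` lies in `L i`.
  refine ⟨inter fun i => (L i).push (f i), fun i => Le.antisymm ?_ ?_⟩
  · rw [pullback_le_iff]
    exact fun U t ht => (Submodule.mem_iInf _).mp ht i
  intro W t ht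
  let U : S.left.Opens := (f i).left ''ᵁ W
  have hU : U ≤ (f i).left.opensRange := image_le_opensRange _ W
  have hfU : (f i).left ⁻¹ᵁ U = W := (f i).left.preimage_image_eq W
  obtain ⟨s, hs⟩ := pull_surjective (f i) hU (res p V hfU.le t)
  suffices hsM : s ∈ (inter fun i => (L i).push (f i)).sec U by
    have := pull_mem_pullback (f i) _ hfU.ge hsM
    rwa [← res_pull (f i) le_rfl hfU.ge, hs, res_res, res_refl] at this
  refine (Submodule.mem_iInf _).mpr fun j => ?_
  rw [mem_push]
  -- Membership in `L j` over the preimage of `U` is tested on the fibre product `T i ×_S T j`,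
  -- whose projection to `T j` is an open immersion covering that preimage.
  let Z : Sch k := Over.mk (Limits.pullback.fst (f i).left (f j).left ≫ (T i).hom)
  let a : Z ⟶ T i := Over.homMk (Limits.pullback.fst (f i).left (f j).left)
  let b : Z ⟶ T j := Over.homMk (Limits.pullback.snd (f i).left (f j).left) (by
    change _ = Limits.pullback.fst (f i).left (f j).left ≫ (T i).hom
    rw [← Over.w (f j), ← Over.w (f i), Limits.pullback.condition_assoc])
  have hab : a ≫ f i = b ≫ f j := by
    ext1
    exact Limits.pullback.condition
  have hb : IsOpenImmersion b.left :=
    inferInstanceAs (IsOpenImmersion (Limits.pullback.snd (f i).left (f j).left))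
  have hN : (f j).left ⁻¹ᵁ U ≤ b.left.opensRange := by
    rintro y ⟨x, hx, hxy⟩
    obtain ⟨z, -, hz⟩ := Scheme.Pullback.exists_preimage_pullback x y hxy
    exact ⟨z, hz⟩
  have habU : b.left ⁻¹ᵁ (f j).left ⁻¹ᵁ U = a.left ⁻¹ᵁ (f i).left ⁻¹ᵁ U := by
    change (b ≫ f j).left ⁻¹ᵁ U = (a ≫ f i).left ⁻¹ᵁ U
    rw [hab]
  rw [← pull_mem_pullback_iff b (L j) hN, ← h i j Z a b hab]
  have e := pull_pull (f j) b (le_refl ((f j).left ⁻¹ᵁ U)) (le_refl (b.left ⁻¹ᵁ _)) le_rfl s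
  rw [e, pull_congr hab.symm (by exact le_rfl) (by exact habU.le),
    ← pull_pull (f i) a (le_refl ((f i).left ⁻¹ᵁ U)) habU.le (by exact habU.le), hs]
  exact pull_mem_pullback a _ _ ((L i).res_mem _ ht)

lemma IsFrame.of_pullback [FiniteDimensional (ZMod p) V] (f : T ⟶ S)
    [IsOpenImmersion f.left] {L : Subsheaf p V S} {U : S.left.Opens}
    (hU : U ≤ f.left.opensRange) {ι : Type*} [Fintype ι] [DecidableEq ι] {v w : ι → Sect p V S U}
    (h : IsFrame B (L.pullback f) (f.left ⁻¹ᵁ U) (fun i => pull p V f le_rfl (v i))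
      (fun i => pull p V f le_rfl (w i))) : IsFrame B L U v w := by
  have hdual : ∀ i j, B.baseChange Γ(S.left, U) (w i) (v j) = if i = j then 1 else 0 := by
    intro i j
    obtain ⟨ψ, hψ, -⟩ := exists_pull_inverse (p := p) (V := V) f hU
    rw [← hψ (w i), ← hψ (v j), baseChange_mapV, h.dual]
    split_ifs
    exacts [map_one _, map_zero _]
  refine ⟨hdual, fun W hW => ?_⟩
  ext t
  rw [mem_span_iff_eq_sum (dual_res hdual hW), ← pull_mem_pullback_iff f L (hW.trans hU),
    h.mem_iff (preimage_mono f hW), ← (pull_injective f (hW.trans hU)).eq_iff]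
  refine Eq.congr_right ?_
  rw [map_sum]
  refine Finset.sum_congr rfl fun i _ => ?_
  rw [pull_smul, ← baseChange_pull]
  simp only [res_pull]
  rw [pull_res f hW le_rfl (preimage_mono f hW), pull_res f hW le_rfl (preimage_mono f hW)]

end Subsheaf

open Subsheaf

/-- The pull-back of a pair of subsheaves. -/
def pullbackPair (f : T ⟶ S) (P : Subsheaf p V S × Subsheaf p V S) :
    Subsheaf p V T × Subsheaf p V T := (P.1.pullback f, P.2.pullback f)

lemma pullbackPair_comp (f : T ⟶ S) (g : Z ⟶ T) (P : Subsheaf p V S × Subsheaf p V S) :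
    pullbackPair (g ≫ f) P = pullbackPair g (pullbackPair f P) :=
  Prod.ext (pullback_comp f g P.1) (pullback_comp f g P.2)

lemma pullbackPair_id (P : Subsheaf p V S × Subsheaf p V S) : pullbackPair (𝟙 S) P = P :=
  Prod.ext (pullback_id P.1) (pullback_id P.2)

lemma IsChartFrame.of_pullback [FiniteDimensional (ZMod p) V] (f : T ⟶ S)
    [IsOpenImmersion f.left] {P : Subsheaf p V S × Subsheaf p V S} {c : Chart V d}
    {U : S.left.Opens} (hU : U ≤ f.left.opensRange) {x : Option (Fin d) → Sect p V S U}
    (h : IsChartFrame B c (pullbackPair f P) (f.left ⁻¹ᵁ U) fun i => pull p V f le_rfl (x i)) :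
    IsChartFrame B c P U x where
  point := by
    obtain ⟨ψ, hψ, -⟩ := exists_pull_inverse (p := p) (V := V) f hU
    have := h.point.map ψ
    simp only [hψ] at this
    exact this
  fst := by
    apply IsFrame.of_pullback f hU
    have := h.fst
    simp only [pull_one_tmul]
    exact this
  snd := by
    apply IsFrame.of_pullback f hU
    have e : (fun i => pull p V f (le_refl (f.left ⁻¹ᵁ U)) (chartDual B c x i)) = chartDual B c _ :=
      funext fun i => mapV_chartDual _ c x i
    rw [e]
    exact h.snd

/-- A point of a chart on an open subscheme. -/
lemma IsChartFrame.exists_of_pullback [FiniteDimensional (ZMod p) V] (f : T ⟶ S)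
    [IsOpenImmersion f.left] {P : Subsheaf p V S × Subsheaf p V S} {c : Chart V d}
    {W : T.left.Opens} {x : Option (Fin d) → Sect p V T W}
    (h : IsChartFrame B c (pullbackPair f P) W x) :
    ∃ y : Option (Fin d) → Sect p V S (f.left ''ᵁ W), IsChartFrame B c P (f.left ''ᵁ W) y := by
  have hfU : f.left ⁻¹ᵁ f.left ''ᵁ W = W := f.left.preimage_image_eq W
  choose y hy using fun i => pull_surjective f (image_le_opensRange f W) (OrthDL.res p V hfU.le (x i))
  refine ⟨y, IsChartFrame.of_pullback f (image_le_opensRange f W) ?_⟩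
  simp only [hy]
  exact h.res hfU.le

variable [FiniteDimensional (ZMod p) V]

/-- Rather than comparing sums and Frobenius pull-backs with `f^*`, one pulls back chart points,
which determine membership. -/
lemma pullbackPair_mem_moduliSet (hV : Module.finrank (ZMod p) V = 2 * (d + 1))
    (hB : B.Nondegenerate) (hs : B.IsSymm) (hns : IsNonsplit B d)
    {P : Subsheaf p V S × Subsheaf p V S} (hP : P ∈ moduliSet B d S) (f : T ⟶ S) :
    pullbackPair f P ∈ moduliSet B d T := by
  refine mem_moduliSet_of_isChartFrame hV hB hs hns fun t => ?_
  obtain ⟨U, hU, c, x, h⟩ := exists_isChartFrame hB hP (f.left.base t)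
  exact ⟨f.left ⁻¹ᵁ U, hU, c, _, h.pullback hB f le_rfl⟩

/-- Pairs in `𝒴_V` which are compatible on overlaps glue. -/
lemma exists_glue_moduliSet (hV : Module.finrank (ZMod p) V = 2 * (d + 1))
    (hB : B.Nondegenerate) (hs : B.IsSymm) (hns : IsNonsplit B d)
    {ι : Type*} {T : ι → Sch k} (f : ∀ i, T i ⟶ S)
    [∀ i, IsOpenImmersion (f i).left] (hf : ∀ s : S.left, ∃ i, s ∈ (f i).left.opensRange)
    (P : ∀ i, Subsheaf p V (T i) × Subsheaf p V (T i)) (hP : ∀ i, P i ∈ moduliSet B d (T i))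
    (h : ∀ (i j : ι) (Z : Sch k) (a : Z ⟶ T i) (b : Z ⟶ T j), a ≫ f i = b ≫ f j →
      pullbackPair a (P i) = pullbackPair b (P j)) :
    ∃ Q ∈ moduliSet B d S, ∀ i, pullbackPair (f i) Q = P i := by
  obtain ⟨L, hL⟩ := exists_glue f (fun i => (P i).1) fun i j Z a b e =>
    congrArg Prod.fst (h i j Z a b e)
  obtain ⟨M, hM⟩ := exists_glue f (fun i => (P i).2) fun i j Z a b e =>
    congrArg Prod.snd (h i j Z a b e)
  have hQ : ∀ i, pullbackPair (f i) (L, M) = P i := fun i => Prod.ext (hL i) (hM i)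
  refine ⟨(L, M), mem_moduliSet_of_isChartFrame hV hB hs hns fun s => ?_, hQ⟩
  obtain ⟨i, x, rfl⟩ := hf s
  obtain ⟨W, hxW, c, x', hx'⟩ := exists_isChartFrame hB (hP i) x
  rw [← hQ i] at hx'
  obtain ⟨y, hy⟩ := hx'.exists_of_pullback
  exact ⟨(f i).left ''ᵁ W, ⟨x, hxW, rfl⟩, c, y, hy⟩

end OrthDL

end

/-! ### The coordinate ring of a chart and its formal smoothness -/

noncomputable section

namespace OrthDL

section ChartRing

variable {p : ℕ} [Fact p.Prime] (k : Type u) [Field k] [Algebra (ZMod p) k]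
  {V : Type v} [AddCommGroup V] [Module (ZMod p) V] [FiniteDimensional (ZMod p) V]
  {B : LinearMap.BilinForm (ZMod p) V} (hB : B.Nondegenerate) {d : ℕ} (c : Chart V d)
  {R R' : Type*} [CommRing R] [CommRing R'] [Algebra (ZMod p) R] [Algebra (ZMod p) R']

/-- The coordinate of a vector of `R ⊗ V` with respect to a fixed basis of `V`. -/
def coordV (a : Fin (Module.finrank (ZMod p) V)) (t : R ⊗[ZMod p] V) : R :=
  B.baseChange R (1 ⊗ₜ B.dualBasis hB (Module.finBasis (ZMod p) V) a) t

lemma coordV_mapV (φ : R →ₐ[ZMod p] R') (a : Fin (Module.finrank (ZMod p) V))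
    (t : R ⊗[ZMod p] V) : coordV hB a (mapV V φ t) = φ (coordV hB a t) := by
  rw [coordV, ← mapV_one_tmul φ, baseChange_mapV]
  rfl

lemma coordV_ext {s t : R ⊗[ZMod p] V} (h : ∀ a, coordV hB a s = coordV hB a t) : s = t := by
  rw [sum_dualBasis hB (Module.finBasis (ZMod p) V) s,
    sum_dualBasis hB (Module.finBasis (ZMod p) V) t]
  exact Finset.sum_congr rfl fun a _ => by congr 1; exact h a

/-- The vector with given coordinates. -/
def ofCoordV (y : Fin (Module.finrank (ZMod p) V) → R) : R ⊗[ZMod p] V :=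
  ∑ a, y a ⊗ₜ[ZMod p] Module.finBasis (ZMod p) V a

lemma coordV_ofCoordV (y : Fin (Module.finrank (ZMod p) V) → R)
    (a : Fin (Module.finrank (ZMod p) V)) : coordV hB a (ofCoordV (V := V) y) = y a := by
  simp only [coordV, ofCoordV, map_sum, LinearMap.BilinForm.baseChange_tmul, one_mul,
    LinearMap.BilinForm.apply_dualBasis_left, ite_smul, one_smul, zero_smul,
    Finset.sum_ite_eq', Finset.mem_univ, if_true]

/-- The index set of the equations of a chart. -/
abbrev ChartEqnIndex (p : ℕ) [Fact p.Prime] (V : Type v) [AddCommGroup V] [Module (ZMod p) V]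
    (d : ℕ) :=
  (Fin d × Option (Fin d)) ⊕ Unit ⊕ (Option (Fin d) × Option (Fin d)) ⊕
    (Fin d × Fin (Module.finrank (ZMod p) V))

/-- The equations satisfied by the points of a chart. -/
def chartEqn (x : Option (Fin d) → R ⊗[ZMod p] V) : ChartEqnIndex p V d → R
  | .inl (i, j) => B.baseChange R (1 ⊗ₜ c (some i)) (x j) - if some i = j then 1 else 0
  | .inr (.inl _) => B.baseChange R (1 ⊗ₜ c none) (x none) - 1
  | .inr (.inr (.inl (i, j))) => B.baseChange R (x i) (x j)
  | .inr (.inr (.inr (i, a))) => coordV hB a (x (some i)) - coordV hB a (frobV V R (x (some i)) +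
      (B.baseChange R (1 ⊗ₜ c none) (x (some i)) -
        B.baseChange R (1 ⊗ₜ c none) (x (some i)) ^ p) • frobV V R (x none))

lemma chartEqn_mapV (φ : R →ₐ[ZMod p] R') (x : Option (Fin d) → R ⊗[ZMod p] V)
    (e : ChartEqnIndex p V d) :
    chartEqn hB c (fun i => mapV V φ (x i)) e = φ (chartEqn hB c x e) := by
  rcases e with ⟨i, j⟩ | _ | ⟨i, j⟩ | ⟨i, a⟩
  · simp only [chartEqn, map_sub]
    rw [← baseChange_mapV, mapV_one_tmul]
    split_ifs <;> simp
  · simp only [chartEqn, map_sub]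
    rw [← baseChange_mapV, mapV_one_tmul, map_one]
  · exact baseChange_mapV B φ _ _
  · simp only [chartEqn, map_sub]
    rw [← coordV_mapV, ← coordV_mapV, map_add, mapV_smul, mapV_frobV, mapV_frobV, map_sub, map_pow,
      ← baseChange_mapV, mapV_one_tmul]

lemma isChartPoint_iff {x : Option (Fin d) → R ⊗[ZMod p] V} :
    IsChartPoint B c x ↔ ∀ e, chartEqn hB c x e = 0 := by
  constructor
  · rintro h (⟨i, _ | j⟩ | _ | ⟨i, j⟩ | ⟨i, a⟩)
    · simp [chartEqn, h.some_none]
    · simp [chartEqn, h.some_some]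
    · simp [chartEqn, h.none_none]
    · exact h.isotropic i j
    · simp only [chartEqn]
      rw [← h.frob i, sub_self]
  · intro h
    refine ⟨fun i j => ?_, fun i => ?_, ?_, fun i j => h (.inr (.inr (.inl (i, j)))), fun i => ?_⟩
    · have := h (.inl (i, some j))
      simpa [chartEqn, sub_eq_zero] using this
    · have := h (.inl (i, none))
      simpa [chartEqn, sub_eq_zero] using this
    · have := h (.inr (.inl ()))
      simpa [chartEqn, sub_eq_zero] using this
    · exact coordV_ext hB fun a => sub_eq_zero.mp (h (.inr (.inr (.inr (i, a)))))

/-- The polynomial ring in the coordinates of a chart. -/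
abbrev ChartPoly (p : ℕ) [Fact p.Prime] (k : Type u) [Field k] (V : Type v) [AddCommGroup V]
    [Module (ZMod p) V] (d : ℕ) :=
  MvPolynomial (Option (Fin d) × Fin (Module.finrank (ZMod p) V)) k

/-- The family of vectors with indeterminate coordinates. -/
def genericPoint (i : Option (Fin d)) : ChartPoly p k V d ⊗[ZMod p] V :=
  ofCoordV fun a => MvPolynomial.X (i, a)

/-- The coordinate ring of a chart. -/
abbrev ChartRing : Type u :=
  ChartPoly p k V d ⧸ Ideal.span (Set.range (chartEqn hB c (genericPoint k)))

/-- The universal point of a chart. -/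
def chartPoint (i : Option (Fin d)) : ChartRing k hB c ⊗[ZMod p] V :=
  mapV V (Ideal.Quotient.mkₐ (ZMod p) _) (genericPoint k i)

lemma isChartPoint_chartPoint : IsChartPoint B c (chartPoint k hB c) := by
  rw [isChartPoint_iff hB]
  intro e
  refine (chartEqn_mapV hB c (Ideal.Quotient.mkₐ (ZMod p) _) (genericPoint k) e).trans ?_
  exact Ideal.Quotient.eq_zero_iff_mem.mpr (Ideal.subset_span ⟨e, rfl⟩)

variable {k c}

/-- With `chartRing_hom_ext`, this is the universal property of the coordinate ring. It is phrased
with a ring homomorphism `θ`, as rings of sections receive `k` through `structureHom`. -/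
lemma exists_chartRing_lift (θ : k →+* R) {x : Option (Fin d) → R ⊗[ZMod p] V}
    (hx : IsChartPoint B c x) :
    ∃ g : ChartRing k hB c →+* R, g.comp (algebraMap k _) = θ ∧
      ∀ i, mapV V (toAlgHom p g) (chartPoint k hB c i) = x i := by
  let g₀ : ChartPoly p k V d →+* R := MvPolynomial.eval₂Hom θ fun j => coordV hB j.2 (x j.1)
  have hg₀ : ∀ i, mapV V (toAlgHom p g₀) (genericPoint k i) = x i := by
    intro i
    refine coordV_ext hB fun a => ?_
    rw [coordV_mapV, genericPoint, coordV_ofCoordV]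
    exact MvPolynomial.eval₂Hom_X' _ _ _
  have hker : ∀ a ∈ Ideal.span (Set.range (chartEqn hB c (genericPoint k))), g₀ a = 0 := by
    intro a ha
    have hle : Ideal.span (Set.range (chartEqn hB c (genericPoint k))) ≤ RingHom.ker g₀ := by
      rw [Ideal.span_le]
      rintro _ ⟨e, rfl⟩
      have := chartEqn_mapV hB c (toAlgHom p g₀) (genericPoint k) e
      simp only [hg₀] at this
      rw [(isChartPoint_iff hB c).mp hx] at this
      exact this.symm
    exact hle ha
  refine ⟨Ideal.Quotient.lift _ g₀ hker, ?_, fun i => ?_⟩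
  · ext a
    exact MvPolynomial.eval₂Hom_C _ _ _
  · rw [← hg₀ i, chartPoint, mapV_mapV]
    rfl

lemma chartRing_hom_ext {g g' : ChartRing k hB c →+* R}
    (h : g.comp (algebraMap k _) = g'.comp (algebraMap k _))
    (h' : ∀ i, mapV V (toAlgHom p g) (chartPoint k hB c i)
      = mapV V (toAlgHom p g') (chartPoint k hB c i)) : g = g' := by
  apply Ideal.Quotient.ringHom_ext
  apply MvPolynomial.ringHom_ext
  · intro a
    exact RingHom.congr_fun h a
  · rintro ⟨i, a⟩
    have := congrArg (coordV hB a) (h' i)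
    rw [coordV_mapV, coordV_mapV, chartPoint, coordV_mapV, genericPoint, coordV_ofCoordV] at this
    exact this

instance : Algebra.FinitePresentation k (ChartRing k hB c) := by
  have h : (Ideal.span (Set.range (chartEqn hB c (genericPoint k)))).FG :=
    Submodule.fg_def.mpr ⟨_, Set.finite_range _, rfl⟩
  exact .quotient h

/-- Homomorphisms out of the coordinate ring are chart points, so the lifting criterion is
`IsChartPoint.exists_lift`. -/
lemma chartRing_formallySmooth (hp : p ≠ 2)
    (hV : Module.finrank (ZMod p) V = 2 * (d + 1)) (hs : B.IsSymm) (hns : IsNonsplit B d) :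
    Algebra.FormallySmooth k (ChartRing k hB c) := by
  refine Algebra.FormallySmooth.of_comp_surjective fun A _ _ I hI f => ?_
  let _ : Algebra (ZMod p) A := ((algebraMap k A).comp (algebraMap (ZMod p) k)).toAlgebra
  have hI' : ∀ a ∈ I, ∀ b ∈ I, a * b = 0 := by
    intro a ha b hb
    have := Ideal.mul_mem_mul ha hb
    rwa [← pow_two, hI, Ideal.mem_bot] at this
  obtain ⟨y, hy, hyx⟩ := ((isChartPoint_chartPoint k hB c).map
    (toAlgHom p f.toRingHom)).exists_lift I hI' hp hV hB hs hns
  obtain ⟨g, hg, hgy⟩ := exists_chartRing_lift hB (algebraMap k A) hy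
  refine ⟨⟨g, fun a => RingHom.congr_fun hg a⟩, ?_⟩
  apply AlgHom.coe_ringHom_injective
  refine chartRing_hom_ext hB ?_ fun i => ?_
  · ext a
    exact (congrArg (Ideal.Quotient.mk I) (RingHom.congr_fun hg a)).trans (f.commutes a).symm
  · refine Eq.trans ?_ (hyx i)
    rw [← hgy, mapV_mapV]
    rfl

end ChartRing

end OrthDL

end

/-! ### Local nature of chart points; the open locus of a chart -/

noncomputable section

namespace OrthDL

open Subsheaf

variable {p : ℕ} [Fact p.Prime] {k : Type u} [Field k] [Algebra (ZMod p) k]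
  {V : Type v} [AddCommGroup V] [Module (ZMod p) V] [FiniteDimensional (ZMod p) V]
  {B : LinearMap.BilinForm (ZMod p) V} {S T Z : Sch k} {d : ℕ}

lemma exists_glue_function {U : S.left.Opens} {ι : Type*} (W : ι → S.left.Opens)
    (hW : ∀ i, W i ≤ U) (hU : ∀ s ∈ U, ∃ i, s ∈ W i) (a : ∀ i, Γ(S.left, W i))
    (h : ∀ (i j : ι) (N : S.left.Opens) (hi : N ≤ W i) (hj : N ≤ W j),
      (S.left.presheaf.map (homOfLE hi).op).hom (a i) =
        (S.left.presheaf.map (homOfLE hj).op).hom (a j)) :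
    ∃ b : Γ(S.left, U), ∀ i, (S.left.presheaf.map (homOfLE (hW i)).op).hom b = a i := by
  obtain ⟨b, hb, -⟩ := TopCat.Sheaf.existsUnique_gluing' S.left.sheaf W U
    (fun i => homOfLE (hW i)) (fun s hs => TopologicalSpace.Opens.mem_iSup.mpr (hU s hs)) a
    fun i j => h i j _ inf_le_left inf_le_right
  exact ⟨b, hb⟩

/-- Compatible local sections of `V ⊗ 𝒪_S` glue. -/
lemma exists_glue_sect (hB : B.Nondegenerate) {U : S.left.Opens} {ι : Type*}
    (W : ι → S.left.Opens) (hW : ∀ i, W i ≤ U) (hU : ∀ s ∈ U, ∃ i, s ∈ W i)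
    (t : ∀ i, Sect p V S (W i))
    (h : ∀ (i j : ι) (N : S.left.Opens) (hi : N ≤ W i) (hj : N ≤ W j),
      res p V hi (t i) = res p V hj (t j)) :
    ∃ s : Sect p V S U, ∀ i, res p V (hW i) s = t i := by
  have key : ∀ {N N' : S.left.Opens} (hN : N ≤ N') (s : Sect p V S N') (a),
      coordV hB a (res p V hN s) = (S.left.presheaf.map (homOfLE hN).op).hom (coordV hB a s) :=
    fun hN s a => coordV_mapV hB _ a s
  choose b hb using fun a => exists_glue_function W hW hU (fun i => coordV hB a (t i)) (by
    intro i j N hi hj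
    rw [← key, ← key, h i j N hi hj])
  refine ⟨ofCoordV b, fun i => coordV_ext hB fun a => ?_⟩
  rw [key, coordV_ofCoordV, hb]

lemma Subsheaf.IsFrame.of_local (hB : B.Nondegenerate) {L : Subsheaf p V S} {U : S.left.Opens}
    {ι : Type*} [Fintype ι] [DecidableEq ι] {v w : ι → Sect p V S U}
    (h : ∀ s ∈ U, ∃ (W : S.left.Opens) (hW : W ≤ U), s ∈ W ∧
      IsFrame B L W (fun i => OrthDL.res p V hW (v i)) fun i => OrthDL.res p V hW (w i)) :
    IsFrame B L U v w := by
  have hdual : ∀ i j, B.baseChange Γ(S.left, U) (w i) (v j) = if i = j then 1 else 0 := by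
    intro i j
    refine function_ext fun s hs => ?_
    obtain ⟨W, hW, hsW, hf⟩ := h s hs
    refine ⟨W, hW, hsW, ?_⟩
    rw [← baseChange_res, hf.dual]
    split_ifs
    exacts [(map_one _).symm, (map_zero _).symm]
  refine ⟨hdual, fun N hN => ?_⟩
  ext t
  rw [mem_span_iff_eq_sum (dual_res hdual hN)]
  constructor
  · intro ht
    refine L.local_mem fun s hs => ?_
    obtain ⟨W, hW, hsW, hf⟩ := h s (hN hs)
    refine ⟨W ⊓ N, inf_le_right, ⟨hsW, hs⟩, L.res_mem _ ?_⟩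
    rw [ht]
    refine Submodule.sum_mem _ fun i _ => Submodule.smul_mem _ _ ?_
    refine L.local_mem fun s hs => ?_
    obtain ⟨W, hW, hsW, hf⟩ := h s (hN hs)
    refine ⟨W ⊓ N, inf_le_right, ⟨hsW, hs⟩, ?_⟩
    have := L.res_mem (inf_le_left : W ⊓ N ≤ W) (hf.mem i)
    rw [res_res] at this ⊢
    exact this
  · intro ht
    apply sect_ext hB
    intro s hs
    obtain ⟨W, hW, hsW, hf⟩ := h s (hN hs)
    refine ⟨W ⊓ N, inf_le_right, ⟨hsW, hs⟩, ?_⟩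
    have := L.res_mem (inf_le_right : W ⊓ N ≤ N) ht
    rw [hf.mem_iff inf_le_left] at this
    rw [this, map_sum]
    refine Finset.sum_congr rfl fun i _ => ?_
    rw [res_smul, ← baseChange_res, res_res, res_res, res_res, res_res]

variable {c : Chart V d} {P : Subsheaf p V S × Subsheaf p V S}

lemma IsChartFrame.of_local (hB : B.Nondegenerate) {U : S.left.Opens}
    {x : Option (Fin d) → Sect p V S U}
    (h : ∀ s ∈ U, ∃ (W : S.left.Opens) (hW : W ≤ U), s ∈ W ∧
      IsChartFrame B c P W fun i => OrthDL.res p V hW (x i)) : IsChartFrame B c P U x where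
  point := by
    rw [isChartPoint_iff hB]
    refine fun e => function_ext fun s hs => ?_
    obtain ⟨W, hW, hsW, hx⟩ := h s hs
    refine ⟨W, hW, hsW, ?_⟩
    have := (isChartPoint_iff hB c).mp hx.point e
    rw [map_zero, ← this]
    exact (chartEqn_mapV hB c (toAlgHom p _) x e).symm
  fst := by
    refine IsFrame.of_local hB fun s hs => ?_
    obtain ⟨W, hW, hsW, hx⟩ := h s hs
    refine ⟨W, hW, hsW, ?_⟩
    simp only [res_one_tmul]
    exact hx.fst
  snd := by
    refine IsFrame.of_local hB fun s hs => ?_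
    obtain ⟨W, hW, hsW, hx⟩ := h s hs
    refine ⟨W, hW, hsW, ?_⟩
    have e : (fun i => OrthDL.res p V hW (chartDual B c x i)) = chartDual B c _ :=
      funext fun i => mapV_chartDual _ c x i
    rw [e]
    exact hx.snd

/-- Points of the same chart giving the pair `P` locally glue. -/
lemma IsChartFrame.exists_of_local (hB : B.Nondegenerate) {U : S.left.Opens}
    (h : ∀ s ∈ U, ∃ W : S.left.Opens, s ∈ W ∧ ∃ x : Option (Fin d) → Sect p V S W,
      IsChartFrame B c P W x) : ∃ x : Option (Fin d) → Sect p V S U, IsChartFrame B c P U x := by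
  have h' : ∀ s : U, ∃ (W : S.left.Opens) (_ : W ≤ U), s.1 ∈ W ∧
      ∃ x : Option (Fin d) → Sect p V S W, IsChartFrame B c P W x := by
    rintro ⟨s, hs⟩
    obtain ⟨W, hsW, x, hx⟩ := h s hs
    exact ⟨W ⊓ U, inf_le_right, ⟨hsW, hs⟩, _, hx.res inf_le_left⟩
  choose W hW hsW x hx using h'
  -- The coordinates in a fixed chart are unique, so the local ones agree on overlaps.
  choose y hy using fun i => exists_glue_sect hB W hW (fun s hs => ⟨⟨s, hs⟩, hsW _⟩)
    (fun s => x s i) fun s s' N hi hj => congrFun (((hx s).res hi).unique ((hx s').res hj)) i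
  refine ⟨y, .of_local hB fun s hs => ⟨W ⟨s, hs⟩, hW _, hsW _, ?_⟩⟩
  simp only [hy]
  exact hx _

/-- The open set where a pair is given by a point of the chart `c`. -/
def chartOpen (B : LinearMap.BilinForm (ZMod p) V) (c : Chart V d)
    (P : Subsheaf p V S × Subsheaf p V S) : S.left.Opens :=
  sSup {U | ∃ x : Option (Fin d) → Sect p V S U, IsChartFrame B c P U x}

omit [FiniteDimensional (ZMod p) V] in
lemma mem_chartOpen {s : S.left} : s ∈ chartOpen B c P ↔ ∃ U : S.left.Opens, s ∈ U ∧
    ∃ x : Option (Fin d) → Sect p V S U, IsChartFrame B c P U x := by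
  simp [chartOpen, TopologicalSpace.Opens.mem_sSup, and_comm]

lemma exists_isChartFrame_chartOpen (hB : B.Nondegenerate) :
    ∃ x : Option (Fin d) → Sect p V S (chartOpen B c P),
      IsChartFrame B c P (chartOpen B c P) x :=
  IsChartFrame.exists_of_local hB fun _ hs => mem_chartOpen.mp hs

omit [FiniteDimensional (ZMod p) V] in
-- Expressing `w` through `f` and `v` through `v'` factors the identity matrix through the matrix in
-- question, so its determinant divides `1`.
lemma isUnit_det_of_dual {R : Type*} [CommRing R] [Algebra (ZMod p) R] {ι : Type*} [Fintype ι]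
    [DecidableEq ι] {f : ι → V} {v v' w : ι → R ⊗[ZMod p] V}
    (hw : ∀ i, w i ∈ Submodule.span R (Set.range fun i => (1 : R) ⊗ₜ[ZMod p] f i))
    (hv : ∀ i, v i ∈ Submodule.span R (Set.range v'))
    (h : ∀ i j, B.baseChange R (w i) (v j) = if i = j then 1 else 0) :
    IsUnit (Matrix.of fun i j => B.baseChange R (1 ⊗ₜ f i) (v' j)).det := by
  simp only [Submodule.mem_span_range_iff_exists_fun] at hw hv
  choose G hG using hw
  choose N hN using hv
  have : Matrix.of G * (Matrix.of fun i j => B.baseChange R (1 ⊗ₜ f i) (v' j)) *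
      (Matrix.of N).transpose = 1 := by
    ext i j
    rw [Matrix.one_apply, ← h i j, ← hG, ← hN, Matrix.mul_apply]
    simp only [Matrix.mul_apply, map_sum, LinearMap.sum_apply, map_smul, LinearMap.smul_apply,
      smul_eq_mul, Matrix.of_apply, Matrix.transpose_apply, Finset.sum_mul, Finset.mul_sum]
    refine Finset.sum_congr rfl fun a _ => Finset.sum_congr rfl fun b _ => ?_
    ring
  have hdet := congrArg Matrix.det this
  rw [Matrix.det_mul, Matrix.det_mul, Matrix.det_one] at hdet
  exact IsUnit.of_mul_eq_one ((Matrix.of G).det * (Matrix.of N).transpose.det)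
    (by refine Eq.trans ?_ hdet; ring)

lemma mem_basicOpen_of_isUnit_pull (f : T ⟶ S) {U : S.left.Opens} {W : T.left.Opens}
    (h : W ≤ f.left ⁻¹ᵁ U) (a : Γ(S.left, U)) (ha : IsUnit ((f.left.appLE U W h).hom a))
    {t : T.left} (ht : t ∈ W) : f.left.base t ∈ S.left.basicOpen a := by
  have h1 := T.left.basicOpen_of_isUnit ha
  have h2 : t ∈ T.left.basicOpen ((f.left.appLE U W h).hom a) := by rwa [h1]
  rw [Scheme.Hom.appLE, CommRingCat.hom_comp, RingHom.comp_apply] at h2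
  erw [Scheme.basicOpen_res] at h2
  have h3 := h2.2
  rw [← Scheme.preimage_basicOpen] at h3
  exact h3

omit [FiniteDimensional (ZMod p) V] in
lemma chartDual_mem_span {R : Type*} [CommRing R] [Algebra (ZMod p) R]
    (x : Option (Fin d) → R ⊗[ZMod p] V) (i : Option (Fin d)) :
    chartDual B c x i ∈ Submodule.span R (Set.range fun i => (1 : R) ⊗ₜ[ZMod p] c i) := by
  have h : ∀ i, (1 : R) ⊗ₜ[ZMod p] c i ∈
    Submodule.span R (Set.range fun i => (1 : R) ⊗ₜ[ZMod p] c i) :=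
    fun i => Submodule.subset_span ⟨i, rfl⟩
  cases i with
  | some i => exact h _
  | none => exact Submodule.sub_mem _ (h _) (Submodule.sum_mem _ fun j _ =>
      Submodule.smul_mem _ _ (h _))

omit [FiniteDimensional (ZMod p) V] in
lemma Subsheaf.IsFrame.isUnit_det {L : Subsheaf p V S} {U : S.left.Opens} {ι : Type*} [Fintype ι]
    [DecidableEq ι] {v w v' w' : ι → Sect p V S U} (h : IsFrame B L U v w)
    (h' : IsFrame B L U v' w') {f : ι → V}
    (hw : ∀ i, w i ∈ Submodule.span Γ(S.left, U)
      (Set.range fun i => (1 : Γ(S.left, U)) ⊗ₜ[ZMod p] f i)) :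
    IsUnit (Matrix.of fun i j => B.baseChange Γ(S.left, U) (1 ⊗ₜ f i) (v' j)).det := by
  refine isUnit_det_of_dual hw (fun i => ?_) h.dual
  have := h'.span U le_rfl
  simp only [res_refl] at this
  rw [this]
  exact h.mem i

/-- The formation of `chartOpen` commutes with pull-back. -/
lemma mem_chartOpen_of_pullback (hB : B.Nondegenerate) (hP : P ∈ moduliSet B d S) (f : T ⟶ S)
    {t : T.left} (ht : t ∈ chartOpen B c (pullbackPair f P)) :
    f.left.base t ∈ chartOpen B c P := by
  obtain ⟨W, htW, x, hx⟩ := mem_chartOpen.mp ht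
  obtain ⟨U, hU, c', y, hy⟩ := exists_isChartFrame hB hP (f.left.base t)
  let N := W ⊓ f.left ⁻¹ᵁ U
  have hN : N ≤ f.left ⁻¹ᵁ U := inf_le_right
  have htN : t ∈ N := ⟨htW, hU⟩
  have hxN := hx.res (inf_le_left : N ≤ W)
  have hyN := hy.pullback hB f hN
  -- Lying in the chart `c` amounts to the invertibility of two determinants computed in any frame
  -- `y` of this kind: one for `ℒ_d`, one for `ℒ_{d+1}`. Being invertible at `t` after pull-back,
  -- they are nonzero at the image of `t`.
  have u1 := hxN.fst.isUnit_det hyN.fst (f := fun i => c (some i)) fun i =>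
    Submodule.subset_span ⟨i, rfl⟩
  have u2 := hxN.snd.isUnit_det hyN.snd (f := c) fun i => chartDual_mem_span _ i
  have e1 := map_det_baseChange (B := B) (toAlgHom p (f.left.appLE U N hN).hom)
    (fun i => c (some i)) fun i => y (some i)
  have e2 := map_det_baseChange (B := B) (toAlgHom p (f.left.appLE U N hN).hom) c y
  have m1 := mem_basicOpen_of_isUnit_pull f hN _ (e1 ▸ u1) htN
  have m2 := mem_basicOpen_of_isUnit_pull f hN _ (e2 ▸ u2) htN
  set D1 := (Matrix.of fun i j => B.baseChange Γ(S.left, U) (1 ⊗ₜ c (some i)) (y (some j))).det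
  set D2 := (Matrix.of fun i j => B.baseChange Γ(S.left, U) (1 ⊗ₜ c i) (y j)).det
  let N' := S.left.basicOpen D1 ⊓ S.left.basicOpen D2
  have hN1 : N' ≤ S.left.basicOpen D1 := inf_le_left
  have hN2 : N' ≤ S.left.basicOpen D2 := inf_le_right
  have hN' : N' ≤ U := hN1.trans (S.left.basicOpen_le D1)
  have unit : ∀ D : Γ(S.left, U), N' ≤ S.left.basicOpen D →
      IsUnit ((S.left.presheaf.map (homOfLE hN').op).hom D) := by
    intro D hD
    have e : (homOfLE hN').op = (homOfLE (S.left.basicOpen_le D)).op ≫ (homOfLE hD).op := rfl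
    rw [e, Functor.map_comp, CommRingCat.hom_comp, RingHom.comp_apply]
    exact (RingedSpace.isUnit_res_basicOpen S.left.toRingedSpace D).map _
  have hyN' := hy.res hN'
  obtain ⟨l, hl, hcl⟩ := exists_normalized (B := B) (v := fun i => res p V hN' (y (some i)))
    (fun i => c (some i)) (map_det_baseChange (B := B)
      (toAlgHom p (S.left.presheaf.map (homOfLE hN').op).hom) (fun i => c (some i))
      (fun i => y (some i)) ▸ unit D1 hN1)
  obtain ⟨m, hm, hcm⟩ := exists_normalized (B := B) (v := fun i => res p V hN' (y i))
    c (map_det_baseChange (B := B)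
      (toAlgHom p (S.left.presheaf.map (homOfLE hN').op).hom) c y ▸ unit D2 hN2)
  have s1 := hyN'.fst.span N' le_rfl
  have s2 := hyN'.snd.span N' le_rfl
  simp only [res_refl] at s1 s2
  rw [s1] at hl
  rw [s2] at hm
  -- Only the last vector of the normalised basis of `ℒ_{d+1}` is used; the others are taken in
  -- `ℒ_d`, as a chart requires.
  let z : Option (Fin d) → Sect p V S N' := fun i => i.elim (m none) l
  have h2 : ∀ j : Fin d, B.baseChange Γ(S.left, N') (1 ⊗ₜ c (some j)) (z none) = 0 :=
    fun j => (hcm (some j) none).trans (if_neg (by simp))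
  have h3 : B.baseChange Γ(S.left, N') (1 ⊗ₜ c none) (z none) = 1 :=
    (hcm none none).trans (if_pos rfl)
  refine mem_chartOpen.mpr ⟨N', ⟨m1, m2⟩, z, isChartFrame_of_isFrame hB hP h2 h3
    (hyN'.fst.of_card_eq hcl rfl hl) (hyN'.snd.of_card_eq (chartDual_spec hcl h2 h3) rfl ?_)⟩
  rintro (_ | i)
  · exact hm none
  · exact hyN'.le le_rfl (hl i)

end OrthDL

end

/-! ### Charts as affine schemes -/

noncomputable section

namespace OrthDL

open Subsheaf

section Pair

variable {p : ℕ} [Fact p.Prime] {k : Type u} [Field k] [Algebra (ZMod p) k]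
  {V : Type v} [AddCommGroup V] [Module (ZMod p) V] {S T : Sch k} {d : ℕ}

/-- The pair of subsheaves generated by global sections. -/
def pairOfSect (x : Option (Fin d) → Sect p V S ⊤) : Subsheaf p V S × Subsheaf p V S :=
  (gen fun _ => Set.range fun i : Fin d => res p V le_top (x (some i)),
    gen fun _ => Set.range fun i => res p V le_top (x i))

lemma isChartFrame_pairOfSect [FiniteDimensional (ZMod p) V] {B : LinearMap.BilinForm (ZMod p) V}
    (hB : B.Nondegenerate) {c : Chart V d} {x : Option (Fin d) → Sect p V S ⊤}
    (hx : IsChartPoint B c x) : IsChartFrame B c (pairOfSect x) ⊤ x where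
  point := hx
  fst := by
    refine isFrame_gen hB hx.some_some (fun i => subset_gen _ ⟨i, res_refl _⟩) ?_
    rintro U' W - hU' _ ⟨i, rfl⟩
    rw [res_res]
    exact Submodule.subset_span ⟨i, rfl⟩
  snd := by
    refine isFrame_gen hB hx.dual (fun i => subset_gen _ ⟨i, res_refl _⟩) ?_
    rintro U' W - hU' _ ⟨i, rfl⟩
    rw [res_res]
    exact Submodule.subset_span ⟨i, rfl⟩

/-- The ring homomorphism attached to a morphism to an affine scheme. -/
def coHom {X : Scheme.{u}} {A : CommRingCat.{u}} (q : X ⟶ Spec A) : A →+* Γ(X, ⊤) :=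
  ((Scheme.ΓSpecIso A).inv ≫ q.appTop).hom

lemma coHom_injective {X : Scheme.{u}} {A : CommRingCat.{u}} {q q' : X ⟶ Spec A}
    (h : coHom q = coHom q') : q = q' := by
  apply ext_of_isAffine
  have := CommRingCat.hom_ext h
  rwa [Iso.cancel_iso_inv_left] at this

lemma exists_coHom_eq {X : Scheme.{u}} {A : CommRingCat.{u}} (g : A →+* Γ(X, ⊤)) :
    ∃ q : X ⟶ Spec A, coHom q = g := by
  refine ⟨X.toSpecΓ ≫ Spec.map (CommRingCat.ofHom g), ?_⟩
  rw [coHom, Scheme.Hom.comp_appTop, ← Category.assoc, ← Scheme.ΓSpecIso_inv_naturality,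
    Scheme.toSpecΓ_appTop, Category.assoc, Iso.inv_hom_id, Category.comp_id]
  rfl

lemma coHom_comp_specMap {X : Scheme.{u}} {A A' : CommRingCat.{u}} (q : X ⟶ Spec A)
    (α : A' ⟶ A) : coHom (q ≫ Spec.map α) = (coHom q).comp α.hom := by
  rw [coHom, Scheme.Hom.comp_appTop, ← Category.assoc, ← Scheme.ΓSpecIso_inv_naturality]
  rfl

lemma coHom_hom (T : Sch k) : coHom T.hom = structureHom T ⊤ := by
  rw [structureHom, ← CommRingCat.hom_comp, coHom, Scheme.Hom.appTop, Scheme.Hom.app_eq_appLE]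
  rfl

end Pair

section ChartScheme

variable {p : ℕ} [Fact p.Prime] (k : Type u) [Field k] [Algebra (ZMod p) k]
  {V : Type v} [AddCommGroup V] [Module (ZMod p) V] [FiniteDimensional (ZMod p) V]
  {B : LinearMap.BilinForm (ZMod p) V} (hB : B.Nondegenerate) {d : ℕ} (c : Chart V d)
  {T : Sch k}

/-- The chart `c` as a scheme. -/
def chartScheme : Sch k :=
  Over.mk (Spec.map (CommRingCat.ofHom (algebraMap k (ChartRing k hB c))))

/-- The coordinate ring of a chart, as global sections of the corresponding scheme. -/
def chartRingHom : ChartRing k hB c →+* Γ((chartScheme k hB c).left, ⊤) :=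
  (Scheme.ΓSpecIso (CommRingCat.of (ChartRing k hB c))).inv.hom

/-- The universal point of a chart, as a family of sections on the corresponding scheme. -/
def chartSect (i : Option (Fin d)) : Sect p V (chartScheme k hB c) ⊤ :=
  mapV V (toAlgHom p (chartRingHom k hB c)) (chartPoint k hB c i)

/-- The universal pair on a chart. -/
def chartPair : Subsheaf p V (chartScheme k hB c) × Subsheaf p V (chartScheme k hB c) :=
  pairOfSect (chartSect k hB c)

lemma isChartFrame_chartPair :
    IsChartFrame B c (chartPair k hB c) ⊤ (chartSect k hB c) :=
  isChartFrame_pairOfSect hB ((isChartPoint_chartPoint k hB c).map _)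

variable {k c}

/-- The ring homomorphism attached to a morphism to a chart. -/
def chartCoHom (q : T ⟶ chartScheme k hB c) : ChartRing k hB c →+* Γ(T.left, ⊤) :=
  coHom (A := .of (ChartRing k hB c)) q.left

lemma pull_chartSect (q : T ⟶ chartScheme k hB c) (i : Option (Fin d)) :
    pull p V q (le_refl ⊤) (chartSect k hB c i) =
      mapV V (toAlgHom p (chartCoHom hB q)) (chartPoint k hB c i) := by
  refine mapV_toAlgHom_comp (chartRingHom k hB c) (q.left.appLE ⊤ ⊤ le_rfl).hom _ ?_ _
  change _ = ((Scheme.ΓSpecIso (CommRingCat.of (ChartRing k hB c))).inv ≫ q.left.app ⊤).hom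
  rw [Scheme.Hom.app_eq_appLE]
  rfl

lemma chartCoHom_comp (q : T ⟶ chartScheme k hB c) :
    (chartCoHom hB q).comp (algebraMap k _) = structureHom T ⊤ := by
  rw [← coHom_hom, ← Over.w q]
  exact (coHom_comp_specMap (A := .of (ChartRing k hB c)) q.left
    (CommRingCat.ofHom (algebraMap k (ChartRing k hB c)))).symm

/-- With `hom_chartScheme_ext`, the chart represents the pairs admitting a chart point over all of
`T`: morphisms to an affine scheme are ring homomorphisms to `Γ(T, ⊤)`. -/
lemma exists_hom_chartScheme {P : Subsheaf p V T × Subsheaf p V T}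
    {x : Option (Fin d) → Sect p V T ⊤} (hx : IsChartFrame B c P ⊤ x) :
    ∃ q : T ⟶ chartScheme k hB c, pullbackPair q (chartPair k hB c) = P := by
  obtain ⟨g, hg, hgx⟩ := exists_chartRing_lift hB (structureHom T ⊤) hx.point
  obtain ⟨q₀, hq₀⟩ := exists_coHom_eq (A := .of (ChartRing k hB c)) g
  have hw : q₀ ≫ (chartScheme k hB c).hom = T.hom := by
    apply coHom_injective
    rw [coHom_hom, ← hg, ← hq₀]
    exact coHom_comp_specMap (A := .of (ChartRing k hB c)) q₀
      (CommRingCat.ofHom (algebraMap k (ChartRing k hB c)))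
  let q : T ⟶ chartScheme k hB c := Over.homMk q₀ hw
  have hq : chartCoHom hB q = g := hq₀
  refine ⟨q, IsChartFrame.ext_of_local fun s => ⟨⊤, trivial, c, x, ?_, hx⟩⟩
  have := (isChartFrame_chartPair k hB c).pullback hB q (le_refl ⊤)
  simp only [pull_chartSect, hq, hgx] at this
  exact this

lemma hom_chartScheme_ext {q q' : T ⟶ chartScheme k hB c}
    (h : pullbackPair q (chartPair k hB c) = pullbackPair q' (chartPair k hB c)) : q = q' := by
  have h1 := (isChartFrame_chartPair k hB c).pullback hB q (le_refl ⊤)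
  have h2 := (isChartFrame_chartPair k hB c).pullback hB q' (le_refl ⊤)
  change IsChartFrame B c (pullbackPair q _) ⊤ _ at h1
  rw [h] at h1
  have h3 := h1.unique h2
  have h4 : chartCoHom hB q = chartCoHom hB q' := by
    refine chartRing_hom_ext hB ?_ fun i => ?_
    · rw [chartCoHom_comp, chartCoHom_comp]
    · rw [← pull_chartSect, ← pull_chartSect]
      exact congrFun h3 i
  ext1
  exact coHom_injective (A := .of (ChartRing k hB c)) h4

lemma chartPair_mem_moduliSet (hV : Module.finrank (ZMod p) V = 2 * (d + 1))
    (hs : B.IsSymm) (hns : IsNonsplit B d) :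
    chartPair k hB c ∈ moduliSet B d (chartScheme k hB c) :=
  mem_moduliSet_of_isChartFrame hV hB hs hns fun _ =>
    ⟨⊤, trivial, c, _, isChartFrame_chartPair k hB c⟩

lemma smooth_chartScheme (hp : p ≠ 2) (hV : Module.finrank (ZMod p) V = 2 * (d + 1))
    (hs : B.IsSymm) (hns : IsNonsplit B d) : Smooth (chartScheme k hB c).hom := by
  have h1 : Algebra.FormallySmooth k (ChartRing k hB c) :=
    chartRing_formallySmooth hB hp hV hs hns
  have h2 : Algebra.Smooth k (ChartRing k hB c) := {}
  have h3 : (algebraMap k (ChartRing k hB c)).Smooth := RingHom.smooth_algebraMap.mpr h2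
  exact (HasRingHomProperty.Spec_iff (P := @Smooth)).mpr h3

end ChartScheme

end OrthDL

end

/-! ### The moduli problem as a functor on all schemes -/

noncomputable section

namespace OrthDL

/-- `(V, B)` is a nonsplit quadratic space of dimension `2 (d + 1)`. -/
structure IsNonsplitSpace {p : ℕ} [Fact p.Prime] {V : Type v} [AddCommGroup V]
    [Module (ZMod p) V] (B : LinearMap.BilinForm (ZMod p) V) (d : ℕ) : Prop where
  finrank_eq : Module.finrank (ZMod p) V = 2 * (d + 1)
  isSymm : B.IsSymm
  nondegenerate : B.Nondegenerate
  isNonsplit : IsNonsplit B d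

variable {p : ℕ} [Fact p.Prime] (k : Type u) [Field k] [Algebra (ZMod p) k]
  {V : Type v} [AddCommGroup V] [Module (ZMod p) V]
  (B : LinearMap.BilinForm (ZMod p) V) (d : ℕ)

/-- A `k`-structure on a scheme `X` together with an element of `𝒴_V(X)`. -/
structure Datum (X : Scheme.{u}) where
  /-- The structure morphism. -/
  str : X ⟶ Spec (CommRingCat.of k)
  /-- The pair of subsheaves. -/
  pair : Subsheaf p V (Over.mk str) × Subsheaf p V (Over.mk str)
  mem : pair ∈ moduliSet B d (Over.mk str)

/-- The space `V` lives in the universe `v`, whereas the functor to be represented takes values in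
`Type u`; finite dimension gives the required smallness. -/
instance [FiniteDimensional (ZMod p) V] (S : Sch k) (U : S.left.Opens) :
    Small.{u} (Sect p V S U) :=
  small_of_injective
    ((Module.finBasis (ZMod p) V).baseChange Γ(S.left, U)).equivFun.injective

instance [FiniteDimensional (ZMod p) V] (S : Sch k) : Small.{u} (Subsheaf p V S) :=
  small_of_injective (f := fun L U => (L.sec U : Set (Sect p V S U))) fun L M h => by
    ext1
    funext U
    exact SetLike.coe_injective (congrFun h U)

instance [FiniteDimensional (ZMod p) V] (X : Scheme.{u}) : Small.{u} (Datum k B d X) :=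
  small_of_injective (β := Σ π : X ⟶ Spec (CommRingCat.of k),
      Subsheaf p V (Over.mk π) × Subsheaf p V (Over.mk π))
    (f := fun x => ⟨x.str, x.pair⟩) fun x y h => by
      cases x
      cases y
      cases h
      rfl

variable {k B d}

/-- The datum given by an element of `𝒴_V(S)`. -/
def Datum.ofSch {S : Sch k} {P : Subsheaf p V S × Subsheaf p V S} (hP : P ∈ moduliSet B d S) :
    Datum k B d S.left := ⟨S.hom, P, hP⟩

lemma Datum.ofSch_injective {S : Sch k} {P Q : Subsheaf p V S × Subsheaf p V S}
    {hP : P ∈ moduliSet B d S} {hQ : Q ∈ moduliSet B d S} (h : ofSch hP = ofSch hQ) : P = Q := by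
  have := (Datum.mk.injEq _ _ _ _ _ _).mp h
  exact eq_of_heq this.2

variable [FiniteDimensional (ZMod p) V] (hB : IsNonsplitSpace B d)

namespace IsNonsplitSpace

include hB in
lemma pullbackPair_mem {S T : Sch k} {P : Subsheaf p V S × Subsheaf p V S}
    (hP : P ∈ moduliSet B d S) (f : T ⟶ S) : pullbackPair f P ∈ moduliSet B d T :=
  pullbackPair_mem_moduliSet hB.finrank_eq hB.nondegenerate hB.isSymm hB.isNonsplit hP f

/-- The pull-back of data. -/
def map {X Y : Scheme.{u}} (f : Y ⟶ X) (x : Datum k B d X) : Datum k B d Y where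
  str := f ≫ x.str
  pair := pullbackPair (Over.homMk f : Over.mk (f ≫ x.str) ⟶ Over.mk x.str) x.pair
  mem := hB.pullbackPair_mem x.mem _

lemma map_eq_iff {X Y : Scheme.{u}} {f : Y ⟶ X} {x : Datum k B d X} {y : Datum k B d Y} :
    hB.map f x = y ↔ ∃ h : f ≫ x.str = y.str,
      pullbackPair (Over.homMk f h : Over.mk y.str ⟶ Over.mk x.str) x.pair = y.pair := by
  constructor
  · rintro rfl
    exact ⟨rfl, rfl⟩
  · obtain ⟨π, P, hP⟩ := y
    rintro ⟨h, h'⟩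
    dsimp only at h
    subst h
    dsimp only at h'
    subst h'
    rfl

lemma map_id {X : Scheme.{u}} (x : Datum k B d X) : hB.map (𝟙 X) x = x :=
  (map_eq_iff hB).mpr ⟨Category.id_comp _, pullbackPair_id _⟩

lemma map_comp {X Y Z : Scheme.{u}} (f : Y ⟶ X) (g : Z ⟶ Y) (x : Datum k B d X) :
    hB.map (g ≫ f) x = hB.map g (hB.map f x) :=
  (map_eq_iff hB).mpr ⟨Category.assoc _ _ _, pullbackPair_comp
    (Over.homMk f : Over.mk (f ≫ x.str) ⟶ Over.mk x.str)
    (Over.homMk g : Over.mk (g ≫ f ≫ x.str) ⟶ Over.mk (f ≫ x.str)) _⟩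

lemma map_ofSch {S T : Sch k} {P : Subsheaf p V S × Subsheaf p V S} (hP : P ∈ moduliSet B d S)
    (f : T ⟶ S) :
    hB.map f.left (Datum.ofSch hP) = Datum.ofSch (hB.pullbackPair_mem hP f) :=
  (map_eq_iff hB).mpr ⟨Over.w f, rfl⟩

lemma eq_of_map_eq {X : Scheme.{u}} (𝒰 : X.OpenCover) {x y : Datum k B d X}
    (h : ∀ i, hB.map (𝒰.f i) x = hB.map (𝒰.f i) y) : x = y := by
  have hstr : x.str = y.str := 𝒰.hom_ext _ _ fun i => ((map_eq_iff hB).mp (h i)).1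
  obtain ⟨π, P, hP⟩ := x
  obtain ⟨π', Q, hQ⟩ := y
  dsimp only at hstr
  subst hstr
  let f : ∀ i, Over.mk (𝒰.f i ≫ π) ⟶ Over.mk π := fun i => Over.homMk (𝒰.f i)
  have key : ∀ i, pullbackPair (f i) P = pullbackPair (f i) Q := fun i =>
    ((map_eq_iff hB).mp (h i)).2
  have him : ∀ i, IsOpenImmersion (f i).left := fun i => 𝒰.map_prop i
  have hcov : ∀ s : (Over.mk π).left, ∃ i, s ∈ (f i).left.opensRange := fun s => 𝒰.exists_eq s
  have hPQ : P = Q := Prod.ext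
    (Subsheaf.eq_of_pullback_eq f hcov fun i => congrArg Prod.fst (key i))
    (Subsheaf.eq_of_pullback_eq f hcov fun i => congrArg Prod.snd (key i))
  subst hPQ
  rfl

lemma exists_of_compatible {X : Scheme.{u}} (𝒰 : X.OpenCover)
    (x : ∀ i, Datum k B d (𝒰.X i))
    (h : ∀ (i j) (Z : Scheme.{u}) (a : Z ⟶ 𝒰.X i) (b : Z ⟶ 𝒰.X j), a ≫ 𝒰.f i = b ≫ 𝒰.f j →
      hB.map a (x i) = hB.map b (x j)) :
    ∃ y : Datum k B d X, ∀ i, hB.map (𝒰.f i) y = x i := by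
  -- The structure morphisms are glued first, so that the pairs can be glued over a fixed
  -- `k`-scheme.
  let π : X ⟶ Spec (CommRingCat.of k) := 𝒰.glueMorphisms (fun i => (x i).str) fun i j =>
    congrArg Datum.str (h i j _ _ _ Limits.pullback.condition)
  have hπ : ∀ i, 𝒰.f i ≫ π = (x i).str := fun i => 𝒰.ι_glueMorphisms _ _ i
  let f : ∀ i, Over.mk (x i).str ⟶ Over.mk π := fun i => Over.homMk (𝒰.f i) (hπ i)
  have him : ∀ i, IsOpenImmersion (f i).left := fun i => 𝒰.map_prop i
  obtain ⟨Q, hQ, hQx⟩ := exists_glue_moduliSet hB.finrank_eq hB.nondegenerate hB.isSymm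
    hB.isNonsplit f (fun s => 𝒰.exists_eq s) (fun i => (x i).pair) (fun i => (x i).mem) (by
      intro i j Z a b hab
      have e := h i j Z.left a.left b.left (congrArg CommaMorphism.left hab)
      have e1 := hB.map_ofSch (x i).mem a
      have e2 := hB.map_ofSch (x j).mem b
      exact Datum.ofSch_injective (e1.symm.trans (e.trans e2)))
  exact ⟨⟨π, Q, hQ⟩, fun i => (map_eq_iff hB).mpr ⟨hπ i, hQx i⟩⟩

section Chart

variable (k) (c : Chart V d)

/-- The universal datum on a chart. -/
def chartDatum : Datum k B d (chartScheme k hB.nondegenerate c).left :=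
  .ofSch (chartPair_mem_moduliSet hB.nondegenerate hB.finrank_eq hB.isSymm hB.isNonsplit)

variable {k c}

lemma map_chartDatum_injective {X : Scheme.{u}}
    {a b : X ⟶ (chartScheme k hB.nondegenerate c).left}
    (h : hB.map a (hB.chartDatum k c) = hB.map b (hB.chartDatum k c)) : a = b := by
  obtain ⟨hw, h'⟩ := (map_eq_iff hB).mp h
  let C := chartScheme k hB.nondegenerate c
  let q : Over.mk (b ≫ C.hom) ⟶ C := Over.homMk a hw
  let q' : Over.mk (b ≫ C.hom) ⟶ C := Over.homMk b
  have e : q = q' := hom_chartScheme_ext hB.nondegenerate h'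
  exact congrArg CommaMorphism.left e

lemma exists_map_chartDatum_eq {X : Scheme.{u}} {x : Datum k B d X}
    {y : Option (Fin d) → Sect p V (Over.mk x.str) ⊤} (h : IsChartFrame B c x.pair ⊤ y) :
    ∃ q : X ⟶ (chartScheme k hB.nondegenerate c).left, hB.map q (hB.chartDatum k c) = x := by
  obtain ⟨q, hq⟩ := exists_hom_chartScheme hB.nondegenerate h
  exact ⟨q.left, (map_eq_iff hB).mpr ⟨Over.w q, hq⟩⟩

lemma exists_map_chartDatum_eq_map_ι {X : Scheme.{u}} (x : Datum k B d X) (c : Chart V d) :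
    ∃ q : (chartOpen B c x.pair : X.Opens).toScheme ⟶ (chartScheme k hB.nondegenerate c).left,
      hB.map q (hB.chartDatum k c) = hB.map (chartOpen B c x.pair : X.Opens).ι x := by
  obtain ⟨y, hy⟩ := exists_isChartFrame_chartOpen (c := c) (P := x.pair) hB.nondegenerate
  let U : X.Opens := chartOpen B c x.pair
  let f : Over.mk (U.ι ≫ x.str) ⟶ Over.mk x.str := Over.homMk U.ι
  have hU : ⊤ ≤ f.left ⁻¹ᵁ chartOpen B c x.pair := fun z _ => z.2
  exact hB.exists_map_chartDatum_eq (hy.pullback hB.nondegenerate f hU)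

/-- Together with `exists_map_chartDatum_eq_map_ι`, this identifies the fibre product of `X` with
the chart as the open subscheme `chartOpen`. -/
lemma range_le_chartOpen {X Z : Scheme.{u}} {x : Datum k B d X}
    {a : Z ⟶ (chartScheme k hB.nondegenerate c).left} {b : Z ⟶ X}
    (h : hB.map a (hB.chartDatum k c) = hB.map b x) (z : Z) :
    b.base z ∈ (chartOpen B c x.pair : X.Opens) := by
  obtain ⟨hw, h'⟩ := (map_eq_iff hB).mp h
  let f : Over.mk (b ≫ x.str) ⟶ Over.mk x.str := Over.homMk b
  refine mem_chartOpen_of_pullback (t := z) hB.nondegenerate x.mem f ?_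
  change z ∈ chartOpen B c (hB.map b x).pair
  rw [← h']
  exact mem_chartOpen.mpr ⟨⊤, trivial, _, (isChartFrame_chartPair k hB.nondegenerate c).pullback
    hB.nondegenerate _ (le_refl ⊤)⟩

end Chart

end IsNonsplitSpace

end OrthDL

end

/-! ### The Zariski sheaf of data and its open charts -/

noncomputable section

namespace OrthDL

namespace IsNonsplitSpace

open Opposite

variable {p : ℕ} [Fact p.Prime] (k : Type u) [Field k] [Algebra (ZMod p) k]
  {V : Type v} [AddCommGroup V] [Module (ZMod p) V] [FiniteDimensional (ZMod p) V]
  {B : LinearMap.BilinForm (ZMod p) V} {d : ℕ} (hB : IsNonsplitSpace B d)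

/-- The functor of data. -/
def functor : Scheme.{u}ᵒᵖ ⥤ Type u where
  obj X := Shrink.{u} (Datum k B d X.unop)
  map f := ↾fun x => equivShrink _ (hB.map f.unop ((equivShrink _).symm x))
  map_id X := by
    ext x
    refine congrArg (equivShrink _).symm ?_
    change equivShrink _ (hB.map (𝟙 _) ((equivShrink _).symm x)) = x
    rw [map_id, Equiv.apply_symm_apply]
  map_comp f g := by
    ext x
    refine congrArg (equivShrink _).symm ?_
    change equivShrink _ (hB.map (g.unop ≫ f.unop) ((equivShrink _).symm x)) =
      equivShrink _ (hB.map g.unop ((equivShrink _).symm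
        (equivShrink _ (hB.map f.unop ((equivShrink _).symm x)))))
    rw [map_comp, Equiv.symm_apply_apply]

variable {k}

/-- The datum given by a section of `functor`. -/
def toDatum {X : Scheme.{u}} : (hB.functor k).obj (op X) ≃ Datum k B d X := (equivShrink _).symm

lemma toDatum_map {X Y : Scheme.{u}} (f : Y ⟶ X) (x : (hB.functor k).obj (op X)) :
    hB.toDatum ((hB.functor k).map f.op x) = hB.map f (hB.toDatum x) :=
  (equivShrink _).symm_apply_apply _

lemma isSheaf_functor : Presheaf.IsSheaf Scheme.zariskiTopology.{u} (hB.functor k) := by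
  rw [isSheaf_iff_isSheaf_of_type, Scheme.zariskiTopology, Scheme.grothendieckTopology,
    Precoverage.isSheaf_toGrothendieck_iff_of_isStableUnderBaseChange]
  rintro X S hS
  obtain ⟨(𝒰 : X.OpenCover), rfl⟩ := Scheme.exists_cover_of_mem_pretopology hS
  rw [Presieve.isSheafFor_arrows_iff]
  intro x hx
  obtain ⟨y, hy⟩ := hB.exists_of_compatible 𝒰 (fun i => hB.toDatum (x i)) (by
    intro i j Z a b hab
    rw [← toDatum_map, ← toDatum_map, hx i j Z a b hab])
  refine ⟨hB.toDatum.symm y, fun i => ?_, fun z hz => ?_⟩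
  · apply hB.toDatum.injective
    rw [toDatum_map, Equiv.apply_symm_apply, hy]
  · rw [Equiv.eq_symm_apply]
    refine hB.eq_of_map_eq 𝒰 fun i => ?_
    rw [hy, ← toDatum_map, hz]

variable (k)

/-- The functor of data as a sheaf. -/
def sheaf : Sheaf Scheme.zariskiTopology.{u} (Type u) := ⟨hB.functor k, hB.isSheaf_functor⟩

/-- The morphism to `functor` given by a chart. -/
def chartMap (c : Chart V d) :
    yoneda.obj (chartScheme k hB.nondegenerate c).left ⟶ (hB.sheaf k).1 :=
  yonedaEquiv.symm (hB.toDatum.symm (hB.chartDatum k c) :)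

variable {k}

lemma toDatum_chartMap {c : Chart V d} {X : Scheme.{u}}
    (q : X ⟶ (chartScheme k hB.nondegenerate c).left) :
    hB.toDatum ((hB.chartMap k c).app (op X) q) = hB.map q (hB.chartDatum k c) := by
  have : (hB.chartMap k c).app (op X) q =
    (hB.functor k).map q.op (hB.toDatum.symm (hB.chartDatum k c)) := rfl
  rw [this, toDatum_map, Equiv.apply_symm_apply]

lemma isOpenImmersion_chartMap (c : Chart V d) : IsOpenImmersion.presheaf (hB.chartMap k c) := by
  apply MorphismProperty.relative.of_exists
  intro X g
  let x : Datum k B d X := hB.toDatum (yonedaEquiv g)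
  have hg : ∀ {Z : Scheme.{u}} (b : Z ⟶ X), hB.toDatum (g.app (op Z) b) = hB.map b x := by
    intro Z b
    rw [← toDatum_map]
    congr 1
    exact (yonedaEquiv_naturality' g b.op).symm
  let U : X.Opens := chartOpen B c x.pair
  obtain ⟨q, hq⟩ := hB.exists_map_chartDatum_eq_map_ι x c
  -- The fibre product is `U` itself; on points, existence comes from `range_le_chartOpen` and
  -- uniqueness from `U.ι` being a monomorphism.
  refine ⟨U.toScheme, yoneda.map q, U.ι, ?_, inferInstance⟩
  refine IsPullback.of_forall_isPullback_app fun Z => ?_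
  rw [Limits.Types.isPullback_iff]
  refine ⟨?_, ?_, ?_⟩
  · ext a
    apply hB.toDatum.injective
    change hB.toDatum ((hB.chartMap k c).app Z (a ≫ q)) = hB.toDatum (g.app Z (a ≫ U.ι))
    rw [hg]
    refine (hB.toDatum_chartMap _).trans ?_
    rw [map_comp, map_comp, hq]
  · rintro a b ⟨-, h⟩
    exact (cancel_mono U.ι).mp h
  · intro a b hab
    have hab' : hB.map a (hB.chartDatum k c) = hB.map b x := by
      rw [← hg, ← toDatum_chartMap]
      exact congrArg hB.toDatum hab
    have hr : Set.range b.base ⊆ Set.range U.ι.base := by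
      rintro _ ⟨z, rfl⟩
      rw [Scheme.Opens.range_ι]
      exact hB.range_le_chartOpen hab' z
    let l := IsOpenImmersion.lift U.ι b hr
    have hl : l ≫ U.ι = b := IsOpenImmersion.lift_fac _ _ _
    refine ⟨l, hB.map_chartDatum_injective ?_, hl⟩
    change hB.map (l ≫ q) _ = _
    rw [map_comp, hq, ← map_comp, hl, hab']

end IsNonsplitSpace

end OrthDL

end

/-! ### Representability and smoothness -/

noncomputable section

namespace OrthDL

variable {p : ℕ} [Fact p.Prime] {k : Type u} [Field k] [Algebra (ZMod p) k]
  {V : Type v} [AddCommGroup V] [Module (ZMod p) V]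
  {B : LinearMap.BilinForm (ZMod p) V} {d : ℕ}

namespace IsNonsplitSpace

open Opposite

variable [FiniteDimensional (ZMod p) V] (hB : IsNonsplitSpace B d)

lemma isLocallySurjective_chartMap {ι : Type u} {e : ι → Chart V d}
    (he : Function.Surjective e) : Presheaf.IsLocallySurjective Scheme.zariskiTopology.{u}
      (Limits.Sigma.desc fun i => hB.chartMap k (e i)) where
  imageSieve_mem {X} s := by
    let x : Datum k B d X := hB.toDatum s
    let U : ι → X.Opens := fun i => chartOpen B (e i) x.pair
    have hU : TopologicalSpace.IsOpenCover U := by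
      refine top_le_iff.mp fun z _ => TopologicalSpace.Opens.mem_iSup.mpr ?_
      obtain ⟨W, hzW, c, y, hy⟩ := exists_isChartFrame hB.nondegenerate x.mem z
      obtain ⟨i, rfl⟩ := he c
      exact ⟨i, mem_chartOpen.mpr ⟨W, hzW, y, hy⟩⟩
    refine Scheme.mem_grothendieckTopology_iff.mpr ⟨X.openCoverOfIsOpenCover U hU, ?_⟩
    rintro _ _ ⟨i⟩
    obtain ⟨q, hq⟩ := hB.exists_map_chartDatum_eq_map_ι x (e i)
    refine ⟨(Limits.Sigma.ι (fun i => yoneda.obj (chartScheme k hB.nondegenerate (e i)).left) i).app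
      _ q, ?_⟩
    apply hB.toDatum.injective
    have h := ConcreteCategory.congr_hom (congr_app (Limits.Sigma.ι_desc
      (fun i => hB.chartMap k (e i)) i) (op (U i).toScheme)) q
    exact (congrArg hB.toDatum h).trans <| (hB.toDatum_chartMap q).trans (hq.trans (hB.toDatum_map (U i).ι s).symm)

variable (k)

include hB in
/-- There is a universal datum, and its structure morphism is smooth. -/
lemma exists_universal_datum (hp : p ≠ 2) :
    ∃ (Y : Scheme.{u}) (y : Datum k B d Y), Smooth y.str ∧
      ∀ X : Scheme.{u}, Function.Bijective fun f : X ⟶ Y => hB.map f y := by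
  -- Since `V` is a finite set there are finitely many charts, which allows an index type in the
  -- universe `u`.
  have : Finite V := Module.finite_of_finite (ZMod p)
  obtain ⟨n, ⟨e⟩⟩ := Finite.exists_equiv_fin (Chart V d)
  let ε : ULift.{u} (Fin n) → Chart V d := fun i => e.symm i.down
  have hε : Function.Surjective ε := e.symm.surjective.comp ULift.down_surjective
  have hf : ∀ i, IsOpenImmersion.presheaf (hB.chartMap k (ε i)) :=
    fun i => hB.isOpenImmersion_chartMap (ε i)
  have := hB.isLocallySurjective_chartMap (k := k) hε
  let G := Scheme.LocalRepresentability.glueData (F := hB.sheaf k) hf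
  let r : (hB.functor k).RepresentableBy G.glued :=
    Scheme.LocalRepresentability.representableBy (F := hB.sheaf k) hf
  let y : Datum k B d G.glued := hB.toDatum (r.homEquiv (𝟙 _))
  have hr : ∀ {X : Scheme.{u}} (f : X ⟶ G.glued), hB.toDatum (r.homEquiv f) = hB.map f y := by
    intro X f
    rw [r.homEquiv_eq, toDatum_map]
  refine ⟨G.glued, y, ?_, fun X => ?_⟩
  · have : IsZariskiLocalAtSource @Smooth.{u} :=
      HasRingHomProperty.instIsZariskiLocalAtSource (Q := RingHom.Smooth)
    refine (IsZariskiLocalAtSource.iff_of_openCover (P := @Smooth.{u}) G.openCover).mpr fun i => ?_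
    -- The universal datum restricts to the chart datum on each chart; comparing structure morphisms
    -- reduces smoothness to that of the chart.
    have h1 : r.homEquiv (Scheme.LocalRepresentability.toGlued hf i) =
        hB.toDatum.symm (hB.chartDatum k (ε i)) :=
      (Scheme.LocalRepresentability.yonedaGluedToSheaf_app_toGlued hf).trans
        (yonedaEquiv.apply_symm_apply _)
    have h2 := hr (Scheme.LocalRepresentability.toGlued hf i)
    rw [h1, Equiv.apply_symm_apply] at h2
    have h3 := ((map_eq_iff hB).mp h2.symm).1
    change Smooth (Scheme.LocalRepresentability.toGlued hf i ≫ y.str)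
    rw [h3]
    exact smooth_chartScheme hB.nondegenerate hp hB.finrank_eq hB.isSymm hB.isNonsplit
  · simp only [← hr]
    exact hB.toDatum.bijective.comp r.homEquiv.bijective

include hB in
-- Equality of data includes equality of structure morphisms, so the morphisms `f` pulling the
-- universal datum back to one on `S` are automatically `k`-morphisms.
lemma exists_represents (hp : p ≠ 2) :
    ∃ (Y : Sch k) (P : Subsheaf p V Y × Subsheaf p V Y), Represents B d Y P ∧ Smooth Y.hom := by
  obtain ⟨Y, ⟨π, P, hP⟩, hsm, hbij⟩ := hB.exists_universal_datum k hp
  refine ⟨Over.mk π, P, ⟨hP, fun S => ⟨fun f _ => hB.pullbackPair_mem hP f, ?_, ?_⟩⟩, hsm⟩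
  · intro f _ g _ h
    ext1
    apply (hbij S.left).injective
    exact (hB.map_ofSch hP f).trans (Eq.trans (by congr 1) (hB.map_ofSch hP g).symm)
  · intro Q hQ
    obtain ⟨f, hf⟩ := (hbij S.left).surjective (Datum.ofSch hQ)
    obtain ⟨hw, h⟩ := (map_eq_iff hB).mp hf
    exact ⟨Over.homMk f hw, trivial, h⟩

end IsNonsplitSpace

/-- Two schemes representing the same functor are isomorphic. -/
lemma Represents.nonempty_iso {Y Z : Sch k} {P : Subsheaf p V Y × Subsheaf p V Y}
    {Q : Subsheaf p V Z × Subsheaf p V Z} (hP : Represents B d Y P) (hQ : Represents B d Z Q) :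
    Nonempty (Y ≅ Z) := by
  obtain ⟨f, -, hf⟩ := (hQ.2 Y).surjOn hP.1
  obtain ⟨g, -, hg⟩ := (hP.2 Z).surjOn hQ.1
  change pullbackPair f Q = P at hf
  change pullbackPair g P = Q at hg
  refine ⟨⟨f, g, (hP.2 Y).injOn trivial trivial ?_, (hQ.2 Z).injOn trivial trivial ?_⟩⟩
  · change pullbackPair (f ≫ g) P = pullbackPair (𝟙 Y) P
    rw [pullbackPair_comp, hg, hf, pullbackPair_id]
  · change pullbackPair (g ≫ f) Q = pullbackPair (𝟙 Z) Q
    rw [pullbackPair_comp, hf, hg, pullbackPair_id]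

end OrthDL

end

theorem lemma2p1 (p : ℕ) [Fact p.Prime] (hp : p ≠ 2) (d : ℕ)
    (k : Type u) [Field k] [Algebra (ZMod p) k] (hk : Nat.card k = p ^ 2)
    (V : Type v) [AddCommGroup V] [Module (ZMod p) V]
    (hV : Module.finrank (ZMod p) V = 2 * (d + 1))
    (B : LinearMap.BilinForm (ZMod p) V) (hsymm : B.IsSymm) (hnd : B.Nondegenerate)
    (hns : OrthDL.IsNonsplit B d) :
    (∃ (Y : OrthDL.Sch k) (P : OrthDL.Subsheaf p V Y × OrthDL.Subsheaf p V Y),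
      OrthDL.Represents B d Y P) ∧
    ∀ (Y : OrthDL.Sch k) (P : OrthDL.Subsheaf p V Y × OrthDL.Subsheaf p V Y),
      OrthDL.Represents B d Y P → Smooth Y.hom := by
  have : FiniteDimensional (ZMod p) V := Module.finite_of_finrank_pos (by omega)
  have hB : OrthDL.IsNonsplitSpace B d := ⟨hV, hsymm, hnd, hns⟩
  obtain ⟨Y, P, hP, hY⟩ := hB.exists_represents k hp
  refine ⟨⟨Y, P, hP⟩, fun Z Q hQ => ?_⟩
  obtain ⟨e⟩ := hQ.nonempty_iso hP
  have : IsIso e.hom.left := inferInstanceAs (IsIso ((Over.forget _).map e.hom))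
  rw [← Over.w e.hom]
  infer_instance
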